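/- **Lemma 4.5 (Standard Virial Identity).** Let $d\ge 3$, $0<b<2$, $0<\sigma\le\frac{4-2b}{d-2}$ (this includes the energy-critical exponent $\sigma=\frac{4-2b}{d-2}$) and $c>-\left(\frac{d-2}{2}\right)^2$. Let $P_c=-\Delta+c|x|^{-2}$ and, for $f\in H^1(\mathbb R^d)$, let $$\|f\|_{\dot H^1_c}^2=\|P_c^{1/2}f\|_{L^2}^2=\int_{\mathbb R^d}\left(|\nabla f|^2+c|x|^{-2}|f|^2\right)dx .$$ Let $I\subset\mathbb R$ be an interval containing $0$, let $u_0\in H^1(\mathbb R^d)$ with $|x|u_0\in L^2(\mathbb R^d)$, and let $u:I\times\mathbb R^d\to\mathbb C$ be a solution of the focusing INLS$_c$ equation $$iu_t-P_cu=-|x|^{-b}|u|^{\sigma}u,\qquad u(0)=u_0,$$ that is: $u\in C(I,H^1)$, $u(0)=u_0$, the equation holds in the sense of distributions, and $\nabla u\in L^{\gamma(r)}(J,L^r(K))$ for all compact $J\subset I$ and all compact $K\subset\mathbb R^d\setminus\{0\}$, where $$r=\frac{2d(d+2-2b)}{d^2-2db+4},\qquad \frac{2}{\gamma(r)}=\frac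 d2-\frac dr$$ (this last condition holds in particular if $u\in L^{\gamma(r)}(J,H^{1,r}(\mathbb R^d))$ for all compact $J\subset I$). Then $|x|u\in C(I,L^2)$. Moreover, for every $t\in I$ the functions $|x|^{-2}|u(t)|^2$ and $|x|^{-b}|u(t)|^{\sigma+2}$ are integrable, the function $t\mapsto\|xu(t)\|_{L^2}^2$ is twice differentiable on $I$ (one-sidedly at end points belonging to $I$), and for every $t\in I$ $$\frac{d^2}{dt^2}\|xu(t)\|_{L^2}^2=8\|u(t)\|_{\dot H^1_c}^2-\frac{4(d\sigma+2b)}{\sigma+2}\int_{\mathbb R^d}|x|^{-b}|u(t,x)|^{\sigma+2}\,dx .$$ -/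

import Mathlib

open MeasureTheory Filter Topology
open scoped ENNReal ContDiff

noncomputable section

namespace INLS

/-- Euclidean space `ℝ^d`. -/
abbrev Space (d : ℕ) : Type := EuclideanSpace ℝ (Fin d)

/-- Real-valued test functions `C_c^∞(ℝ^d)`. (Testing against real functions is the same as testing
against complex ones, all identities below being linear in the test function.) -/
def IsTest {d : ℕ} (φ : Space d → ℝ) : Prop :=
  ContDiff ℝ ∞ φ ∧ HasCompactSupport φ

/-- The partial derivative `∂_j φ` of a differentiable function. -/
def pderiv {d : ℕ} (j : Fin d) (φ : Space d → ℝ) (x : Space d) : ℝ :=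
  fderiv ℝ φ x (EuclideanSpace.single j (1 : ℝ))

/-- `g` is the weak (distributional) gradient of `f`. -/
def IsWeakGrad {d : ℕ} (f : Space d → ℂ) (g : Space d → EuclideanSpace ℂ (Fin d)) : Prop :=
  LocallyIntegrable f volume ∧ LocallyIntegrable g volume ∧
    ∀ φ : Space d → ℝ, IsTest φ → ∀ j : Fin d,
      ∫ x, pderiv j φ x • f x = - ∫ x, φ x • g x j

open Classical in
/-- The weak gradient of `f` (unique up to null sets); zero if `f` has none. -/
def weakGrad {d : ℕ} (f : Space d → ℂ) : Space d → EuclideanSpace ℂ (Fin d) :=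
  if h : ∃ g, IsWeakGrad f g then h.choose else 0

/-- `f ∈ H¹(ℝ^d)`. -/
def MemH1 {d : ℕ} (f : Space d → ℂ) : Prop :=
  MemLp f 2 volume ∧ (∃ g, IsWeakGrad f g) ∧ MemLp (weakGrad f) 2 volume

/-- `f ∈ C(I, L²(ℝ^d; F))`, for a family `f t` of functions on `ℝ^d`. -/
def ContL2 {d : ℕ} {F : Type*} [NormedAddCommGroup F] (I : Set ℝ) (f : ℝ → Space d → F) : Prop :=
  (∀ t ∈ I, MemLp (f t) 2 volume) ∧
    ∀ t ∈ I, Tendsto (fun s => eLpNorm (f s - f t) 2 volume) (𝓝[I] t) (𝓝 0)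

/-- `u ∈ C(I, H¹(ℝ^d))`. -/
def ContH1 {d : ℕ} (I : Set ℝ) (u : ℝ → Space d → ℂ) : Prop :=
  (∀ t ∈ I, MemH1 (u t)) ∧ ContL2 I u ∧ ContL2 I (fun t => weakGrad (u t))

/-- The square of the `Ḣ¹_c` norm, `‖f‖²_{Ḣ¹_c} = ‖P_c^{1/2} f‖²_{L²}`, i.e. the value at `f ∈ H¹` of
the quadratic form `∫ |∇f|² + c |x|⁻² |f|²` that defines the operator `P_c = -Δ + c |x|⁻²`. -/
def normSqH1c {d : ℕ} (c : ℝ) (f : Space d → ℂ) : ℝ :=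
  ∫ x, (‖weakGrad f x‖ ^ 2 + c * ‖x‖ ^ (-2 : ℝ) * ‖f x‖ ^ 2)

/-- The focusing nonlinearity without its sign, `|x|^{-b} |f|^σ f`. -/
def nonlin {d : ℕ} (b σ : ℝ) (f : Space d → ℂ) (x : Space d) : ℂ :=
  (‖x‖ ^ (-b) * ‖f x‖ ^ σ) • f x

/-- The potential energy `∫ |x|^{-b} |f|^{σ+2}`. -/
def potential {d : ℕ} (b σ : ℝ) (f : Space d → ℂ) : ℝ :=
  ∫ x, ‖x‖ ^ (-b) * ‖f x‖ ^ (σ + 2)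

/-- The distribution `Δf - c |x|⁻² f + |x|^{-b} |f|^σ f = -P_c f + |x|^{-b} |f|^σ f` applied to the
test function `φ`. -/
def rhsPairing {d : ℕ} (c b σ : ℝ) (f : Space d → ℂ) (φ : Space d → ℝ) : ℂ :=
  - (∑ j : Fin d, ∫ x, pderiv j φ x • weakGrad f x j)
    - (c : ℂ) * (∫ x, φ x • (‖x‖ ^ (-2 : ℝ) • f x))
    + ∫ x, φ x • nonlin b σ f x

/-- The Lebesgue exponent `r` of the space `L^{γ(r)}(I, H^{1,r})` in which solutions live. -/
def rExp (d : ℕ) (b : ℝ) : ℝ :=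
  2 * d * (d + 2 - 2 * b) / ((d : ℝ) ^ 2 - 2 * d * b + 4)

/-- The time exponent `γ(p)` of an admissible pair: `2 / γ(p) = d / 2 - d / p`. -/
def gammaExp (d : ℕ) (p : ℝ) : ℝ :=
  2 / ((d : ℝ) / 2 - d / p)

/-- `u : I × ℝ^d → ℂ` is a solution of the focusing equation
`i u_t - P_c u = -|x|^{-b} |u|^σ u`, `u(0) = u₀`, on the time interval `I ∋ 0`.

* `u ∈ C(I, H¹)` and `u(0) = u₀`;
* the equation, written as `u_t = i (-P_c u + |x|^{-b} |u|^σ u)`, holds in the sense of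
  distributions (with one-sided time derivatives at end points that belong to `I`);
* `u` has the Strichartz regularity `L^{γ(r)}_loc(I, H^{1,r})`, which is only asked for locally in
  `ℝ^d ∖ {0}`. (That `u` itself, besides its gradient, lies in `L^{γ(r)}_loc(I, L^r)` is contained in
  `u ∈ C(I, H¹)`, because `2 ≤ r ≤ 2d/(d-2)`.) -/
structure IsSolution {d : ℕ} (c b σ : ℝ) (I : Set ℝ) (u₀ : Space d → ℂ)
    (u : ℝ → Space d → ℂ) : Prop where
  ordConnected : I.OrdConnected
  zero_mem : (0 : ℝ) ∈ I
  contH1 : ContH1 I u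
  initial : u 0 =ᵐ[volume] u₀
  equation : ∀ φ : Space d → ℝ, IsTest φ → ∀ t ∈ I,
    HasDerivWithinAt (fun s => ∫ x, φ x • u s x) (Complex.I * rhsPairing c b σ (u t) φ) I t
  strichartz : ∀ J : Set ℝ, J ⊆ I → IsCompact J →
    ∀ K : Set (Space d), IsCompact K → (0 : Space d) ∉ K →
      ∫⁻ t in J, (eLpNorm (weakGrad (u t)) (ENNReal.ofReal (rExp d b)) (volume.restrict K)) ^
        (gammaExp d (rExp d b)) < ⊤

end INLS

end

/-! Formally, `V(t) = ‖xu‖²` satisfies `V' = 4 Im ∫ ū x·∇u`, and the momentum on the right is the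
quadratic form of the symmetric generator of dilations. Its time derivative is therefore a
commutator: with the Laplacian it gives `2|∇u|²`, with `c|x|⁻²` it gives `2c|x|⁻²|u|²` because the
weight is homogeneous of degree `-2`, and with the nonlinearity it gives the last term through the
chain rule for `|u|^(σ+2)` and the degree `-b` of its weight. The difficulty is that `u(t)` lies
only in `H¹`, that the weights are unbounded at infinity, and that the potentials are singular at
the origin.

Variance and momentum are treated together, as forms `actForm ψ k` of the symmetric operator `ψ -
i(k x·∇ + (d k + k')/2)`, where `ψ` and `k` are smooth compactly supported functions of `log ‖x‖`
and so live on annuli. Along the mollified solution, symmetry of the operator reduces the time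
derivative to testing the equation (`IsSolution.hasDerivWithinAt_actForm_mol`). Up to an exact
divergence, the Laplacian contributes an expression in `u` and `∇u` alone
(`SmoothPair.two_mul_re_sum_integral`), so the mollification can be removed in `H¹`.

The potential terms need `|u|^(σ+1)` in `L²` of space-time away from the origin, which `H¹` alone
need not provide. This is the role of the Strichartz condition: with `γ = gammaExp d (rExp d b)`, a
local Sobolev inequality turns `∇u ∈ L^γ L^r` into `u ∈ L^γ` of space-time on annuli, and `γ ≥
2(σ+1)` (`exists_lintegral_rpow_annulus_le`). The outcome is the integrated identity
`IsSolution.actForm_sub_eq`. Its density `virDens` is dominated by `(1+|x|⁻²)|u|² + |∇u|² +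
|u|^(2d/(d-2))`, whose integral is finite by Hardy and Sobolev; functionals dominated in this way
are continuous in time (`ContH1.continuousOn_integral`).

Finally the cutoffs are removed by dilating them in `log ‖x‖`. Their logarithmic derivatives stay
bounded, so the error terms are dominated by the energy density. Truncated variances are bounded
uniformly by an absorption argument (`IsSolution.exists_truncated_variance_le`), and Fatou gives
`|x|u(t) ∈ L²`. Dominated convergence yields both virial identities in integrated form, and the
fundamental theorem of calculus makes them derivatives. Continuity of `|x|u` in `L²` follows from
continuity of `V` and of its truncations. -/

noncomputable section
-- Radial cutoffs in the variable `log ‖x‖` and the divergence theorem for radial fields.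
namespace INLS

/-- The radial function `x ↦ k (log ‖x‖)`, with value `0` at the origin. -/
def rad {d : ℕ} (k : ℝ → ℝ) (x : Space d) : ℝ :=
  if x = 0 then 0 else k (Real.log ‖x‖)

/-- Smooth compactly supported radial profiles, as functions of `log ‖x‖`. -/
def IsCut (k : ℝ → ℝ) : Prop :=
  ContDiff ℝ ∞ k ∧ HasCompactSupport k

/-- The annulus `e^{-m} ≤ ‖x‖ ≤ e^m`. -/
def annulus (d : ℕ) (m : ℝ) : Set (Space d) :=
  {x | Real.exp (-m) ≤ ‖x‖ ∧ ‖x‖ ≤ Real.exp m}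

variable {d : ℕ}

theorem rad_zero (k : ℝ → ℝ) : rad k (0 : Space d) = 0 := by simp [rad]

theorem rad_of_ne (k : ℝ → ℝ) {x : Space d} (hx : x ≠ 0) :
    rad k x = k (Real.log ‖x‖) := by simp [rad, hx]

theorem isCompact_annulus (m : ℝ) : IsCompact (annulus d m) := by
  refine (isCompact_closedBall (0 : Space d) (Real.exp m)).of_isClosed_subset ?_ ?_
  · exact (isClosed_le continuous_const continuous_norm).inter
      (isClosed_le continuous_norm continuous_const)
  · intro x hx
    simpa using hx.2

theorem zero_notMem_annulus (m : ℝ) : (0 : Space d) ∉ annulus d m := by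
  intro h
  have := h.1
  simp only [norm_zero] at this
  exact absurd this (not_le.2 (Real.exp_pos _))

theorem ne_zero_of_mem_annulus {m : ℝ} {x : Space d} (hx : x ∈ annulus d m) : x ≠ 0 := by
  rintro rfl
  exact zero_notMem_annulus m hx

theorem measurableSet_annulus (m : ℝ) : MeasurableSet (annulus d m) :=
  (isCompact_annulus m).isClosed.measurableSet

theorem mem_annulus_iff {m : ℝ} {x : Space d} (hx : x ≠ 0) :
    x ∈ annulus d m ↔ |Real.log ‖x‖| ≤ m := by
  have h : 0 < ‖x‖ := norm_pos_iff.2 hx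
  rw [abs_le, Real.le_log_iff_exp_le h, Real.log_le_iff_le_exp h]
  rfl

namespace IsCut

variable {k l : ℝ → ℝ}

theorem exists_zero (hk : IsCut k) : ∃ m : ℝ, 0 < m ∧ ∀ s, m < |s| → k s = 0 := by
  obtain ⟨m, hm⟩ := hk.2.isCompact.isBounded.subset_closedBall (0 : ℝ)
  refine ⟨max m 1, by positivity, fun s hs => ?_⟩
  by_contra h
  have := hm (subset_tsupport _ h)
  simp only [Metric.mem_closedBall, dist_zero_right, Real.norm_eq_abs] at this
  exact absurd (hs.trans_le this) (not_lt.2 (le_max_left _ _))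

theorem exists_bound (hk : IsCut k) : ∃ C : ℝ, 0 < C ∧ ∀ s, |k s| ≤ C := by
  obtain ⟨C, hC⟩ := hk.2.exists_bound_of_continuous hk.1.continuous
  exact ⟨max C 1, by positivity, fun s => (hC s).trans (le_max_left _ _)⟩

theorem deriv (hk : IsCut k) : IsCut (deriv k) :=
  ⟨((contDiff_infty_iff_deriv (𝕜 := ℝ)).1 hk.1).2, hk.2.deriv⟩

theorem mul_left (hk : IsCut k) (hl : ContDiff ℝ ∞ l) : IsCut (fun s => l s * k s) :=
  ⟨hl.mul hk.1, hk.2.mul_left⟩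

theorem mul_right (hk : IsCut k) (hl : ContDiff ℝ ∞ l) : IsCut (fun s => k s * l s) :=
  ⟨hk.1.mul hl, hk.2.mul_right⟩

theorem const_mul (hk : IsCut k) (a : ℝ) : IsCut (fun s => a * k s) :=
  hk.mul_left contDiff_const

theorem mul_exp (hk : IsCut k) (a : ℝ) : IsCut (fun s => k s * Real.exp (a * s)) :=
  hk.mul_right (Real.contDiff_exp.comp (contDiff_const.mul contDiff_id))

theorem add (hk : IsCut k) (hl : IsCut l) : IsCut (fun s => k s + l s) :=
  ⟨hk.1.add hl.1, hk.2.add hl.2⟩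

theorem zero : IsCut (fun _ => 0) := ⟨contDiff_const, HasCompactSupport.zero⟩

/-- In the variable `s = log ‖x‖` the operator `x·∇` is `d/ds`; for `a = d` this profile is thus the
divergence of the field `rad k • x`. -/
theorem div_profile (hk : IsCut k) (a : ℝ) : IsCut (fun s => a * k s + _root_.deriv k s) :=
  (hk.const_mul a).add hk.deriv

theorem comp_div (hk : IsCut k) {a : ℝ} (ha : a ≠ 0) : IsCut (fun s => k (s / a)) := by
  refine ⟨hk.1.comp (contDiff_id.div_const a), ?_⟩
  have := hk.2.comp_homeomorph (Homeomorph.mulRight₀ a⁻¹ (inv_ne_zero ha))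
  simpa [Function.comp_def, div_eq_mul_inv] using this

theorem rad_eq_zero {m : ℝ} (hm : ∀ s, m < |s| → k s = 0) {x : Space d}
    (hx : x ∉ annulus d m) : rad k x = 0 := by
  by_cases h0 : x = 0
  · rw [h0, rad_zero]
  · rw [rad_of_ne k h0]
    apply hm
    rw [mem_annulus_iff h0] at hx
    exact not_le.1 hx

/-- The origin is harmless: `k` vanishes near `-∞`, so `rad k` vanishes on a ball around `0`. -/
theorem contDiff_rad (hk : IsCut k) : ContDiff ℝ ∞ (rad k : Space d → ℝ) := by
  rw [contDiff_iff_contDiffAt]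
  intro x
  by_cases hx : x = 0
  · subst hx
    obtain ⟨m, -, hm⟩ := hk.exists_zero
    have : (rad k : Space d → ℝ) =ᶠ[𝓝 0] fun _ => 0 := by
      filter_upwards [((isCompact_annulus m).isClosed.isOpen_compl).mem_nhds
        (zero_notMem_annulus (d := d) m)] with x hx
      exact rad_eq_zero hm hx
    exact contDiffAt_const.congr_of_eventuallyEq this
  · have : (rad k : Space d → ℝ) =ᶠ[𝓝 x] fun y => k (Real.log ‖y‖) := by
      filter_upwards [isOpen_ne.mem_nhds hx] with y hy
      exact rad_of_ne k hy
    refine ContDiffAt.congr_of_eventuallyEq ?_ this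
    exact hk.1.contDiffAt.comp x ((contDiffAt_id.norm ℝ hx).log (norm_ne_zero_iff.2 hx))

theorem hasCompactSupport_rad (hk : IsCut k) : HasCompactSupport (rad k : Space d → ℝ) := by
  obtain ⟨m, -, hm⟩ := hk.exists_zero
  exact HasCompactSupport.intro (isCompact_annulus m) fun x hx => rad_eq_zero hm hx

theorem continuous_rad (hk : IsCut k) : Continuous (rad k : Space d → ℝ) :=
  hk.contDiff_rad.continuous

theorem abs_rad_le {C : ℝ} (hC : 0 ≤ C) (h : ∀ s, |k s| ≤ C) (x : Space d) : |rad k x| ≤ C := by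
  unfold rad
  split_ifs
  · simpa
  · exact h _

theorem hasFDerivAt_rad (hk : IsCut k) (x : Space d) :
    HasFDerivAt (rad k)
      (rad (fun s => _root_.deriv k s * Real.exp ((-2) * s)) x • innerSL ℝ x) x := by
  by_cases hx : x = 0
  · subst hx
    obtain ⟨m, -, hm⟩ := hk.exists_zero
    have : (rad k : Space d → ℝ) =ᶠ[𝓝 0] fun _ => 0 := by
      filter_upwards [((isCompact_annulus m).isClosed.isOpen_compl).mem_nhds
        (zero_notMem_annulus (d := d) m)] with x hx
      exact rad_eq_zero hm hx
    rw [rad_zero, zero_smul]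
    exact (hasFDerivAt_const (0 : ℝ) (0 : Space d)).congr_of_eventuallyEq this
  · have hn : ‖x‖ ≠ 0 := norm_ne_zero_iff.2 hx
    -- Writing `log ‖y‖` as half of `log ‖y‖²` lets the derivative of the squared norm, `2⟨x,·⟩`, be
    -- used directly; dividing by `‖x‖²` produces the factor `e^{-2s}`.
    have : (rad k : Space d → ℝ) =ᶠ[𝓝 x] fun y => k (Real.log (‖y‖ ^ 2) / 2) := by
      filter_upwards [isOpen_ne.mem_nhds hx] with y hy
      rw [rad_of_ne k hy, Real.log_pow]
      congr 1
      push_cast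
      ring
    have h1 := (hasStrictFDerivAt_norm_sq x).hasFDerivAt
    have h2 := (h1.log (pow_ne_zero 2 hn)).mul_const (2 : ℝ)⁻¹
    have h3 := ((hk.1.differentiable (by simp)) (Real.log (‖x‖ ^ 2) * 2⁻¹)).hasDerivAt
    have h4 := h3.comp_hasFDerivAt x h2
    refine (h4.congr_fderiv ?_).congr_of_eventuallyEq ?_
    · rw [rad_of_ne _ hx]
      have e1 : Real.log (‖x‖ ^ 2) * 2⁻¹ = Real.log ‖x‖ := by
        rw [Real.log_pow]; push_cast; ring
      have e2 : Real.exp ((-2) * Real.log ‖x‖) = (‖x‖ ^ 2)⁻¹ := by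
        rw [show (-2) * Real.log ‖x‖ = -(Real.log (‖x‖ ^ 2)) by rw [Real.log_pow]; push_cast; ring,
          Real.exp_neg, Real.exp_log (by positivity)]
      rw [e1, e2]
      ext y
      simp
      ring
    · filter_upwards [this] with y hy
      rw [hy]
      simp [div_eq_mul_inv]

end IsCut

theorem fderiv_apply_self_eq_sum {F : Type*} [NormedAddCommGroup F] [NormedSpace ℝ F]
    (L : Space d →L[ℝ] F) (x : Space d) :
    L x = ∑ j, x j • L (EuclideanSpace.single j (1 : ℝ)) := by
  conv_lhs => rw [← (EuclideanSpace.basisFun (Fin d) ℝ).sum_repr x]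
  simp

theorem norm_sq_mul_exp {x : Space d} (hx : x ≠ 0) (a : ℝ) :
    Real.exp (a * Real.log ‖x‖) = ‖x‖ ^ a := by
  rw [Real.rpow_def_of_pos (norm_pos_iff.2 hx), mul_comm]

/-- Divergence theorem for the field `rad k • x`. -/
theorem integral_rad_mul_fderiv {k : ℝ → ℝ} (hk : IsCut k) {G : Space d → ℝ}
    (hG : ContDiff ℝ 1 G) :
    ∫ x, rad k x * fderiv ℝ G x x
      = - ∫ x, rad (fun s => d * k s + deriv k s) x * G x := by
  have hGc : Continuous (fderiv ℝ G) := hG.continuous_fderiv (by simp)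
  have hcoord : ∀ j : Fin d, ∀ x, HasFDerivAt (fun x : Space d => x j)
      (EuclideanSpace.proj (𝕜 := ℝ) j) x := fun j x =>
    (EuclideanSpace.proj (𝕜 := ℝ) j).hasFDerivAt
  set r1 : Space d → ℝ := rad (fun s => deriv k s * Real.exp ((-2) * s)) with hr1
  have hr1c : Continuous r1 := (hk.deriv.mul_exp (-2)).continuous_rad
  have hr1s : HasCompactSupport r1 := (hk.deriv.mul_exp (-2)).hasCompactSupport_rad
  have hD : ∀ j : Fin d, ∀ x : Space d, HasFDerivAt (fun x : Space d => rad k x * x j)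
      (rad k x • EuclideanSpace.proj (𝕜 := ℝ) j + x j • (r1 x • innerSL ℝ x)) x := fun j x =>
    (hk.hasFDerivAt_rad x).mul (hcoord j x)
  have hkc : Continuous (rad k : Space d → ℝ) := hk.continuous_rad
  have hks : HasCompactSupport (rad k : Space d → ℝ) := hk.hasCompactSupport_rad
  have hval : ∀ (j : Fin d) (x : Space d),
      fderiv ℝ (fun x : Space d => rad k x * x j) x (EuclideanSpace.single j (1 : ℝ))
        = rad k x + r1 x * (x j) ^ 2 := by
    intro j x
    rw [(hD j x).fderiv]
    simp [EuclideanSpace.inner_single_right]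
    ring
  -- The integration by parts is done one coordinate at a time, for the component `rad k x * x j` of
  -- the field.
  have hibp : ∀ j : Fin d,
      ∫ x, (rad k x * x j) * fderiv ℝ G x (EuclideanSpace.single j (1 : ℝ))
        = - ∫ x, (rad k x + r1 x * (x j) ^ 2) * G x := by
    intro j
    have := integral_mul_fderiv_eq_neg_fderiv_mul_of_integrable (𝕜 := ℝ) (μ := volume)
      (f := fun x : Space d => rad k x * x j) (g := G)
      (v := EuclideanSpace.single j (1 : ℝ)) ?_ ?_ ?_
      (fun x _ => (hD j x).differentiableAt)
      (fun x _ => (hG.differentiable (by simp)) x)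
    · simpa only [hval] using this
    · simp only [hval]
      refine Continuous.integrable_of_hasCompactSupport ?_ ?_
      · exact (hkc.add (hr1c.mul (by fun_prop))).mul hG.continuous
      · exact (hks.add hr1s.mul_right).mul_right
    · refine Continuous.integrable_of_hasCompactSupport ?_ ?_
      · exact (hkc.mul (by fun_prop)).mul (hGc.clm_apply continuous_const)
      · exact hks.mul_right.mul_right
    · refine Continuous.integrable_of_hasCompactSupport ?_ ?_
      · exact (hkc.mul (by fun_prop)).mul hG.continuous
      · exact hks.mul_right.mul_right
  calc ∫ x, rad k x * fderiv ℝ G x x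
      = ∫ x, ∑ j, (rad k x * x j) * fderiv ℝ G x (EuclideanSpace.single j (1 : ℝ)) := by
        congr 1
        ext x
        conv_lhs => rw [fderiv_apply_self_eq_sum (fderiv ℝ G x) x, Finset.mul_sum]
        exact Finset.sum_congr rfl fun j _ => by simp [mul_assoc]
    _ = ∑ j, ∫ x, (rad k x * x j) * fderiv ℝ G x (EuclideanSpace.single j (1 : ℝ)) := by
        refine integral_finsetSum _ fun j _ => ?_
        refine Continuous.integrable_of_hasCompactSupport ?_ ?_
        · exact (hkc.mul (by fun_prop)).mul (hGc.clm_apply continuous_const)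
        · exact hks.mul_right.mul_right
    _ = - ∑ j, ∫ x, (rad k x + r1 x * (x j) ^ 2) * G x := by
        rw [← Finset.sum_neg_distrib]
        exact Finset.sum_congr rfl fun j _ => hibp j
    _ = - ∫ x, ∑ j : Fin d, (rad k x + r1 x * (x j) ^ 2) * G x := by
        rw [integral_finsetSum]
        intro j _
        refine Continuous.integrable_of_hasCompactSupport ?_ ?_
        · exact (hkc.add (hr1c.mul (by fun_prop))).mul hG.continuous
        · exact (hks.add hr1s.mul_right).mul_right
    _ = _ := by
        congr 2
        ext x
        rw [← Finset.sum_mul]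
        congr 1
        -- Summed over `j`, the `x_j²` give `‖x‖²`, which cancels the `‖x‖⁻²` inside `r1` and leaves
        -- `k'`; the other term is counted `d` times.
        rw [Finset.sum_add_distrib, ← Finset.mul_sum, ← EuclideanSpace.real_norm_sq_eq]
        simp only [Finset.sum_const, Finset.card_univ, Fintype.card_fin, nsmul_eq_mul]
        by_cases hx : x = 0
        · simp [hx, rad_zero, hr1]
        · rw [hr1, rad_of_ne _ hx, rad_of_ne _ hx, rad_of_ne _ hx, norm_sq_mul_exp hx, mul_assoc,
            ← Real.rpow_natCast ‖x‖ 2, ← Real.rpow_add (norm_pos_iff.2 hx)]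
          norm_num

end INLS
end

/-! ### Mollification in `L^p` and `L²`. -/

noncomputable section
namespace INLS

variable {d : ℕ} {F : Type*} [NormedAddCommGroup F] [NormedSpace ℝ F]

/-- The bump functions underlying the standard mollifiers. -/
def bump (d n : ℕ) : ContDiffBump (0 : Space d) where
  rIn := 1 / ((n : ℝ) + 1)
  rOut := 2 / ((n : ℝ) + 1)
  rIn_pos := by positivity
  rIn_lt_rOut := by gcongr; norm_num

/-- The standard mollifiers. -/
def mollifier (d n : ℕ) : Space d → ℝ := (bump d n).normed volume

/-- Mollification. -/
def mol (n : ℕ) (f : Space d → F) : Space d → F :=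
  convolution (mollifier d n) f (ContinuousLinearMap.lsmul ℝ ℝ) volume

theorem tendsto_bump_rOut : Tendsto (fun n => (bump d n).rOut) atTop (𝓝 0) := by
  have := (tendsto_one_div_add_atTop_nhds_zero_nat (𝕜 := ℝ)).const_mul 2
  simpa [bump, div_eq_mul_inv] using this

theorem contDiff_mollifier (n : ℕ) : ContDiff ℝ ∞ (mollifier d n) :=
  (bump d n).contDiff_normed

theorem continuous_mollifier (n : ℕ) : Continuous (mollifier d n) :=
  (contDiff_mollifier n).continuous

theorem hasCompactSupport_mollifier (n : ℕ) : HasCompactSupport (mollifier d n) :=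
  (bump d n).hasCompactSupport_normed

theorem mollifier_nonneg (n : ℕ) (x : Space d) : 0 ≤ mollifier d n x :=
  (bump d n).nonneg_normed x

theorem integrable_mollifier (n : ℕ) : Integrable (mollifier d n) volume :=
  (bump d n).integrable_normed

theorem mollifier_sub_comm (n : ℕ) (x y : Space d) : mollifier d n (x - y) = mollifier d n (y - x) := by
  rw [← neg_sub, mollifier, ContDiffBump.normed_neg]

theorem mollifier_eq_zero {n : ℕ} {x : Space d} (hx : (bump d n).rOut ≤ ‖x‖) :
    mollifier d n x = 0 := by
  have : x ∉ Function.support (mollifier d n) := by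
    rw [mollifier, ContDiffBump.support_normed_eq]
    simpa using hx
  simpa using this

theorem mol_apply (n : ℕ) (f : Space d → F) (x : Space d) :
    mol n f x = ∫ y, mollifier d n (x - y) • f y := convolution_lsmul_swap

theorem mol_apply' (n : ℕ) (f : Space d → F) (x : Space d) :
    mol n f x = ∫ y, mollifier d n y • f (x - y) := rfl

theorem mol_congr {n : ℕ} {f f' : Space d → F} (h : f =ᵐ[volume] f') : mol n f = mol n f' :=
  convolution_congr _ EventuallyEq.rfl h

theorem contDiff_mol (n : ℕ) {f : Space d → F} [CompleteSpace F] (hf : LocallyIntegrable f volume) :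
    ContDiff ℝ ∞ (mol n f) :=
  (hasCompactSupport_mollifier n).contDiff_convolution_left _ (contDiff_mollifier n) hf

theorem continuous_mol (n : ℕ) {f : Space d → F} [CompleteSpace F]
    (hf : LocallyIntegrable f volume) : Continuous (mol n f) :=
  (contDiff_mol n hf).continuous

theorem integrable_kernel_smul {κ : Space d → ℝ} (hκ : Continuous κ) (hκs : HasCompactSupport κ)
    {f : Space d → F} (hf : LocallyIntegrable f volume) (x : Space d) :
    Integrable (fun y => κ (x - y) • f y) volume := by
  have := hκs.convolutionExists_left (ContinuousLinearMap.lsmul ℝ ℝ) (μ := volume) hκ hf x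
  exact this.integrable_swap

theorem fderiv_mol (n : ℕ) {f : Space d → F} [CompleteSpace F]
    (hf : LocallyIntegrable f volume) (x v : Space d) :
    fderiv ℝ (mol n f) x v = ∫ y, fderiv ℝ (mollifier d n) (x - y) v • f y := by
  have h := ((hasCompactSupport_mollifier n).hasFDerivAt_convolution_left
    (ContinuousLinearMap.lsmul ℝ ℝ (E := F)) ((contDiff_mollifier n).of_le (by simp)) hf x).fderiv
  rw [mol, h, convolution_eq_swap]
  have hi : Integrable (fun y => ((ContinuousLinearMap.precompL (Space d)
      (ContinuousLinearMap.lsmul ℝ ℝ (E := F))) (fderiv ℝ (mollifier d n) (x - y))) (f y)) volume := by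
    have := ((hasCompactSupport_mollifier (d := d) n).fderiv ℝ).convolutionExists_left
      (ContinuousLinearMap.precompL (Space d) (ContinuousLinearMap.lsmul ℝ ℝ (E := F))) (μ := volume)
      ((contDiff_mollifier n).continuous_fderiv (by simp)) hf x
    exact this.integrable_swap
  rw [ContinuousLinearMap.integral_apply hi]
  rfl

theorem mol_sub (n : ℕ) {f g : Space d → F} (hf : LocallyIntegrable f volume)
    (hg : LocallyIntegrable g volume) : mol n (f - g) = mol n f - mol n g := by
  ext x
  simp only [mol_apply, Pi.sub_apply, smul_sub]
  exact integral_sub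
    (integrable_kernel_smul (continuous_mollifier n) (hasCompactSupport_mollifier n) hf x)
    (integrable_kernel_smul (continuous_mollifier n) (hasCompactSupport_mollifier n) hg x)

theorem mol_eval {n : ℕ} {g : Space d → EuclideanSpace ℂ (Fin d)} (hg : LocallyIntegrable g volume)
    (x : Space d) (j : Fin d) : mol n g x j = mol n (fun y => g y j) x := by
  have h := ContinuousLinearMap.integral_comp_comm
    ((EuclideanSpace.proj j : EuclideanSpace ℂ (Fin d) →L[ℂ] ℂ).restrictScalars ℝ)
    (integrable_kernel_smul (continuous_mollifier n) (hasCompactSupport_mollifier n) hg x)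
  rw [mol_apply, mol_apply]
  simpa using h.symm

theorem ae_tendsto_mol [CompleteSpace F] {f : Space d → F} (hf : LocallyIntegrable f volume) :
    ∀ᵐ x, Tendsto (fun n => mol n f x) atTop (𝓝 (f x)) := by
  -- The constant `2` is the ratio of outer to inner radius, which has to stay bounded for Lebesgue
  -- differentiation to apply.
  refine ContDiffBump.ae_convolution_tendsto_right_of_locallyIntegrable (K := 2)
    tendsto_bump_rOut (Eventually.of_forall fun n => ?_) hf
  simp [bump, div_eq_mul_inv]

/-- Local `L^p` contractivity of mollification. -/
theorem lintegral_mol_le {p : ℝ} (hp : 1 ≤ p) (n : ℕ) {f : Space d → F}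
    (hf : AEStronglyMeasurable f volume) {K K' : Set (Space d)} (hK : MeasurableSet K) (hK' : MeasurableSet K')
    (hKK' : ∀ x ∈ K, ∀ y, ‖y‖ < (bump d n).rOut → x - y ∈ K') :
    ∫⁻ x in K, ‖mol n f x‖ₑ ^ p ≤ ∫⁻ x in K', ‖f x‖ₑ ^ p := by
  obtain ⟨f', hf', hff'⟩ := hf
  rw [mol_congr hff', show ∫⁻ x in K', ‖f x‖ₑ ^ p = ∫⁻ x in K', ‖f' x‖ₑ ^ p from
    lintegral_congr_ae (ae_restrict_of_ae (hff'.mono fun x hx => by simp only [hx]))]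
  -- Mollification is an average against the probability measure `ν`, so the bound is Jensen's
  -- inequality followed by Tonelli and translation invariance. The indicator of `K'` records that
  -- only points within the radius of the bump are seen from `K`.
  set ν : Measure (Space d) := volume.withDensity fun y => ENNReal.ofReal (mollifier d n y) with hν
  have hmm : Measurable fun y => ENNReal.ofReal (mollifier d n y) :=
    (continuous_mollifier n).measurable.ennreal_ofReal
  have : IsProbabilityMeasure ν := by
    refine ⟨?_⟩
    rw [hν, withDensity_apply _ MeasurableSet.univ, Measure.restrict_univ,
      ← ofReal_integral_eq_lintegral_ofReal (integrable_mollifier n)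
        (Eventually.of_forall (mollifier_nonneg n)), mollifier, ContDiffBump.integral_normed]
    simp
  set h : Space d → ℝ≥0∞ := K'.indicator fun x => ‖f' x‖ₑ with hh
  have hhm : Measurable h := hf'.enorm.indicator hK'
  have hpt : ∀ x ∈ K, ‖mol n f' x‖ₑ ≤ ∫⁻ y, h (x - y) ∂ν := by
    intro x hx
    have hm : Measurable fun y => h (x - y) := hhm.comp (measurable_const.sub measurable_id)
    rw [mol_apply', hν, lintegral_withDensity_eq_lintegral_mul _ hmm hm]
    refine (enorm_integral_le_lintegral_enorm _).trans (lintegral_mono fun y => ?_)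
    simp only [Pi.mul_apply]
    rw [enorm_smul, Real.enorm_of_nonneg (mollifier_nonneg n y)]
    by_cases hy : ‖y‖ < (bump d n).rOut
    · rw [hh, Set.indicator_of_mem (hKK' x hx y hy)]
    · rw [mollifier_eq_zero (not_lt.1 hy)]
      simp
  have hp0 : (0 : ℝ) < p := by linarith
  -- On a probability space the `L¹` norm is at most the `L^p` norm.
  have hjensen : ∀ x, (∫⁻ y, h (x - y) ∂ν) ^ p ≤ ∫⁻ y, h (x - y) ^ p ∂ν := by
    intro x
    have hm : Measurable fun y => h (x - y) := hhm.comp (measurable_const.sub measurable_id)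
    have h1 := eLpNorm'_le_eLpNorm'_of_exponent_le (f := fun y => h (x - y)) one_pos hp ν
      hm.aestronglyMeasurable
    simp only [eLpNorm', ENNReal.rpow_one, enorm_eq_self, div_one] at h1
    calc (∫⁻ y, h (x - y) ∂ν) ^ p
        ≤ ((∫⁻ y, h (x - y) ^ p ∂ν) ^ (1 / p)) ^ p := ENNReal.rpow_le_rpow h1 hp0.le
      _ = _ := by rw [← ENNReal.rpow_mul, one_div_mul_cancel hp0.ne', ENNReal.rpow_one]
  calc ∫⁻ x in K, ‖mol n f' x‖ₑ ^ p
      ≤ ∫⁻ x in K, ∫⁻ y, h (x - y) ^ p ∂ν := by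
        exact setLIntegral_mono' hK fun x hx =>
          (ENNReal.rpow_le_rpow (hpt x hx) hp0.le).trans (hjensen x)
    _ ≤ ∫⁻ x, ∫⁻ y, h (x - y) ^ p ∂ν := setLIntegral_le_lintegral _ _
    _ = ∫⁻ y, (∫⁻ x, h (x - y) ^ p) ∂ν := by
        refine lintegral_lintegral_swap (Measurable.aemeasurable ?_)
        exact (hhm.comp (measurable_fst.sub measurable_snd)).pow_const p
    _ = ∫⁻ y, (∫⁻ x, h x ^ p) ∂ν := by
        congr 1
        ext y
        exact lintegral_sub_right_eq_self (fun x => h x ^ p) y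
    _ = ∫⁻ x in K', ‖f' x‖ₑ ^ p := by
        rw [lintegral_const, measure_univ, mul_one, ← lintegral_indicator hK']
        congr 1
        ext x
        by_cases hx : x ∈ K' <;> simp [hh, hx, hp0]

theorem eLpNorm_mol_le {p : ℝ} (hp : 1 ≤ p) (n : ℕ) {f : Space d → F}
    (hf : AEStronglyMeasurable f volume) {K K' : Set (Space d)} (hK : MeasurableSet K)
    (hK' : MeasurableSet K') (hKK' : ∀ x ∈ K, ∀ y, ‖y‖ < (bump d n).rOut → x - y ∈ K') :
    eLpNorm (mol n f) (ENNReal.ofReal p) (volume.restrict K)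
      ≤ eLpNorm f (ENNReal.ofReal p) (volume.restrict K') := by
  have hp0 : 0 < p := by linarith
  rw [eLpNorm_eq_lintegral_rpow_enorm_toReal (by simpa using hp0) ENNReal.ofReal_ne_top,
    eLpNorm_eq_lintegral_rpow_enorm_toReal (by simpa using hp0) ENNReal.ofReal_ne_top,
    ENNReal.toReal_ofReal hp0.le]
  exact ENNReal.rpow_le_rpow (lintegral_mol_le hp n hf hK hK' hKK') (by positivity)

theorem eLpNorm_two_mol_le (n : ℕ) {f : Space d → F} (hf : AEStronglyMeasurable f volume) :
    eLpNorm (mol n f) 2 volume ≤ eLpNorm f 2 volume := by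
  have := eLpNorm_mol_le (p := 2) (by norm_num) n hf MeasurableSet.univ MeasurableSet.univ
    (fun _ _ _ _ => Set.mem_univ _)
  simpa using this

theorem locallyIntegrable_of_memLp_two {E : Type*} [NormedAddCommGroup E] {f : Space d → E}
    (hf : MemLp f 2 volume) : LocallyIntegrable f volume :=
  hf.locallyIntegrable (by norm_num)

theorem memLp_mol [CompleteSpace F] (n : ℕ) {f : Space d → F} (hf : MemLp f 2 volume) :
    MemLp (mol n f) 2 volume :=
  ⟨(continuous_mol n (locallyIntegrable_of_memLp_two hf)).aestronglyMeasurable,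
    (eLpNorm_two_mol_le n hf.1).trans_lt hf.2⟩

theorem eLpNorm_two_sq {E : Type*} [NormedAddCommGroup E] {α : Type*} [MeasurableSpace α]
    (f : α → E) (μ : Measure α) : eLpNorm f 2 μ ^ 2 = ∫⁻ x, ‖f x‖ₑ ^ 2 ∂μ := by
  rw [eLpNorm_eq_lintegral_rpow_enorm_toReal (by simp) (by simp), ← ENNReal.rpow_natCast,
    ← ENNReal.rpow_mul]
  simp

/-- A bounded almost everywhere convergent sequence in `L²` whose norms do not exceed that of the
limit converges strongly. -/
theorem tendsto_eLpNorm_sub_of_ae_of_le {E : Type*} [NormedAddCommGroup E] {α : Type*}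
    [MeasurableSpace α] {μ : Measure α} {f : α → E} {fn : ℕ → α → E} (hf : MemLp f 2 μ)
    (hfn : ∀ n, AEStronglyMeasurable (fn n) μ) (hle : ∀ n, eLpNorm (fn n) 2 μ ≤ eLpNorm f 2 μ)
    (hae : ∀ᵐ x ∂μ, Tendsto (fun n => fn n x) atTop (𝓝 (f x))) :
    Tendsto (fun n => eLpNorm (fn n - f) 2 μ) atTop (𝓝 0) := by
  set A : ℝ≥0∞ := ∫⁻ x, ‖f x‖ₑ ^ 2 ∂μ with hA
  have hAtop : A ≠ ⊤ := by
    rw [hA, ← eLpNorm_two_sq]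
    exact ENNReal.pow_ne_top hf.2.ne
  have hAn : ∀ n, ∫⁻ x, ‖fn n x‖ₑ ^ 2 ∂μ ≤ A := fun n => by
    rw [hA, ← eLpNorm_two_sq, ← eLpNorm_two_sq]
    exact pow_le_pow_left' (hle n) 2
  have hmf : AEMeasurable (fun x => ‖f x‖ₑ ^ 2) μ := hf.1.enorm.pow_const 2
  have hmfn : ∀ n, AEMeasurable (fun x => ‖fn n x‖ₑ ^ 2) μ := fun n => (hfn n).enorm.pow_const 2
  have hmd : ∀ n, AEMeasurable (fun x => ‖fn n x - f x‖ₑ ^ 2) μ := fun n =>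
    ((hfn n).sub hf.1).enorm.pow_const 2
  -- `H` is nonnegative by the parallelogram bound and tends to `4|f|²` almost everywhere. Fatou
  -- together with the bound on the norms then forces `∫ |fn - f|²` to vanish in the limit.
  set H : ℕ → α → ℝ≥0∞ := fun n x => (2 * ‖f x‖ₑ ^ 2 + 2 * ‖fn n x‖ₑ ^ 2) - ‖fn n x - f x‖ₑ ^ 2
    with hH
  have hptw : ∀ n x, ‖fn n x - f x‖ₑ ^ 2 ≤ 2 * ‖f x‖ₑ ^ 2 + 2 * ‖fn n x‖ₑ ^ 2 := by
    intro n x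
    have h1 : ‖fn n x - f x‖ ^ 2 ≤ 2 * ‖f x‖ ^ 2 + 2 * ‖fn n x‖ ^ 2 := by
      have := norm_sub_le (fn n x) (f x)
      nlinarith [sq_nonneg (‖fn n x‖ - ‖f x‖), norm_nonneg (fn n x - f x), norm_nonneg (fn n x),
        norm_nonneg (f x)]
    have h2 := ENNReal.ofReal_le_ofReal h1
    rw [ENNReal.ofReal_add (by positivity) (by positivity), ENNReal.ofReal_mul (by norm_num),
      ENNReal.ofReal_mul (by norm_num), ENNReal.ofReal_pow (norm_nonneg _),
      ENNReal.ofReal_pow (norm_nonneg _), ENNReal.ofReal_pow (norm_nonneg _)] at h2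
    simpa using h2
  have hHm : ∀ n, AEMeasurable (H n) μ := fun n =>
    (((hmf.const_mul 2).add ((hmfn n).const_mul 2))).sub (hmd n)
  have hsum : ∀ n, ∫⁻ x, H n x ∂μ + ∫⁻ x, ‖fn n x - f x‖ₑ ^ 2 ∂μ ≤ 4 * A := by
    intro n
    rw [← lintegral_add_left' (hHm n)]
    calc ∫⁻ x, H n x + ‖fn n x - f x‖ₑ ^ 2 ∂μ
        = ∫⁻ x, 2 * ‖f x‖ₑ ^ 2 + 2 * ‖fn n x‖ₑ ^ 2 ∂μ := by
          congr 1
          ext x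
          exact tsub_add_cancel_of_le (hptw n x)
      _ = 2 * A + 2 * ∫⁻ x, ‖fn n x‖ₑ ^ 2 ∂μ := by
          rw [lintegral_add_left' (hmf.const_mul 2), lintegral_const_mul'' _ hmf,
            lintegral_const_mul'' _ (hmfn n)]
      _ ≤ 2 * A + 2 * A := by gcongr; exact hAn n
      _ = 4 * A := by ring
  have hfatou : 4 * A ≤ liminf (fun n => ∫⁻ x, H n x ∂μ) atTop := by
    calc 4 * A = ∫⁻ x, 4 * ‖f x‖ₑ ^ 2 ∂μ := (lintegral_const_mul'' _ hmf).symm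
      _ ≤ ∫⁻ x, liminf (fun n => H n x) atTop ∂μ := by
          refine lintegral_mono_ae (hae.mono fun x hx => ?_)
          have h1 : Tendsto (fun n => H n x) atTop
              (𝓝 ((2 * ‖f x‖ₑ ^ 2 + 2 * ‖f x‖ₑ ^ 2) - ‖f x - f x‖ₑ ^ 2)) := by
            refine ENNReal.Tendsto.sub ?_ ?_ (Or.inl ?_)
            · refine tendsto_const_nhds.add (ENNReal.Tendsto.const_mul ?_ (Or.inr (by simp)))
              exact (ENNReal.continuous_pow 2).continuousAt.tendsto.comp (hx.enorm)
            · exact (ENNReal.continuous_pow 2).continuousAt.tendsto.comp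
                ((hx.sub tendsto_const_nhds).enorm)
            · simp [ENNReal.add_eq_top, ENNReal.mul_eq_top]
          rw [h1.liminf_eq]
          simp only [sub_self, enorm_zero, ne_eq, OfNat.ofNat_ne_zero, not_false_eq_true, zero_pow,
            tsub_zero]
          rw [← add_mul]
          norm_num
      _ ≤ _ := lintegral_liminf_le' hHm
  have h2 : Tendsto (fun n => ∫⁻ x, ‖fn n x - f x‖ₑ ^ 2 ∂μ) atTop (𝓝 0) := by
    rw [ENNReal.tendsto_nhds_zero]
    intro ε hε
    by_cases hA0 : 4 * A ≤ ε
    · exact Eventually.of_forall fun n => (le_add_self.trans (hsum n)).trans hA0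
    have h4 : 4 * A - ε < 4 * A :=
      ENNReal.sub_lt_self (ENNReal.mul_ne_top (by simp) hAtop)
        (fun h => hA0 (h.trans_le zero_le)) hε.ne'
    filter_upwards [eventually_lt_of_lt_liminf (h4.trans_le hfatou)] with n hn
    have h5 : (4 * A - ε) + ∫⁻ x, ‖fn n x - f x‖ₑ ^ 2 ∂μ ≤ (4 * A - ε) + ε := by
      rw [tsub_add_cancel_of_le (not_le.1 hA0).le]
      exact (add_le_add_left hn.le _).trans (hsum n)
    exact (ENNReal.add_le_add_iff_left (ne_top_of_lt h4)).1 h5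
  have h3 : ∀ n, eLpNorm (fn n - f) 2 μ = (∫⁻ x, ‖fn n x - f x‖ₑ ^ 2 ∂μ) ^ ((1 : ℝ) / 2) := by
    intro n
    rw [eLpNorm_eq_lintegral_rpow_enorm_toReal (by simp) (by simp)]
    simp
  simp only [h3]
  have := (ENNReal.continuous_rpow_const (y := (1 : ℝ) / 2)).continuousAt.tendsto.comp h2
  simpa [Function.comp_def] using this

theorem tendsto_eLpNorm_mol_sub [CompleteSpace F] {f : Space d → F} (hf : MemLp f 2 volume) :
    Tendsto (fun n => eLpNorm (mol n f - f) 2 volume) atTop (𝓝 0) :=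
  tendsto_eLpNorm_sub_of_ae_of_le hf (fun n => (memLp_mol n hf).1)
    (fun n => eLpNorm_two_mol_le n hf.1) (ae_tendsto_mol (locallyIntegrable_of_memLp_two hf))

/-- Mollification is symmetric. -/
theorem integral_mol_mul {n : ℕ} {f h : Space d → ℂ} (hf : MemLp f 2 volume)
    (hh : MemLp h 2 volume) : ∫ x, mol n f x * h x = ∫ x, f x * mol n h x := by
  have hf2 : Integrable (fun x => ‖f x‖ ^ 2) volume := hf.integrable_norm_pow (by simp)
  have hh2 : Integrable (fun x => ‖h x‖ ^ 2) volume := hh.integrable_norm_pow (by simp)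
  have h1 := hf2.convolution_integrand (ContinuousLinearMap.lsmul ℝ ℝ (E := ℝ))
    (integrable_mollifier n) (μ := volume)
  have h2 := (hh2.convolution_integrand (ContinuousLinearMap.lsmul ℝ ℝ (E := ℝ))
    (integrable_mollifier n) (μ := volume)).swap
  -- For Fubini: the integrand is dominated by the kernel times `|f(y)|² + |h(x)|²`, each summand
  -- being the integrand of a convolution of integrable functions.
  have hint : Integrable (fun p : Space d × Space d =>
      (mollifier d n (p.1 - p.2) • f p.2) * h p.1) (volume.prod volume) := by
    refine (h1.add h2).mono' ?_ (Eventually.of_forall fun p => ?_)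
    · have hm : AEStronglyMeasurable (fun p : Space d × Space d => mollifier d n (p.1 - p.2))
          (volume.prod volume) :=
        ((continuous_mollifier n).comp (continuous_fst.sub continuous_snd)).aestronglyMeasurable
      exact (hm.smul hf.1.comp_snd).mul hh.1.comp_fst
    · simp only [Pi.add_apply, Function.comp, Prod.swap, ContinuousLinearMap.lsmul_apply, smul_eq_mul,
        norm_mul, Complex.real_smul, Complex.norm_real, Real.norm_eq_abs,
        abs_of_nonneg (mollifier_nonneg n _)]
      rw [mollifier_sub_comm n p.2 p.1]
      have := mollifier_nonneg n (p.1 - p.2)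
      nlinarith [sq_nonneg (‖f p.2‖ - ‖h p.1‖), mul_nonneg this (sq_nonneg (‖f p.2‖ - ‖h p.1‖)),
        mul_nonneg this (sq_nonneg (‖f p.2‖)), mul_nonneg this (sq_nonneg (‖h p.1‖))]
  calc ∫ x, mol n f x * h x = ∫ x, ∫ y, (mollifier d n (x - y) • f y) * h x := by
        congr 1
        ext x
        rw [mol_apply, integral_mul_const]
    _ = ∫ y, ∫ x, (mollifier d n (x - y) • f y) * h x := integral_integral_swap hint
    _ = ∫ y, f y * mol n h y := by
        congr 1
        ext y
        rw [mol_apply, ← integral_const_mul]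
        congr 1
        ext x
        rw [mollifier_sub_comm n x y, Complex.real_smul, Complex.real_smul]
        ring

/-- Cauchy–Schwarz, with the kernel's `L²` norm unchanged under reflection and translation. It
provides pointwise bounds on mollified functions and their derivatives in terms of `L²` norms. -/
theorem enorm_integral_kernel_le {κ : Space d → ℝ} (hκ : AEStronglyMeasurable κ volume)
    {f : Space d → F} (hf : AEStronglyMeasurable f volume) (x : Space d) :
    ‖∫ y, κ (x - y) • f y‖ₑ ≤ eLpNorm κ 2 volume * eLpNorm f 2 volume := by
  have hmp : MeasurePreserving (fun y : Space d => x - y) volume volume :=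
    Measure.measurePreserving_sub_left volume x
  calc ‖∫ y, κ (x - y) • f y‖ₑ ≤ ∫⁻ y, ‖κ (x - y) • f y‖ₑ := enorm_integral_le_lintegral_enorm _
    _ = eLpNorm ((κ ∘ fun y => x - y) • f) 1 volume := by
        rw [eLpNorm_one_eq_lintegral_enorm]; rfl
    _ ≤ eLpNorm (κ ∘ fun y => x - y) 2 volume * eLpNorm f 2 volume :=
        eLpNorm_smul_le_mul_eLpNorm hf (hκ.comp_measurePreserving hmp)
    _ = _ := by rw [eLpNorm_comp_measurePreserving hκ hmp]

end INLS
end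

/-! ### Weak gradients and Sobolev inequalities. -/

noncomputable section
namespace INLS

variable {d : ℕ}

/-- The bilinear pairing `∑ x_j w_j` of a real with a complex vector. -/
def xdot (x : Space d) (w : EuclideanSpace ℂ (Fin d)) : ℂ := ∑ j, (x j : ℂ) * w j

theorem continuous_xdot : Continuous fun p : Space d × EuclideanSpace ℂ (Fin d) => xdot p.1 p.2 := by
  unfold xdot
  fun_prop

theorem norm_xdot_le (x : Space d) (w : EuclideanSpace ℂ (Fin d)) : ‖xdot x w‖ ≤ ‖x‖ * ‖w‖ := by
  unfold xdot
  calc ‖∑ j, (x j : ℂ) * w j‖ ≤ ∑ j, ‖x j‖ * ‖w j‖ := by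
        refine (norm_sum_le _ _).trans (Finset.sum_le_sum fun j _ => ?_)
        simp
    _ ≤ √(∑ j, ‖x j‖ ^ 2) * √(∑ j, ‖w j‖ ^ 2) := Real.sum_mul_le_sqrt_mul_sqrt _ _ _
    _ = _ := by rw [EuclideanSpace.norm_eq, EuclideanSpace.norm_eq]

theorem xdot_single (j : Fin d) (w : EuclideanSpace ℂ (Fin d)) :
    xdot (EuclideanSpace.single j (1 : ℝ)) w = w j := by
  simp [xdot, apply_ite Complex.ofReal]

theorem xdot_sub (x : Space d) (w w' : EuclideanSpace ℂ (Fin d)) :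
    xdot x (w - w') = xdot x w - xdot x w' := by
  simp [xdot, mul_sub, Finset.sum_sub_distrib]

/-- `f ∈ H¹` with weak gradient `g`. -/
structure IsPair (f : Space d → ℂ) (g : Space d → EuclideanSpace ℂ (Fin d)) : Prop where
  weak : IsWeakGrad f g
  left : MemLp f 2 volume
  right : MemLp g 2 volume

theorem MemH1.isPair {f : Space d → ℂ} (hf : MemH1 f) : IsPair f (weakGrad f) := by
  refine ⟨?_, hf.1, hf.2.2⟩
  have h := hf.2.1
  rw [weakGrad, dif_pos h]
  exact h.choose_spec

theorem isTest_comp_sub (n : ℕ) (x : Space d) : IsTest fun y => mollifier d n (x - y) := by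
  refine ⟨(contDiff_mollifier n).comp (contDiff_const.sub contDiff_id), ?_⟩
  have := (hasCompactSupport_mollifier (d := d) n).comp_homeomorph (Homeomorph.subLeft x)
  simpa [Function.comp_def] using this

theorem integrable_smul_of_isTest {F : Type*} [NormedAddCommGroup F] [NormedSpace ℝ F]
    {φ : Space d → ℝ} (hφ : Continuous φ) (hs : HasCompactSupport φ) {f : Space d → F}
    (hf : LocallyIntegrable f volume) : Integrable (fun x => φ x • f x) volume :=
  hf.integrable_smul_left_of_hasCompactSupport hφ hs

theorem IsTest.continuous_pderiv {φ : Space d → ℝ} (hφ : IsTest φ) (j : Fin d) :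
    Continuous (pderiv j φ) :=
  (hφ.1.continuous_fderiv (by simp)).clm_apply continuous_const

theorem IsTest.hasCompactSupport_pderiv {φ : Space d → ℝ} (hφ : IsTest φ) (j : Fin d) :
    HasCompactSupport (pderiv j φ) :=
  (hφ.2.fderiv ℝ).comp_left (g := fun L : Space d →L[ℝ] ℝ => L (EuclideanSpace.single j 1)) rfl

theorem locallyIntegrable_eval {g : Space d → EuclideanSpace ℂ (Fin d)}
    (hg : LocallyIntegrable g volume) (j : Fin d) : LocallyIntegrable (fun x => g x j) volume :=
  fun x => by
    obtain ⟨s, hs, hi⟩ := hg x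
    exact ⟨s, hs, ((EuclideanSpace.proj j :
      EuclideanSpace ℂ (Fin d) →L[ℂ] ℂ)).integrable_comp hi⟩

theorem memLp_eval {g : Space d → EuclideanSpace ℂ (Fin d)} {μ : Measure (Space d)}
    (hg : MemLp g 2 μ) (j : Fin d) : MemLp (fun x => g x j) 2 μ :=
  ((EuclideanSpace.proj j : EuclideanSpace ℂ (Fin d) →L[ℂ] ℂ)).comp_memLp' hg

theorem IsPair.sub {f f' : Space d → ℂ} {g g' : Space d → EuclideanSpace ℂ (Fin d)}
    (h : IsPair f g) (h' : IsPair f' g') : IsPair (f - f') (g - g') := by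
  refine ⟨⟨h.weak.1.sub h'.weak.1, h.weak.2.1.sub h'.weak.2.1, fun φ hφ j => ?_⟩,
    h.left.sub h'.left, h.right.sub h'.right⟩
  simp only [Pi.sub_apply, PiLp.sub_apply, smul_sub]
  rw [integral_sub, integral_sub, h.weak.2.2 φ hφ j, h'.weak.2.2 φ hφ j]
  · ring
  · exact integrable_smul_of_isTest hφ.1.continuous hφ.2 (locallyIntegrable_eval h.weak.2.1 j)
  · exact integrable_smul_of_isTest hφ.1.continuous hφ.2 (locallyIntegrable_eval h'.weak.2.1 j)
  · exact integrable_smul_of_isTest (hφ.continuous_pderiv j) (hφ.hasCompactSupport_pderiv j) h.weak.1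
  · exact integrable_smul_of_isTest (hφ.continuous_pderiv j) (hφ.hasCompactSupport_pderiv j) h'.weak.1

/-- The derivative falls on the mollifier, and `y ↦ mollifier d n (x - y)` is itself an admissible
test function in the definition of the weak gradient; the two signs cancel. -/
theorem fderiv_mol_eq_xdot {f : Space d → ℂ} {g : Space d → EuclideanSpace ℂ (Fin d)}
    (h : IsWeakGrad f g) (n : ℕ) (x v : Space d) :
    fderiv ℝ (mol n f) x v = xdot v (mol n g x) := by
  have key : ∀ j : Fin d, fderiv ℝ (mol n f) x (EuclideanSpace.single j (1 : ℝ)) = mol n g x j := by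
    intro j
    have h1 := h.2.2 _ (isTest_comp_sub n x) j
    have h2 : ∀ y, pderiv j (fun y => mollifier d n (x - y)) y
        = - fderiv ℝ (mollifier d n) (x - y) (EuclideanSpace.single j (1 : ℝ)) := by
      intro y
      have h3 : HasFDerivAt (fun y => mollifier d n (x - y))
          ((fderiv ℝ (mollifier d n) (x - y)).comp (-ContinuousLinearMap.id ℝ (Space d))) y :=
        (((contDiff_mollifier n).differentiable (by simp)) (x - y)).hasFDerivAt.comp y
          ((hasFDerivAt_id y).const_sub x)
      rw [pderiv, h3.fderiv]
      simp
    simp only [h2, neg_smul] at h1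
    rw [integral_neg, neg_inj] at h1
    rw [fderiv_mol n h.1, h1, mol_eval h.2.1, mol_apply]
  rw [fderiv_apply_self_eq_sum, xdot]
  exact Finset.sum_congr rfl fun j _ => by rw [key j, Complex.real_smul]

theorem norm_fderiv_mol_le {f : Space d → ℂ} {g : Space d → EuclideanSpace ℂ (Fin d)}
    (h : IsWeakGrad f g) (n : ℕ) (x : Space d) : ‖fderiv ℝ (mol n f) x‖ ≤ ‖mol n g x‖ :=
  ContinuousLinearMap.opNorm_le_bound _ (norm_nonneg _) fun v => by
    rw [fderiv_mol_eq_xdot h, mul_comm]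
    exact norm_xdot_le _ _

/-- Local Sobolev inequality with a cutoff. -/
theorem exists_eLpNorm_cutoff_le (hd : 0 < d) {p q : NNReal} (hp : 1 ≤ p)
    (hpq : (q : ℝ)⁻¹ = (p : ℝ)⁻¹ - (d : ℝ)⁻¹) :
    ∃ C : NNReal, ∀ (η : Space d → ℝ) (C₀ : NNReal) (K K' : Set (Space d)) (δ : ℝ)
      (f : Space d → ℂ) (g : Space d → EuclideanSpace ℂ (Fin d)),
      ContDiff ℝ ∞ η → HasCompactSupport η → (∀ x, |η x| ≤ 1) → (∀ x, ‖fderiv ℝ η x‖ ≤ C₀) →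
      MeasurableSet K → MeasurableSet K' → (∀ x, x ∉ K → η x = 0 ∧ fderiv ℝ η x = 0) → 0 < δ →
      (∀ x ∈ K, ∀ y, ‖y‖ < δ → x - y ∈ K') → IsPair f g →
      eLpNorm (fun x => η x • f x) q volume ≤
        C * (eLpNorm g p (volume.restrict K') + C₀ * eLpNorm f p (volume.restrict K')) := by
  refine ⟨SNormLESNormFDerivOfEqConst ℂ (volume : Measure (Space d)) p, ?_⟩
  intro η C₀ K K' δ f g hη hηs hη1 hηd hK hK' hηK hδ hKK' hfg
  set C := SNormLESNormFDerivOfEqConst ℂ (volume : Measure (Space d)) p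
  have hp0 : (1 : ℝ≥0∞) ≤ p := by exact_mod_cast hp
  have hpr : (1 : ℝ) ≤ (p : ℝ) := by exact_mod_cast hp
  have hpe : ENNReal.ofReal (p : ℝ) = p := ENNReal.ofReal_coe_nnreal
  have hsm : ∀ n, ContDiff ℝ ∞ (mol n f) := fun n => contDiff_mol n hfg.weak.1
  have hwc : ∀ n, ContDiff ℝ 1 (fun x => η x • mol n f x) := fun n =>
    (hη.smul (hsm n)).of_le (by simp)
  have hgc : ∀ n, Continuous (mol n g) := fun n => continuous_mol n hfg.weak.2.1
  have hfd : ∀ n x, ‖fderiv ℝ (fun x => η x • mol n f x) x‖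
      ≤ K.indicator (fun x => ‖mol n g x‖ + C₀ * ‖mol n f x‖) x := by
    intro n x
    have h1 := ((hη.differentiable (by simp)) x).hasFDerivAt.smul
      (((hsm n).differentiable (by simp)) x).hasFDerivAt
    have h2 : fderiv ℝ (fun x => η x • mol n f x) x = _ := h1.fderiv
    rw [h2]
    by_cases hx : x ∈ K
    · rw [Set.indicator_of_mem hx]
      refine (norm_add_le _ _).trans (add_le_add ?_ ?_)
      · rw [norm_smul, Real.norm_eq_abs]
        calc _ ≤ 1 * ‖mol n g x‖ := mul_le_mul (hη1 x) (norm_fderiv_mol_le hfg.weak n x)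
              (norm_nonneg _) zero_le_one
          _ = _ := one_mul _
      · refine (ContinuousLinearMap.opNorm_le_bound _ (by positivity) fun v => ?_)
        rw [ContinuousLinearMap.smulRight_apply, norm_smul]
        calc _ ≤ (C₀ * ‖v‖) * ‖mol n f x‖ := by
              gcongr
              exact ((fderiv ℝ η x).le_opNorm v).trans (by gcongr; exact hηd x)
          _ = _ := by ring
    · rw [Set.indicator_of_notMem hx, (hηK x hx).1, (hηK x hx).2]
      simp
  -- Gagliardo–Nirenberg–Sobolev applies to the smooth compactly supported `η • mol n f`. Once the
  -- mollification radius is below `δ`, the right side involves `f` and `g` on `K'` only, uniformly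
  -- in `n`.
  have hbound : ∀ᶠ n in atTop, eLpNorm (fun x => η x • mol n f x) q volume ≤
      C * (eLpNorm g p (volume.restrict K') + C₀ * eLpNorm f p (volume.restrict K')) := by
    filter_upwards [(tendsto_bump_rOut (d := d)).eventually (gt_mem_nhds hδ)] with n hn
    have hgns := eLpNorm_le_eLpNorm_fderiv_of_eq (F := ℂ) (volume : Measure (Space d)) (hwc n)
      (hηs.smul_right) hp (by simpa using hd) (p' := q) (by simpa using hpq)
    refine hgns.trans ?_
    gcongr
    have hyoung : ∀ y : Space d, ‖y‖ < (bump d n).rOut → ‖y‖ < δ := fun y hy => hy.trans hn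
    calc eLpNorm (fderiv ℝ (fun x => η x • mol n f x)) p volume
        ≤ eLpNorm (K.indicator (fun x => ‖mol n g x‖ + C₀ * ‖mol n f x‖)) p volume :=
          eLpNorm_mono_real (hfd n)
      _ = eLpNorm (fun x => ‖mol n g x‖ + C₀ * ‖mol n f x‖) p (volume.restrict K) :=
          eLpNorm_indicator_eq_eLpNorm_restrict hK
      _ ≤ eLpNorm (fun x => ‖mol n g x‖) p (volume.restrict K)
          + eLpNorm (fun x => (C₀ : ℝ) • ‖mol n f x‖) p (volume.restrict K) :=
          eLpNorm_add_le (hgc n).norm.aestronglyMeasurable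
            (((hsm n).continuous.norm.const_smul (C₀ : ℝ))).aestronglyMeasurable hp0
      _ = eLpNorm (mol n g) p (volume.restrict K)
          + C₀ * eLpNorm (mol n f) p (volume.restrict K) := by
          have := eLpNorm_const_smul (C₀ : ℝ) (fun x => ‖mol n f x‖) p (volume.restrict K)
          rw [eLpNorm_norm, show (fun x => (C₀ : ℝ) • ‖mol n f x‖) = (C₀ : ℝ) • fun x => ‖mol n f x‖
            from rfl, this, eLpNorm_norm]
          simp
      _ ≤ _ := by
          have h1 := eLpNorm_mol_le hpr n hfg.right.1 hK hK'
            (fun x hx y hy => hKK' x hx y (hyoung y hy))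
          have h2 := eLpNorm_mol_le hpr n hfg.left.1 hK hK'
            (fun x hx y hy => hKK' x hx y (hyoung y hy))
          rw [hpe] at h1 h2
          gcongr
  -- The bound survives the limit because norms are lower semicontinuous under almost everywhere
  -- convergence.
  refine (Lp.eLpNorm_lim_le_liminf_eLpNorm (fun n => (hwc n).continuous.aestronglyMeasurable) _
    ((ae_tendsto_mol hfg.weak.1).mono fun x hx => hx.const_smul (η x))).trans ?_
  refine liminf_le_of_frequently_le' hbound.frequently

/-- The Sobolev embedding `H¹ ⊂ L^{2d/(d-2)}`. -/
theorem exists_eLpNorm_sobolev_le (hd : 3 ≤ d) :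
    ∃ C : NNReal, ∀ (f : Space d → ℂ) (g : Space d → EuclideanSpace ℂ (Fin d)), IsPair f g →
      eLpNorm f (ENNReal.ofReal (2 * d / ((d : ℝ) - 2))) volume
        ≤ C * (eLpNorm g 2 volume + eLpNorm f 2 volume) := by
  have hd' : (3 : ℝ) ≤ d := by exact_mod_cast hd
  have hq0 : 0 < 2 * d / ((d : ℝ) - 2) := by apply div_pos <;> linarith
  obtain ⟨C, hC⟩ := exists_eLpNorm_cutoff_le (d := d) (by omega) (p := 2)
    (q := (2 * d / ((d : ℝ) - 2)).toNNReal) (by norm_num) (by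
      rw [Real.coe_toNNReal _ hq0.le]
      have : (d : ℝ) - 2 ≠ 0 := by linarith
      field_simp
      push_cast
      field_simp)
  set φ : Space d → ℝ := fun x => bump d 0 x with hφ
  have hφc : ContDiff ℝ ∞ φ := (bump d 0).contDiff
  have hφs : HasCompactSupport φ := (bump d 0).hasCompactSupport
  obtain ⟨C₁, hC₁⟩ := (hφs.fderiv ℝ).exists_bound_of_continuous (hφc.continuous_fderiv (by simp))
  refine ⟨C * (1 + C₁.toNNReal), fun f g hfg => ?_⟩
  -- The cutoffs are the dilates `φ(a n • x)`: they tend to `1` because the bump is `1` near the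
  -- origin, and `a n ≤ 1` keeps their gradients bounded by `C₁`.
  set a : ℕ → ℝ := fun n => ((n : ℝ) + 1)⁻¹ with ha
  have ha0 : ∀ n, 0 < a n := fun n => by positivity
  have ha1 : ∀ n, a n ≤ 1 := fun n => inv_le_one_of_one_le₀ (by linarith [n.cast_nonneg (α := ℝ)])
  have hηd : ∀ n x, HasFDerivAt (fun x => φ (a n • x)) (a n • fderiv ℝ φ (a n • x)) x := by
    intro n x
    have h1 := ((hφc.differentiable (by simp)) (a n • x)).hasFDerivAt.comp x
      ((hasFDerivAt_id x).const_smul (a n))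
    refine h1.congr_fderiv ?_
    ext v
    simp
  have hlim : ∀ x : Space d, Tendsto (fun n => φ (a n • x) • f x) atTop (𝓝 (f x)) := by
    intro x
    have h1 : Tendsto (fun n => a n • x) atTop (𝓝 ((0 : ℝ) • x)) := by
      have := (tendsto_one_div_add_atTop_nhds_zero_nat (𝕜 := ℝ)).smul_const x
      simpa [ha] using this
    have h2 := (hφc.continuous.tendsto _).comp h1
    have h3 : φ ((0 : ℝ) • x) = 1 := by
      rw [zero_smul]
      exact (bump d 0).one_of_mem_closedBall (by simpa using (bump d 0).rIn_pos.le)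
    rw [h3] at h2
    simpa using h2.smul_const (f x)
  refine (Lp.eLpNorm_lim_le_liminf_eLpNorm (f := fun n x => φ (a n • x) • f x) (fun n => ?_) _
    (Eventually.of_forall hlim)).trans ?_
  · exact (hφc.continuous.comp (continuous_const_smul (a n))).aestronglyMeasurable.smul hfg.left.1
  refine liminf_le_of_frequently_le' (Frequently.of_forall fun n => ?_)
  have := hC (fun x => φ (a n • x)) C₁.toNNReal Set.univ Set.univ 1 f g
    (hφc.comp (contDiff_const_smul (a n)))
    (by
      have := hφs.comp_homeomorph (Homeomorph.smulOfNeZero (a n) (ha0 n).ne')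
      simpa [Function.comp_def] using this)
    (fun x => by rw [abs_of_nonneg (bump d 0).nonneg]; exact (bump d 0).le_one)
    (fun x => by
      rw [(hηd n x).fderiv, norm_smul, Real.norm_eq_abs, abs_of_pos (ha0 n)]
      calc _ ≤ 1 * C₁ := mul_le_mul (ha1 n) (hC₁ _) (norm_nonneg _) zero_le_one
        _ ≤ _ := by rw [one_mul]; exact Real.le_coe_toNNReal _)
    MeasurableSet.univ MeasurableSet.univ (fun x hx => absurd (Set.mem_univ x) hx) one_pos
    (fun _ _ _ _ => Set.mem_univ _) hfg
  refine this.trans ?_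
  simp only [Measure.restrict_univ]
  push_cast
  rw [mul_assoc]
  gcongr
  rw [mul_add, add_mul, add_mul, one_mul, one_mul]
  gcongr
  · exact le_self_add
  · exact le_add_self

end INLS
end

/-! ### Continuity of integral functionals dominated by an energy density. -/

noncomputable section
namespace INLS

variable {d : ℕ}

/-- Dominated convergence with a dominating function that is the sum of a fixed integrable function
and of terms tending to zero in `L¹`. -/
theorem tendsto_lintegral_enorm_sub_of_dominated_add {α E : Type*} [MeasurableSpace α]
    {μ : Measure α} [NormedAddCommGroup E] {F : ℕ → α → E} {f : α → E} {D : α → ℝ≥0∞}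
    {e : ℕ → α → ℝ≥0∞} (hF : ∀ n, AEStronglyMeasurable (F n) μ) (hf : AEStronglyMeasurable f μ)
    (hDm : AEMeasurable D μ) (hD : ∫⁻ x, D x ∂μ ≠ ⊤)
    (hae : ∀ᵐ x ∂μ, Tendsto (fun n => F n x) atTop (𝓝 (f x)))
    (hbound : ∀ n, ∀ᵐ x ∂μ, ‖F n x - f x‖ₑ ≤ D x + e n x)
    (he : Tendsto (fun n => ∫⁻ x, e n x ∂μ) atTop (𝓝 0)) :
    Tendsto (fun n => ∫⁻ x, ‖F n x - f x‖ₑ ∂μ) atTop (𝓝 0) := by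
  have hm : ∀ n, AEMeasurable (fun x => ‖F n x - f x‖ₑ) μ := fun n => ((hF n).sub hf).enorm
  -- Truncating at `D` gives a genuinely dominated sequence; whatever exceeds `D` is bounded by `e
  -- n`, which vanishes in the mean.
  have h1 : Tendsto (fun n => ∫⁻ x, min ‖F n x - f x‖ₑ (D x) ∂μ) atTop (𝓝 (∫⁻ _, 0 ∂μ)) := by
    refine tendsto_lintegral_of_dominated_convergence' D (fun n => (hm n).min hDm)
      (fun n => Eventually.of_forall fun x => min_le_right _ _) hD (hae.mono fun x hx => ?_)
    have h2 : Tendsto (fun n => ‖F n x - f x‖ₑ) atTop (𝓝 0) := by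
      simpa using (hx.sub tendsto_const_nhds).enorm (f := fun n => F n x - f x) (a := f x - f x)
    exact tendsto_of_tendsto_of_tendsto_of_le_of_le tendsto_const_nhds h2 (fun n => zero_le)
      (fun n => min_le_left _ _)
  rw [lintegral_zero] at h1
  have h2 := h1.add he
  rw [add_zero] at h2
  refine tendsto_of_tendsto_of_tendsto_of_le_of_le tendsto_const_nhds h2 (fun n => zero_le)
    (fun n => ?_)
  simp only
  rw [← lintegral_add_left' ((hm n).min hDm)]
  refine lintegral_mono_ae ((hbound n).mono fun x hx => ?_)
  rcases le_total ‖F n x - f x‖ₑ (D x) with h | h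
  · rw [min_eq_left h]; exact le_self_add
  · rw [min_eq_right h]; exact hx

/-- The energy density controlling all the quantities in the virial identity. -/
def dens (a : Space d → ℝ) (q : ℝ) (x : Space d) (z : ℂ) (w : EuclideanSpace ℂ (Fin d)) : ℝ :=
  a x * ‖z‖ ^ 2 + ‖w‖ ^ 2 + ‖z‖ ^ q

theorem dens_nonneg {a : Space d → ℝ} (ha : ∀ x, 1 ≤ a x) (q : ℝ) (x : Space d) (z : ℂ)
    (w : EuclideanSpace ℂ (Fin d)) : 0 ≤ dens a q x z w := by
  have := ha x
  unfold dens
  positivity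

theorem add_rpow_le_two_rpow {s t q : ℝ} (hs : 0 ≤ s) (ht : 0 ≤ t) (hq : 0 ≤ q) :
    (s + t) ^ q ≤ 2 ^ q * (s ^ q + t ^ q) := by
  have h1 : (s + t) ^ q ≤ (2 * max s t) ^ q :=
    Real.rpow_le_rpow (by positivity) (by linarith [le_max_left s t, le_max_right s t]) hq
  rw [Real.mul_rpow (by norm_num) (le_max_of_le_left hs)] at h1
  refine h1.trans (mul_le_mul_of_nonneg_left ?_ (by positivity))
  rcases max_choice s t with h | h <;> rw [h]
  · linarith [Real.rpow_nonneg ht q]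
  · linarith [Real.rpow_nonneg hs q]

theorem dens_add_le {a : Space d → ℝ} (ha : ∀ x, 1 ≤ a x) {q : ℝ} (hq : 0 ≤ q) (x : Space d)
    (z z' : ℂ) (w w' : EuclideanSpace ℂ (Fin d)) :
    dens a q x (z + z') (w + w') ≤ (2 + 2 ^ q) * (dens a q x z w + dens a q x z' w') := by
  have hz : ‖z + z'‖ ^ 2 ≤ 2 * (‖z‖ ^ 2 + ‖z'‖ ^ 2) := by
    have := norm_add_le z z'
    nlinarith [sq_nonneg (‖z‖ - ‖z'‖), norm_nonneg (z + z')]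
  have hw : ‖w + w'‖ ^ 2 ≤ 2 * (‖w‖ ^ 2 + ‖w'‖ ^ 2) := by
    have := norm_add_le w w'
    nlinarith [sq_nonneg (‖w‖ - ‖w'‖), norm_nonneg (w + w')]
  have hq' : ‖z + z'‖ ^ q ≤ 2 ^ q * (‖z‖ ^ q + ‖z'‖ ^ q) :=
    (Real.rpow_le_rpow (norm_nonneg _) (norm_add_le _ _) hq).trans
      (add_rpow_le_two_rpow (norm_nonneg _) (norm_nonneg _) hq)
  have h2 : (0 : ℝ) ≤ 2 ^ q := by positivity
  have hax := ha x
  have hz2 := mul_le_mul_of_nonneg_left hz (zero_le_one.trans hax)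
  have p1 : 0 ≤ a x * ‖z‖ ^ 2 := by positivity
  have p2 : 0 ≤ a x * ‖z'‖ ^ 2 := by positivity
  have p3 : 0 ≤ ‖z‖ ^ q := by positivity
  have p4 : 0 ≤ ‖z'‖ ^ q := by positivity
  unfold dens
  nlinarith [mul_nonneg h2 p1, mul_nonneg h2 p2, mul_nonneg h2 (sq_nonneg ‖w‖),
    mul_nonneg h2 (sq_nonneg ‖w'‖)]

theorem measurable_dens {a : Space d → ℝ} (ha : Measurable a) (q : ℝ) :
    Measurable fun p : Space d × ℂ × EuclideanSpace ℂ (Fin d) => dens a q p.1 p.2.1 p.2.2 := by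
  unfold dens
  exact (((ha.comp measurable_fst).mul (measurable_snd.fst.norm.pow_const 2)).add
    (measurable_snd.snd.norm.pow_const 2)).add (measurable_snd.fst.norm.pow_const q)

theorem aestronglyMeasurable_comp_pair {E : Type*} [NormedAddCommGroup E] [MeasurableSpace E]
    [BorelSpace E] [SecondCountableTopology E] {Φ : Space d → ℂ → EuclideanSpace ℂ (Fin d) → E}
    (hΦ : Measurable fun p : Space d × ℂ × EuclideanSpace ℂ (Fin d) => Φ p.1 p.2.1 p.2.2)
    {μ : Measure (Space d)} {f : Space d → ℂ} {g : Space d → EuclideanSpace ℂ (Fin d)}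
    (hf : AEStronglyMeasurable f μ) (hg : AEStronglyMeasurable g μ) :
    AEStronglyMeasurable (fun x => Φ x (f x) (g x)) μ :=
  (hΦ.comp_aemeasurable (aemeasurable_id.prodMk (hf.aemeasurable.prodMk
    hg.aemeasurable))).aestronglyMeasurable

/-- Integrals of densities dominated by `dens` depend continuously on `(f, g)`. -/
theorem tendsto_integral_of_dens {ι E : Type*} [NormedAddCommGroup E] [NormedSpace ℝ E]
    [MeasurableSpace E] [BorelSpace E] [SecondCountableTopology E]
    {l : Filter ι} [l.IsCountablyGenerated] {a : Space d → ℝ} (ha : ∀ x, 1 ≤ a x)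
    (ham : Measurable a) {q : ℝ} (hq : 0 ≤ q) {μ : Measure (Space d)}
    {fi : ι → Space d → ℂ} {gi : ι → Space d → EuclideanSpace ℂ (Fin d)}
    {f : Space d → ℂ} {g : Space d → EuclideanSpace ℂ (Fin d)}
    (hfi : ∀ i, AEStronglyMeasurable (fi i) μ) (hgi : ∀ i, AEStronglyMeasurable (gi i) μ)
    (hf : AEStronglyMeasurable f μ) (hg : AEStronglyMeasurable g μ)
    (hfin : ∫⁻ x, ENNReal.ofReal (dens a q x (f x) (g x)) ∂μ ≠ ⊤)
    (h0 : Tendsto (fun i => ∫⁻ x, ENNReal.ofReal (dens a q x (fi i x - f x) (gi i x - g x)) ∂μ) l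
      (𝓝 0))
    {Φ : Space d → ℂ → EuclideanSpace ℂ (Fin d) → E}
    (hΦm : Measurable fun p : Space d × ℂ × EuclideanSpace ℂ (Fin d) => Φ p.1 p.2.1 p.2.2)
    (hΦc : ∀ x, Continuous fun p : ℂ × EuclideanSpace ℂ (Fin d) => Φ x p.1 p.2)
    {h : Space d → ℝ} (hh : Integrable h μ) {C : ℝ} (hC : 0 ≤ C)
    (hb : ∀ x z w, ‖Φ x z w‖ ≤ h x + C * dens a q x z w) :
    Integrable (fun x => Φ x (f x) (g x)) μ ∧
    Tendsto (fun i => ∫ x, Φ x (fi i x) (gi i x) ∂μ) l (𝓝 (∫ x, Φ x (f x) (g x) ∂μ)) := by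
  set dn : (Space d → ℂ) → (Space d → EuclideanSpace ℂ (Fin d)) → Space d → ℝ≥0∞ :=
    fun f g x => ENNReal.ofReal (dens a q x (f x) (g x)) with hdn
  have hdnm : ∀ f g, AEStronglyMeasurable f μ → AEStronglyMeasurable g μ → AEMeasurable (dn f g) μ :=
    fun f g hf hg => ((measurable_dens ham q).comp_aemeasurable
      (aemeasurable_id.prodMk (hf.aemeasurable.prodMk hg.aemeasurable))).ennreal_ofReal
  have hΦi : ∀ f g, AEStronglyMeasurable f μ → AEStronglyMeasurable g μ → ∫⁻ x, dn f g x ∂μ ≠ ⊤ →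
      Integrable (fun x => Φ x (f x) (g x)) μ := by
    intro f g hf hg hfin
    have hi : Integrable (fun x => dens a q x (f x) (g x)) μ := by
      refine ⟨((measurable_dens ham q).comp_aemeasurable
        (aemeasurable_id.prodMk (hf.aemeasurable.prodMk hg.aemeasurable))).aestronglyMeasurable, ?_⟩
      rw [hasFiniteIntegral_iff_ofReal (Eventually.of_forall fun x => dens_nonneg ha q x _ _)]
      exact hfin.lt_top
    exact (hh.add (hi.const_mul C)).mono' (aestronglyMeasurable_comp_pair hΦm hf hg)
      (Eventually.of_forall fun x => hb x _ _)
  refine ⟨hΦi f g hf hg hfin, ?_⟩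
  -- The filter is countably generated, so it suffices to treat sequences and to find a convergent
  -- subsequence of each.
  refine tendsto_of_subseq_tendsto fun ns hns => ?_
  have h0n := h0.comp hns
  have hsq : ∀ (p : Space d → ℂ) (p' : Space d → EuclideanSpace ℂ (Fin d)),
      eLpNorm p 2 μ ≤ (∫⁻ x, dn p p' x ∂μ) ^ ((1 : ℝ) / 2) ∧
      eLpNorm p' 2 μ ≤ (∫⁻ x, dn p p' x ∂μ) ^ ((1 : ℝ) / 2) := by
    intro p p'
    rw [eLpNorm_eq_lintegral_rpow_enorm_toReal (by simp) (by simp),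
      eLpNorm_eq_lintegral_rpow_enorm_toReal (by simp) (by simp)]
    simp only [ENNReal.toReal_ofNat, ENNReal.rpow_ofNat]
    refine ⟨ENNReal.rpow_le_rpow (lintegral_mono fun x => ?_) (by norm_num),
      ENNReal.rpow_le_rpow (lintegral_mono fun x => ?_) (by norm_num)⟩
    · rw [← ofReal_norm, ← ENNReal.ofReal_pow (norm_nonneg _)]
      refine ENNReal.ofReal_le_ofReal ?_
      have h1 := ha x
      have h2 : 0 ≤ ‖p x‖ ^ q := by positivity
      simp only [dens]
      nlinarith [sq_nonneg ‖p x‖, sq_nonneg ‖p' x‖]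
    · rw [← ofReal_norm, ← ENNReal.ofReal_pow (norm_nonneg _)]
      refine ENNReal.ofReal_le_ofReal ?_
      have h1 := ha x
      have h2 : 0 ≤ ‖p x‖ ^ q := by positivity
      simp only [dens]
      nlinarith [sq_nonneg ‖p x‖, sq_nonneg ‖p' x‖]
  have hroot : Tendsto (fun n => (∫⁻ x, dn (fi (ns n) - f) (gi (ns n) - g) x ∂μ) ^ ((1 : ℝ) / 2))
      atTop (𝓝 0) := by
    have := (ENNReal.continuous_rpow_const (y := (1 : ℝ) / 2)).continuousAt.tendsto.comp h0n
    simpa [Function.comp_def, hdn] using this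
  have hL2f : Tendsto (fun n => eLpNorm (fi (ns n) - f) 2 μ) atTop (𝓝 0) :=
    tendsto_of_tendsto_of_tendsto_of_le_of_le tendsto_const_nhds hroot (fun n => zero_le)
      (fun n => (hsq _ (gi (ns n) - g)).1)
  have hL2g : Tendsto (fun n => eLpNorm (gi (ns n) - g) 2 μ) atTop (𝓝 0) :=
    tendsto_of_tendsto_of_tendsto_of_le_of_le tendsto_const_nhds hroot (fun n => zero_le)
      (fun n => (hsq (fi (ns n) - f) _).2)
  -- `L²` convergence gives almost everywhere convergence along a subsequence, extracted for the
  -- functions and then once more for the gradients.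
  obtain ⟨ms, hms, hmf⟩ := (tendstoInMeasure_of_tendsto_eLpNorm (by simp)
    (fun n => hfi (ns n)) hf hL2f).exists_seq_tendsto_ae
  obtain ⟨ks, hks, hkg⟩ := (tendstoInMeasure_of_tendsto_eLpNorm (by simp)
    (fun n => hgi (ns (ms n))) hg (hL2g.comp hms.tendsto_atTop)).exists_seq_tendsto_ae
  refine ⟨fun n => ms (ks n), ?_⟩
  have hmk : Tendsto (fun n => ms (ks n)) atTop atTop := hms.tendsto_atTop.comp hks.tendsto_atTop
  set c : ℝ := 2 + 2 ^ q with hc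
  have hc0 : 0 ≤ c := by positivity
  have he0 : Tendsto (fun n => ∫⁻ x, ENNReal.ofReal (C * c) *
      dn (fi (ns (ms (ks n))) - f) (gi (ns (ms (ks n))) - g) x ∂μ) atTop (𝓝 0) := by
    have h1 := ENNReal.Tendsto.const_mul (a := ENNReal.ofReal (C * c)) (h0n.comp hmk)
      (Or.inr ENNReal.ofReal_ne_top)
    rw [mul_zero] at h1
    refine h1.congr fun n => ?_
    rw [lintegral_const_mul'' _ (hdnm _ _ ((hfi _).sub hf) ((hgi _).sub hg))]
    rfl
  -- The dominating function: using `hb` at both arguments and `dens_add_le` for `f + (fi - f)`, the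
  -- difference of the integrands is at most `2|h| + (C c + C) dens(f,g)` plus `C c` times the
  -- density of the difference, which is `he0`.
  have hDmeas : AEMeasurable (fun x => ENNReal.ofReal (2 * |h x|) +
      ENNReal.ofReal (C * c + C) * dn f g x) μ :=
    (((hh.1.aemeasurable.abs.const_mul 2).ennreal_ofReal).add
      ((hdnm f g hf hg).const_mul _))
  refine tendsto_integral_of_L1 _ (hΦi f g hf hg hfin).1 ?_
    (tendsto_lintegral_enorm_sub_of_dominated_add
      (fun n => aestronglyMeasurable_comp_pair hΦm (hfi _) (hgi _))
      (aestronglyMeasurable_comp_pair hΦm hf hg) hDmeas ?_ ?_ ?_ he0)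
  · have hlt := (h0n.comp hmk).eventually (gt_mem_nhds (zero_lt_one (α := ℝ≥0∞)))
    filter_upwards [hlt] with n hn
    refine hΦi _ _ (hfi _) (hgi _) (ne_of_lt ?_)
    have h1 : ∀ x, dn (fi (ns (ms (ks n)))) (gi (ns (ms (ks n)))) x ≤ ENNReal.ofReal c *
        (dn f g x + dn (fi (ns (ms (ks n))) - f) (gi (ns (ms (ks n))) - g) x) := by
      intro x
      simp only [hdn]
      rw [← ENNReal.ofReal_add (dens_nonneg ha q x _ _) (dens_nonneg ha q x _ _),
        ← ENNReal.ofReal_mul hc0]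
      refine ENNReal.ofReal_le_ofReal ?_
      have := dens_add_le ha hq x (f x) (fi (ns (ms (ks n))) x - f x) (g x)
        (gi (ns (ms (ks n))) x - g x)
      simpa using this
    refine (lintegral_mono h1).trans_lt ?_
    have hm2 : AEMeasurable (fun x => dn f g x +
        dn (fi (ns (ms (ks n))) - f) (gi (ns (ms (ks n))) - g) x) μ :=
      (hdnm _ _ hf hg).add (hdnm _ _ ((hfi _).sub hf) ((hgi _).sub hg))
    rw [lintegral_const_mul'' _ hm2,
      lintegral_add_left' (hdnm _ _ hf hg)]
    exact ENNReal.mul_lt_top ENNReal.ofReal_lt_top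
      (ENNReal.add_lt_top.2 ⟨hfin.lt_top, hn.trans ENNReal.one_lt_top⟩)
  · rw [lintegral_add_left' ((hh.1.aemeasurable.abs.const_mul 2).ennreal_ofReal),
      lintegral_const_mul'' _ (hdnm _ _ hf hg)]
    refine (ENNReal.add_lt_top.2 ⟨?_, ENNReal.mul_lt_top ENNReal.ofReal_lt_top hfin.lt_top⟩).ne
    exact (hasFiniteIntegral_iff_ofReal (Eventually.of_forall fun x => by positivity)).1
      (hh.abs.const_mul 2).2
  · filter_upwards [hmf, hkg] with x hx1 hx2
    exact ((hΦc x).tendsto (f x, g x)).comp ((hx1.comp hks.tendsto_atTop).prodMk_nhds hx2)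
  · intro n
    refine Eventually.of_forall fun x => ?_
    simp only [hdn]
    rw [← ENNReal.ofReal_mul (by positivity), ← ENNReal.ofReal_mul (by positivity),
      ← ENNReal.ofReal_add (by positivity) (mul_nonneg (by positivity) (dens_nonneg ha q x _ _)),
      ← ENNReal.ofReal_add (add_nonneg (by positivity)
        (mul_nonneg (by positivity) (dens_nonneg ha q x _ _)))
        (mul_nonneg (by positivity) (dens_nonneg ha q x _ _)), ← ofReal_norm]
    refine ENNReal.ofReal_le_ofReal ?_
    have h1 := dens_add_le ha hq x (f x) (fi (ns (ms (ks n))) x - f x) (g x)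
        (gi (ns (ms (ks n))) x - g x)
    simp only [add_sub_cancel] at h1
    have h2 := hb x (f x) (g x)
    have h3 := hb x (fi (ns (ms (ks n))) x) (gi (ns (ms (ks n))) x)
    have h4 := norm_sub_le (Φ x (fi (ns (ms (ks n))) x) (gi (ns (ms (ks n))) x)) (Φ x (f x) (g x))
    have h5 := mul_le_mul_of_nonneg_left h1 hC
    have h6 := le_abs_self (h x)
    simp only [Pi.sub_apply]
    nlinarith

end INLS
end

/-! ### Truncated powers of an `H¹` function and their integration by parts. -/

noncomputable section
namespace INLS

variable {d : ℕ}

/-- With weight `1` and exponent `2` the density is `2‖z‖² + ‖w‖²`, so `L²` convergence of both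
mollifications is all that is needed. -/
theorem tendsto_lintegral_dens_mol {f : Space d → ℂ} {g : Space d → EuclideanSpace ℂ (Fin d)}
    (hf : MemLp f 2 volume) (hg : MemLp g 2 volume) :
    Tendsto (fun n => ∫⁻ x, ENNReal.ofReal (dens (fun _ => 1) 2 x (mol n f x - f x)
      (mol n g x - g x))) atTop (𝓝 0) := by
  have h1 := tendsto_eLpNorm_mol_sub hf
  have h2 := tendsto_eLpNorm_mol_sub hg
  have h3 : Tendsto (fun n => 2 * eLpNorm (mol n f - f) 2 volume ^ 2
      + eLpNorm (mol n g - g) 2 volume ^ 2) atTop (𝓝 (2 * 0 ^ 2 + 0 ^ 2)) :=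
    (ENNReal.Tendsto.const_mul (((ENNReal.continuous_pow 2).tendsto 0).comp h1)
      (Or.inr (by simp))).add (((ENNReal.continuous_pow 2).tendsto 0).comp h2)
  simp only [ne_eq, OfNat.ofNat_ne_zero, not_false_eq_true, zero_pow, mul_zero, add_zero] at h3
  refine h3.congr fun n => ?_
  have hm : AEMeasurable (fun x => ‖mol n f x - f x‖ₑ ^ 2) volume :=
    (((memLp_mol n hf).sub hf).1.enorm.pow_const 2)
  rw [eLpNorm_two_sq, eLpNorm_two_sq]
  simp only [Pi.sub_apply]
  rw [← lintegral_const_mul'' _ hm, ← lintegral_add_left' (hm.const_mul 2)]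
  congr 1
  ext x
  rw [dens, ENNReal.ofReal_add (by positivity) (by positivity),
    ENNReal.ofReal_add (by positivity) (by positivity), one_mul, Real.rpow_two,
    ENNReal.ofReal_pow (norm_nonneg _), ENNReal.ofReal_pow (norm_nonneg _), ofReal_norm, ofReal_norm]
  ring

theorem lintegral_dens_one_ne_top {μ : Measure (Space d)}
    {f : Space d → ℂ} {g : Space d → EuclideanSpace ℂ (Fin d)}
    (hf : MemLp f 2 μ) (hg : MemLp g 2 μ) :
    ∫⁻ x, ENNReal.ofReal (dens (fun _ => 1) 2 x (f x) (g x)) ∂μ ≠ ⊤ := by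
  have hf2 := hf.integrable_norm_pow (p := 2) (by simp)
  have hg2 := hg.integrable_norm_pow (p := 2) (by simp)
  have : Integrable (fun x => dens (fun _ => 1) 2 x (f x) (g x)) μ := by
    exact ((hf2.add hg2).add hf2).congr (Eventually.of_forall fun x => by simp [dens])
  exact ((hasFiniteIntegral_iff_ofReal (Eventually.of_forall fun x =>
    dens_nonneg (fun _ => le_rfl) 2 x _ _)).1 this.2).ne

/-- Passing to the limit in quadratic expressions of mollified functions. -/
theorem tendsto_integral_mol {E : Type*} [NormedAddCommGroup E] [NormedSpace ℝ E]
    [MeasurableSpace E] [BorelSpace E] [SecondCountableTopology E]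
    {f : Space d → ℂ} {g : Space d → EuclideanSpace ℂ (Fin d)}
    (hf : MemLp f 2 volume) (hg : MemLp g 2 volume)
    {Φ : Space d → ℂ → EuclideanSpace ℂ (Fin d) → E}
    (hΦm : Measurable fun p : Space d × ℂ × EuclideanSpace ℂ (Fin d) => Φ p.1 p.2.1 p.2.2)
    (hΦc : ∀ x, Continuous fun p : ℂ × EuclideanSpace ℂ (Fin d) => Φ x p.1 p.2)
    {C : ℝ} (hC : 0 ≤ C) (hb : ∀ x z w, ‖Φ x z w‖ ≤ C * (‖z‖ ^ 2 + ‖w‖ ^ 2)) :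
    Tendsto (fun n => ∫ x, Φ x (mol n f x) (mol n g x)) atTop (𝓝 (∫ x, Φ x (f x) (g x))) := by
  refine (tendsto_integral_of_dens (a := fun _ => 1) (fun _ => le_rfl) measurable_const (q := 2)
    (by norm_num) (fun n => (memLp_mol n hf).1) (fun n => (memLp_mol n hg).1) hf.1 hg.1
    (lintegral_dens_one_ne_top hf hg) (tendsto_lintegral_dens_mol hf hg) hΦm hΦc
    (h := fun _ => 0) (integrable_zero _ _ _) hC fun x z w => ?_).2
  refine (hb x z w).trans ?_
  simp only [dens, zero_add, one_mul, Real.rpow_two]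
  exact mul_le_mul_of_nonneg_left (by nlinarith [sq_nonneg ‖z‖]) hC

theorem abs_re_conj_mul_xdot_le (z : ℂ) (x : Space d) (w : EuclideanSpace ℂ (Fin d)) :
    |(star z * xdot x w).re| ≤ ‖x‖ * (‖z‖ * ‖w‖) := by
  refine (Complex.abs_re_le_norm _).trans ?_
  rw [norm_mul, norm_star]
  calc _ ≤ ‖z‖ * (‖x‖ * ‖w‖) := by gcongr; exact norm_xdot_le x w
    _ = _ := by ring

theorem IsCut.abs_rad_mul_norm_le {k : ℝ → ℝ} (hk : IsCut k) :
    ∃ C : ℝ, 0 ≤ C ∧ ∀ x : Space d, |rad k x| * ‖x‖ ≤ C := by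
  obtain ⟨C, hC, h⟩ := (hk.mul_exp 1).exists_bound
  refine ⟨C, hC.le, fun x => ?_⟩
  by_cases hx : x = 0
  · simp [hx, hC.le]
  · have := h (Real.log ‖x‖)
    rw [norm_sq_mul_exp hx, Real.rpow_one, abs_mul, abs_norm] at this
    rwa [rad_of_ne _ hx]

theorem sq_div_le {s δ : ℝ} (hs : 0 ≤ s) (hδ : 0 < δ) :
    0 ≤ s / (1 + δ * s) ∧ s / (1 + δ * s) ≤ s ∧ s / (1 + δ * s) ≤ δ⁻¹ := by
  have h : 0 < 1 + δ * s := by positivity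
  refine ⟨by positivity, div_le_self hs (by nlinarith), ?_⟩
  rw [div_le_iff₀ h]
  have : δ⁻¹ * (1 + δ * s) = δ⁻¹ + s := by field_simp
  rw [this]
  have : 0 < δ⁻¹ := by positivity
  linarith

/-- The chain rule for the truncated powers `(|f|² / (1 + δ |f|²))^p`, integrated by parts. -/
theorem integral_rad_truncated_pow {f : Space d → ℂ} {g : Space d → EuclideanSpace ℂ (Fin d)}
    (h : IsPair f g) {p δ : ℝ} (hp : 1 ≤ p) (hδ : 0 < δ) {k : ℝ → ℝ} (hk : IsCut k) :
    ∫ x, rad k x * (p * (‖f x‖ ^ 2 / (1 + δ * ‖f x‖ ^ 2)) ^ (p - 1) / (1 + δ * ‖f x‖ ^ 2) ^ 2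
        * (2 * (star (f x) * xdot x (g x)).re))
      = - ∫ x, rad (fun s => d * k s + deriv k s) x
          * (‖f x‖ ^ 2 / (1 + δ * ‖f x‖ ^ 2)) ^ p := by
  have hpos : ∀ z : ℂ, 0 < 1 + δ * ‖z‖ ^ 2 := fun z => by positivity
  -- For the mollified function the truncated power is `C¹`, as `p ≥ 1`, and the identity is the
  -- divergence theorem combined with the classical chain rule.
  have hsm : ∀ n, ∫ x, rad k x * (p * (‖mol n f x‖ ^ 2 / (1 + δ * ‖mol n f x‖ ^ 2)) ^ (p - 1)
        / (1 + δ * ‖mol n f x‖ ^ 2) ^ 2 * (2 * (star (mol n f x) * xdot x (mol n g x)).re))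
      = - ∫ x, rad (fun s => d * k s + deriv k s) x
          * (‖mol n f x‖ ^ 2 / (1 + δ * ‖mol n f x‖ ^ 2)) ^ p := by
    intro n
    have hv : ContDiff ℝ 1 (mol n f) := (contDiff_mol n h.weak.1).of_le (by simp)
    have hG : ContDiff ℝ 1 fun x => (‖mol n f x‖ ^ 2 / (1 + δ * ‖mol n f x‖ ^ 2)) ^ p := by
      refine ContDiff.rpow_const_of_le (m := 1) ?_ (by simpa using hp)
      exact (hv.norm_sq ℝ).div (contDiff_const.add (contDiff_const.mul (hv.norm_sq ℝ)))
        fun x => (hpos _).ne'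
    rw [← integral_rad_mul_fderiv hk hG]
    congr 1
    ext x
    congr 1
    have h1 : HasFDerivAt (fun x => ‖mol n f x‖ ^ 2)
        (2 • (innerSL ℝ (mol n f x)).comp (fderiv ℝ (mol n f) x)) x :=
      ((hv.differentiable (by simp)) x).hasFDerivAt.norm_sq
    have h2 : HasDerivAt (fun s : ℝ => (s / (1 + δ * s)) ^ p)
        (p * (‖mol n f x‖ ^ 2 / (1 + δ * ‖mol n f x‖ ^ 2)) ^ (p - 1)
        / (1 + δ * ‖mol n f x‖ ^ 2) ^ 2) (‖mol n f x‖ ^ 2) := by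
      have h3 : HasDerivAt (fun s : ℝ => 1 + δ * s) δ (‖mol n f x‖ ^ 2) := by
        simpa using ((hasDerivAt_id (‖mol n f x‖ ^ 2)).const_mul δ).const_add 1
      have h4 := ((hasDerivAt_id (‖mol n f x‖ ^ 2)).div h3 (hpos _).ne').rpow_const (p := p)
        (Or.inr hp)
      refine h4.congr_deriv ?_
      have := (hpos (mol n f x)).ne'
      simp only [id, Pi.div_apply]
      field_simp
      ring
    have h5 := (h2.comp_hasFDerivAt x h1).fderiv
    have h6 : fderiv ℝ (fun x => (‖mol n f x‖ ^ 2 / (1 + δ * ‖mol n f x‖ ^ 2)) ^ p) x = _ := h5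
    rw [h6, ← fderiv_mol_eq_xdot h.weak]
    simp [Complex.inner, mul_comm]
    exact Or.inl (by ring)
  obtain ⟨C₁, hC₁, hk1⟩ := hk.abs_rad_mul_norm_le (d := d)
  obtain ⟨C₂, hC₂, hk2⟩ := (hk.div_profile d).exists_bound
  have hmk : Measurable (rad k : Space d → ℝ) := hk.continuous_rad.measurable
  have hmk' : Measurable (rad (fun s => d * k s + deriv k s) : Space d → ℝ) :=
    (hk.div_profile d).continuous_rad.measurable
  have hδp : 0 ≤ δ⁻¹ ^ (p - 1) := by positivity
  have hb1 : ∀ z : ℂ, (‖z‖ ^ 2 / (1 + δ * ‖z‖ ^ 2)) ^ (p - 1) ≤ δ⁻¹ ^ (p - 1) := fun z =>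
    Real.rpow_le_rpow (sq_div_le (by positivity) hδ).1 (sq_div_le (by positivity) hδ).2.2
      (by linarith)
  have hcz : Continuous fun z : ℂ => ‖z‖ ^ 2 / (1 + δ * ‖z‖ ^ 2) :=
    Continuous.div (by fun_prop) (by fun_prop) fun z => (hpos z).ne'
  have hxm := (continuous_xdot (d := d)).measurable
  have hL := tendsto_integral_mol h.left h.right
    (Φ := fun x z w => rad k x * (p * (‖z‖ ^ 2 / (1 + δ * ‖z‖ ^ 2)) ^ (p - 1)
      / (1 + δ * ‖z‖ ^ 2) ^ 2 * (2 * (star z * xdot x w).re)))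
    (C := p * δ⁻¹ ^ (p - 1) * (2 * C₁)) ?_ ?_ (by positivity) ?_
  · have hR := tendsto_integral_mol h.left h.right
      (Φ := fun x z _ => rad (fun s => d * k s + deriv k s) x *
        (‖z‖ ^ 2 / (1 + δ * ‖z‖ ^ 2)) ^ p)
      (C := C₂ * δ⁻¹ ^ (p - 1)) ?_ ?_ (by positivity) ?_
    · exact tendsto_nhds_unique hL (hR.neg.congr fun n => (hsm n).symm)
    · exact (hmk'.comp measurable_fst).mul ((hcz.measurable.comp measurable_snd.fst).pow_const p)
    · intro x
      exact continuous_const.mul (((hcz.comp continuous_fst)).rpow_const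
        fun _ => Or.inr (by linarith))
    · intro x z w
      obtain ⟨h1, h2, h3⟩ := sq_div_le (sq_nonneg ‖z‖) hδ
      -- The truncation gives quadratic growth for every `p`: one factor is bounded by `‖z‖²`, the
      -- remaining power `p - 1` by a constant depending on `δ`. This makes `H¹` convergence of the
      -- mollifications sufficient.
      have h4 : (‖z‖ ^ 2 / (1 + δ * ‖z‖ ^ 2)) ^ p ≤ δ⁻¹ ^ (p - 1) * ‖z‖ ^ 2 := by
        have h5 : (‖z‖ ^ 2 / (1 + δ * ‖z‖ ^ 2)) ^ p = (‖z‖ ^ 2 / (1 + δ * ‖z‖ ^ 2)) ^ (p - 1)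
            * (‖z‖ ^ 2 / (1 + δ * ‖z‖ ^ 2)) := by
          rcases h1.eq_or_lt with h0 | h0
          · rw [← h0, Real.zero_rpow (by linarith)]; simp
          · rw [← Real.rpow_add_one h0.ne']; congr 1; ring
        rw [h5]
        exact mul_le_mul (hb1 z) h2 h1 hδp
      rw [norm_mul, Real.norm_eq_abs, Real.norm_eq_abs, abs_of_nonneg (Real.rpow_nonneg h1 p)]
      calc _ ≤ C₂ * (δ⁻¹ ^ (p - 1) * ‖z‖ ^ 2) :=
            mul_le_mul (IsCut.abs_rad_le hC₂.le hk2 x) h4 (Real.rpow_nonneg h1 p) hC₂.le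
        _ ≤ C₂ * (δ⁻¹ ^ (p - 1) * (‖z‖ ^ 2 + ‖w‖ ^ 2)) := by gcongr; nlinarith [sq_nonneg ‖w‖]
        _ = _ := by ring
  · refine (hmk.comp measurable_fst).mul (Measurable.mul (Measurable.div
      (((hcz.measurable.comp measurable_snd.fst).pow_const (p - 1)).const_mul p) ?_) ?_)
    · exact Continuous.measurable (by fun_prop)
    · refine Measurable.const_mul (Complex.measurable_re.comp (Measurable.mul ?_ ?_)) 2
      · exact continuous_star.measurable.comp measurable_snd.fst
      · exact hxm.comp (measurable_fst.prodMk measurable_snd.snd)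
  · intro x
    refine continuous_const.mul (Continuous.mul (Continuous.div (continuous_const.mul
      (((hcz.comp continuous_fst)).rpow_const fun _ => Or.inr (by linarith))) (by fun_prop)
      fun q => (pow_pos (hpos q.1) 2).ne') ?_)
    refine continuous_const.mul (Complex.continuous_re.comp (Continuous.mul
      (continuous_star.comp continuous_fst) ?_))
    exact continuous_xdot.comp (continuous_const.prodMk continuous_snd)
  · intro x z w
    have h1 : 1 ≤ (1 + δ * ‖z‖ ^ 2) ^ 2 := one_le_pow₀ (by nlinarith [sq_nonneg ‖z‖])
    have h0 := Real.rpow_nonneg (sq_div_le (sq_nonneg ‖z‖) hδ).1 (p - 1)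
    have h2 : |p * (‖z‖ ^ 2 / (1 + δ * ‖z‖ ^ 2)) ^ (p - 1) / (1 + δ * ‖z‖ ^ 2) ^ 2|
        ≤ p * δ⁻¹ ^ (p - 1) := by
      rw [abs_of_nonneg (by positivity)]
      exact (div_le_self (by positivity) h1).trans (mul_le_mul_of_nonneg_left (hb1 z) (by linarith))
    rw [norm_mul, norm_mul, norm_mul, Real.norm_eq_abs, Real.norm_eq_abs, Real.norm_eq_abs,
      Real.norm_eq_abs, abs_two]
    calc _ ≤ |rad k x| * (p * δ⁻¹ ^ (p - 1) * (2 * (‖x‖ * (‖z‖ * ‖w‖)))) := by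
          gcongr
          exact abs_re_conj_mul_xdot_le z x w
      _ = p * δ⁻¹ ^ (p - 1) * (2 * (|rad k x| * ‖x‖)) * (‖z‖ * ‖w‖) := by ring
      _ ≤ p * δ⁻¹ ^ (p - 1) * (2 * C₁) * (‖z‖ ^ 2 + ‖w‖ ^ 2) := by
          have h3 := hk1 x
          have h4 : ‖z‖ * ‖w‖ ≤ ‖z‖ ^ 2 + ‖w‖ ^ 2 := by nlinarith [sq_nonneg (‖z‖ - ‖w‖)]
          gcongr

end INLS
end

/-! ### Chain rule for powers, Hardy's inequality and finiteness of the energy. -/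

noncomputable section
namespace INLS

variable {d : ℕ}

theorem sq_rpow_eq (z : ℂ) (p : ℝ) : (‖z‖ ^ 2) ^ p = ‖z‖ ^ (2 * p) := by
  rw [← Real.rpow_natCast, ← Real.rpow_mul (norm_nonneg z)]
  norm_num

theorem rpow_mul_self_of_one_le {t s : ℝ} (ht : 0 ≤ t) (hs : 0 < s) : t ^ (s - 1) * t = t ^ s := by
  rcases ht.eq_or_lt with h | h
  · rw [← h, Real.zero_rpow hs.ne', mul_zero]
  · rw [← Real.rpow_add_one h.ne']; congr 1; ring

theorem aestronglyMeasurable_xdot {g : Space d → EuclideanSpace ℂ (Fin d)}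
    {μ : Measure (Space d)} (hg : AEStronglyMeasurable g μ) :
    AEStronglyMeasurable (fun x => xdot x (g x)) μ := by
  simp only [xdot]
  refine Finset.aestronglyMeasurable_fun_sum _ fun j _ => ?_
  exact (Continuous.aestronglyMeasurable (by fun_prop)).mul ((EuclideanSpace.proj j :
      EuclideanSpace ℂ (Fin d) →L[ℂ] ℂ).continuous.comp_aestronglyMeasurable hg)

theorem aestronglyMeasurable_re_conj_mul_xdot {f : Space d → ℂ}
    {g : Space d → EuclideanSpace ℂ (Fin d)} {μ : Measure (Space d)}
    (hf : AEStronglyMeasurable f μ) (hg : AEStronglyMeasurable g μ) :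
    AEStronglyMeasurable (fun x => (star (f x) * xdot x (g x)).re) μ :=
  Complex.continuous_re.comp_aestronglyMeasurable
    ((continuous_star.comp_aestronglyMeasurable hf).mul (aestronglyMeasurable_xdot hg))


/-- Chain rule and integration by parts for `|f|^{2p}`. -/
theorem integral_rad_pow {f : Space d → ℂ} {g : Space d → EuclideanSpace ℂ (Fin d)}
    (h : IsPair f g) {p : ℝ} (hp : 1 ≤ p) {k : ℝ → ℝ} (hk : IsCut k) {m : ℝ}
    (hm : ∀ s, m < |s| → k s = 0)
    (hL : MemLp (fun x => ‖f x‖ ^ (2 * p - 1)) 2 (volume.restrict (annulus d m))) :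
    ∫ x, rad k x * (‖f x‖ ^ (2 * p - 2) * (star (f x) * xdot x (g x)).re)
      = - (2 * p)⁻¹ * ∫ x, rad (fun s => d * k s + deriv k s) x * ‖f x‖ ^ (2 * p) := by
  -- `k` vanishes on the open set `m < |s|`, hence so does its derivative, and both sides of the
  -- identity live on the same annulus.
  have hm' : ∀ s, m < |s| → (fun s => d * k s + deriv k s) s = 0 := by
    intro s hs
    have : deriv k s = 0 := by
      have he : k =ᶠ[𝓝 s] fun _ => 0 := by
        filter_upwards [continuous_abs.continuousAt.eventually (lt_mem_nhds hs)] with t ht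
        exact hm t ht
      rw [he.deriv_eq]
      simp
    simp [hm s hs, this]
  set δ : ℕ → ℝ := fun n => ((n : ℝ) + 1)⁻¹ with hδ
  have hδ0 : ∀ n, 0 < δ n := fun n => by positivity
  have hδt : Tendsto δ atTop (𝓝 0) := by
    simpa [hδ] using tendsto_one_div_add_atTop_nhds_zero_nat (𝕜 := ℝ)
  obtain ⟨C₁, hC₁, hk1⟩ := hk.abs_rad_mul_norm_le (d := d)
  obtain ⟨C₂, hC₂, hk2⟩ := (hk.div_profile d).exists_bound
  have hkm : AEStronglyMeasurable (rad k : Space d → ℝ) volume :=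
    hk.continuous_rad.aestronglyMeasurable
  have hkm' : AEStronglyMeasurable (rad (fun s => d * k s + deriv k s) : Space d → ℝ) volume :=
    (hk.div_profile d).continuous_rad.aestronglyMeasurable
  have hfm := h.left.1
  have hre : AEStronglyMeasurable (fun x => (star (f x) * xdot x (g x)).re) volume :=
    aestronglyMeasurable_re_conj_mul_xdot hfm h.right.1
  have hsq : AEStronglyMeasurable (fun x => ‖f x‖ ^ 2) volume := hfm.norm.pow 2
  have hfrac : ∀ n, AEStronglyMeasurable (fun x => ‖f x‖ ^ 2 / (1 + δ n * ‖f x‖ ^ 2)) volume :=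
    fun n => (hsq.aemeasurable.div ((hsq.aemeasurable.const_mul _).const_add 1)).aestronglyMeasurable
  -- The assumption on `‖f‖^(2p-1)` enters here: by Cauchy–Schwarz its products with `‖g‖` and `‖f‖`
  -- are integrable on the annulus and dominate the truncated integrands uniformly in `δ`.
  have hB1 : Integrable ((annulus d m).indicator
      fun x => ‖f x‖ ^ (2 * p - 1) * ‖g x‖) volume := by
    rw [integrable_indicator_iff (measurableSet_annulus m)]
    exact hL.integrable_mul (h.right.norm.restrict _)
  have hB2 : Integrable ((annulus d m).indicator
      fun x => ‖f x‖ ^ (2 * p - 1) * ‖f x‖) volume := by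
    rw [integrable_indicator_iff (measurableSet_annulus m)]
    exact hL.integrable_mul (h.left.norm.restrict _)
  have hlimfrac : ∀ z : ℂ, Tendsto (fun n => ‖z‖ ^ 2 / (1 + δ n * ‖z‖ ^ 2)) atTop (𝓝 (‖z‖ ^ 2)) := by
    intro z
    have : Tendsto (fun n => ‖z‖ ^ 2 / (1 + δ n * ‖z‖ ^ 2)) atTop
        (𝓝 (‖z‖ ^ 2 / (1 + 0 * ‖z‖ ^ 2))) :=
      tendsto_const_nhds.div (tendsto_const_nhds.add (hδt.mul_const _)) (by simp)
    simpa using this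
  have hden : ∀ z : ℂ, Tendsto (fun n => (1 + δ n * ‖z‖ ^ 2) ^ 2) atTop (𝓝 1) := by
    intro z
    have : Tendsto (fun n => (1 + δ n * ‖z‖ ^ 2) ^ 2) atTop (𝓝 ((1 + 0 * ‖z‖ ^ 2) ^ 2)) :=
      (tendsto_const_nhds.add (hδt.mul_const _)).pow 2
    simpa using this
  have hfle : ∀ n (z : ℂ) {r : ℝ}, 0 ≤ r →
      (‖z‖ ^ 2 / (1 + δ n * ‖z‖ ^ 2)) ^ r ≤ ‖z‖ ^ (2 * r) := by
    intro n z r hr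
    rw [← sq_rpow_eq]
    exact Real.rpow_le_rpow (sq_div_le (sq_nonneg _) (hδ0 n)).1
      (sq_div_le (sq_nonneg _) (hδ0 n)).2.1 hr
  have hL1 := tendsto_integral_of_dominated_convergence (μ := (volume : Measure (Space d)))
    (F := fun n x => rad k x * (p * (‖f x‖ ^ 2 / (1 + δ n * ‖f x‖ ^ 2)) ^ (p - 1) /
      (1 + δ n * ‖f x‖ ^ 2) ^ 2 * (2 * (star (f x) * xdot x (g x)).re)))
    (f := fun x => rad k x * (p * (‖f x‖ ^ 2) ^ (p - 1) / 1 * (2 * (star (f x) * xdot x (g x)).re)))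
    (fun x => (2 * p * C₁) * (annulus d m).indicator (fun x => ‖f x‖ ^ (2 * p - 1) * ‖g x‖) x)
    ?_ (hB1.const_mul _) ?_ ?_
  · have hL2 := tendsto_integral_of_dominated_convergence (μ := (volume : Measure (Space d)))
      (F := fun n x => rad (fun s => d * k s + deriv k s) x *
        (‖f x‖ ^ 2 / (1 + δ n * ‖f x‖ ^ 2)) ^ p)
      (f := fun x => rad (fun s => d * k s + deriv k s) x * (‖f x‖ ^ 2) ^ p)
      (fun x => C₂ * (annulus d m).indicator (fun x => ‖f x‖ ^ (2 * p - 1) * ‖f x‖) x)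
      ?_ (hB2.const_mul _) ?_ ?_
    · have h3 := tendsto_nhds_unique hL1
        (hL2.neg.congr fun n => (integral_rad_truncated_pow h hp (hδ0 n) hk).symm)
      have e1 : ∀ x, rad k x * (p * (‖f x‖ ^ 2) ^ (p - 1) / 1 *
          (2 * (star (f x) * xdot x (g x)).re)) = (2 * p) * (rad k x *
          (‖f x‖ ^ (2 * p - 2) * (star (f x) * xdot x (g x)).re)) := by
        intro x
        rw [sq_rpow_eq, show 2 * (p - 1) = 2 * p - 2 by ring]
        ring
      simp only [e1] at h3
      simp only [sq_rpow_eq] at h3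
      rw [integral_const_mul] at h3
      have : 2 * p ≠ 0 := by linarith
      rw [neg_mul, ← mul_neg, ← h3, inv_mul_cancel_left₀ this]
    · exact fun n => hkm'.mul ((hfrac n).aemeasurable.pow_const p).aestronglyMeasurable
    · refine fun n => Eventually.of_forall fun x => ?_
      by_cases hx : x ∈ annulus d m
      · rw [Set.indicator_of_mem hx, norm_mul, Real.norm_eq_abs, Real.norm_eq_abs,
          abs_of_nonneg (Real.rpow_nonneg (sq_div_le (sq_nonneg _) (hδ0 n)).1 p),
          rpow_mul_self_of_one_le (norm_nonneg _) (by linarith)]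
        exact mul_le_mul (IsCut.abs_rad_le hC₂.le hk2 x) (hfle n _ (by linarith))
          (Real.rpow_nonneg (sq_div_le (sq_nonneg _) (hδ0 n)).1 p) hC₂.le
      · rw [IsCut.rad_eq_zero hm' hx, Set.indicator_of_notMem hx]
        simp
    · exact Eventually.of_forall fun x => tendsto_const_nhds.mul
        ((hlimfrac (f x)).rpow_const (Or.inr (by linarith)))
  · intro n
    refine hkm.mul (AEStronglyMeasurable.mul (AEMeasurable.aestronglyMeasurable
      ((((hfrac n).aemeasurable.pow_const (p - 1)).const_mul p).div
      (((hsq.aemeasurable.const_mul _).const_add 1).pow_const 2))) (hre.const_mul 2))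
  · refine fun n => Eventually.of_forall fun x => ?_
    by_cases hx : x ∈ annulus d m
    · have h1 : 1 ≤ (1 + δ n * ‖f x‖ ^ 2) ^ 2 :=
        one_le_pow₀ (by nlinarith [mul_nonneg (hδ0 n).le (sq_nonneg ‖f x‖)])
      have h0 := Real.rpow_nonneg (sq_div_le (sq_nonneg ‖f x‖) (hδ0 n)).1 (p - 1)
      have h2 : |p * (‖f x‖ ^ 2 / (1 + δ n * ‖f x‖ ^ 2)) ^ (p - 1) / (1 + δ n * ‖f x‖ ^ 2) ^ 2|
          ≤ p * ‖f x‖ ^ (2 * p - 2) := by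
        rw [abs_of_nonneg (by positivity), show 2 * p - 2 = 2 * (p - 1) by ring]
        exact (div_le_self (by positivity) h1).trans
          (mul_le_mul_of_nonneg_left (hfle n _ (by linarith)) (by linarith))
      have h3 := rpow_mul_self_of_one_le (norm_nonneg (f x)) (s := 2 * p - 1) (by linarith)
      rw [show 2 * p - 1 - 1 = 2 * p - 2 by ring] at h3
      rw [Set.indicator_of_mem hx, norm_mul, norm_mul, norm_mul, Real.norm_eq_abs,
        Real.norm_eq_abs, Real.norm_eq_abs, Real.norm_eq_abs, abs_two, ← h3]
      calc _ ≤ |rad k x| * (p * ‖f x‖ ^ (2 * p - 2) * (2 * (‖x‖ * (‖f x‖ * ‖g x‖)))) := by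
            gcongr
            exact abs_re_conj_mul_xdot_le _ x _
        _ = (|rad k x| * ‖x‖) * (2 * p * (‖f x‖ ^ (2 * p - 2) * ‖f x‖ * ‖g x‖)) := by ring
        _ ≤ C₁ * (2 * p * (‖f x‖ ^ (2 * p - 2) * ‖f x‖ * ‖g x‖)) := by
            gcongr
            exact hk1 x
        _ = _ := by ring
    · rw [IsCut.rad_eq_zero hm hx, Set.indicator_of_notMem hx]
      simp
  · exact Eventually.of_forall fun x => tendsto_const_nhds.mul (Tendsto.mul (Tendsto.div
      (((hlimfrac (f x)).rpow_const (Or.inr (by linarith))).const_mul p) (hden (f x)) one_ne_zero)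
      tendsto_const_nhds)

theorem integrable_norm_sq_of_memLp {E : Type*} [NormedAddCommGroup E] {f : Space d → E}
    {μ : Measure (Space d)} (hf : MemLp f 2 μ) : Integrable (fun x => ‖f x‖ ^ 2) μ :=
  hf.integrable_norm_pow (by simp)

theorem ofReal_integral_norm_sq {E : Type*} [NormedAddCommGroup E] {f : Space d → E}
    {μ : Measure (Space d)} (hf : MemLp f 2 μ) :
    ENNReal.ofReal (∫ x, ‖f x‖ ^ 2 ∂μ) = eLpNorm f 2 μ ^ 2 := by
  rw [ofReal_integral_eq_lintegral_ofReal (integrable_norm_sq_of_memLp hf)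
    (Eventually.of_forall fun x => by positivity), eLpNorm_two_sq]
  simp only [ENNReal.ofReal_pow (norm_nonneg _), ofReal_norm]

theorem integrable_rad_mul {k : ℝ → ℝ} (hk : IsCut k) {φ : Space d → ℝ}
    (hφ : Integrable φ volume) : Integrable (fun x => rad k x * φ x) volume := by
  obtain ⟨C, hC, h⟩ := hk.exists_bound
  exact hφ.bdd_mul hk.continuous_rad.aestronglyMeasurable
    (Eventually.of_forall fun x => (IsCut.abs_rad_le hC.le h x : ‖rad k x‖ ≤ C))

/-- Monotonicity is what matters: in Hardy's inequality the derivative of the inner cutoff then has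
a favourable sign, and no bound uniform in its position is required. -/
theorem exists_deriv_smoothTransition_bound :
    ∃ C : ℝ, 0 ≤ C ∧ ∀ t, 0 ≤ deriv Real.smoothTransition t ∧ deriv Real.smoothTransition t ≤ C ∧
      (1 < t → deriv Real.smoothTransition t = 0) := by
  have hc : Continuous (deriv Real.smoothTransition) :=
    (Real.smoothTransition.contDiff (n := 1)).continuous_deriv (by simp)
  have h1 : ∀ t, 1 < t → deriv Real.smoothTransition t = 0 := by
    intro t ht
    have : Real.smoothTransition =ᶠ[𝓝 t] fun _ => 1 := by
      filter_upwards [lt_mem_nhds ht] with s hs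
      exact Real.smoothTransition.one_of_one_le hs.le
    rw [this.deriv_eq]
    simp
  have h0 : ∀ t, t < 0 → deriv Real.smoothTransition t = 0 := by
    intro t ht
    have : Real.smoothTransition =ᶠ[𝓝 t] fun _ => 0 := by
      filter_upwards [gt_mem_nhds ht] with s hs
      exact Real.smoothTransition.zero_of_nonpos hs.le
    rw [this.deriv_eq]
    simp
  obtain ⟨C, hC⟩ := (isCompact_Icc (a := (0 : ℝ)) (b := 1)).exists_bound_of_continuousOn
    hc.continuousOn
  refine ⟨max C 0, le_max_right _ _, fun t => ⟨Real.smoothTransition.monotone.deriv_nonneg, ?_, h1 t⟩⟩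
  by_cases ht : t ∈ Set.Icc (0 : ℝ) 1
  · exact ((le_abs_self _).trans (hC t ht)).trans (le_max_left _ _)
  · rcases not_and_or.1 ht with h | h
    · rw [h0 t (not_le.1 h)]; exact le_max_right _ _
    · rw [h1 t (not_le.1 h)]; exact le_max_right _ _

/-- The weight `‖x‖⁻²`, in logarithmic coordinates. -/
theorem rad_mul_exp (k : ℝ → ℝ) (a : ℝ) (x : Space d) :
    rad (fun s => k s * Real.exp (a * s)) x = rad k x * ‖x‖ ^ a := by
  by_cases hx : x = 0
  · simp [hx, rad_zero]
  · rw [rad_of_ne _ hx, rad_of_ne _ hx, norm_sq_mul_exp hx]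

theorem integrable_rad_mul_re {k : ℝ → ℝ} (hk : IsCut k) {f : Space d → ℂ}
    {g : Space d → EuclideanSpace ℂ (Fin d)} (hf : MemLp f 2 volume) (hg : MemLp g 2 volume) :
    Integrable (fun x => rad k x * (star (f x) * xdot x (g x)).re) volume := by
  obtain ⟨C, hC, h⟩ := hk.abs_rad_mul_norm_le (d := d)
  have hm2 : AEStronglyMeasurable (fun x => (star (f x) * xdot x (g x)).re) volume :=
    aestronglyMeasurable_re_conj_mul_xdot hf.1 hg.1
  have hi : Integrable (fun x => C * (‖f x‖ ^ 2 + ‖g x‖ ^ 2)) volume :=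
    ((integrable_norm_sq_of_memLp hf).add (integrable_norm_sq_of_memLp hg)).const_mul C
  refine hi.mono' (hk.continuous_rad.aestronglyMeasurable.mul hm2)
    (Eventually.of_forall fun x => ?_)
  rw [norm_mul, Real.norm_eq_abs, Real.norm_eq_abs]
  have h1 := abs_re_conj_mul_xdot_le (f x) x (g x)
  have h4 : ‖f x‖ * ‖g x‖ ≤ ‖f x‖ ^ 2 + ‖g x‖ ^ 2 := by nlinarith [sq_nonneg (‖f x‖ - ‖g x‖)]
  calc _ ≤ |rad k x| * (‖x‖ * (‖f x‖ * ‖g x‖)) := mul_le_mul_of_nonneg_left h1 (abs_nonneg _)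
    _ = (|rad k x| * ‖x‖) * (‖f x‖ * ‖g x‖) := by ring
    _ ≤ C * (‖f x‖ ^ 2 + ‖g x‖ ^ 2) := mul_le_mul (h x) h4 (by positivity) hC

/-- Hardy's inequality, with unspecified constants. -/
theorem exists_hardy (hd : 3 ≤ d) :
    ∃ C : ℝ, 0 ≤ C ∧ ∀ (f : Space d → ℂ) (g : Space d → EuclideanSpace ℂ (Fin d)), IsPair f g →
      ∫⁻ x, ENNReal.ofReal (‖x‖ ^ (-2 : ℝ) * ‖f x‖ ^ 2)
        ≤ ENNReal.ofReal (C * (∫ x, ‖f x‖ ^ 2) + 4 * ∫ x, ‖g x‖ ^ 2) := by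
  obtain ⟨C, hC, hsT⟩ := exists_deriv_smoothTransition_bound
  refine ⟨2 * C + 1, by positivity, fun f g h => ?_⟩
  have hd' : (3 : ℝ) ≤ d := by exact_mod_cast hd
  have hf2 := integrable_norm_sq_of_memLp h.left
  have hg2 := integrable_norm_sq_of_memLp h.right
  -- The cutoff rises for `log ‖x‖` between `-n` and `-n + 1` and falls between `1` and `2`. Only
  -- the inner edge moves with `n`.
  set κ : ℕ → ℝ → ℝ := fun n s => Real.smoothTransition (s + n) * Real.smoothTransition (2 - s)
    with hκ
  have hκ01 : ∀ n s, 0 ≤ κ n s ∧ κ n s ≤ 1 := fun n s =>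
    ⟨mul_nonneg (Real.smoothTransition.nonneg _) (Real.smoothTransition.nonneg _),
      mul_le_one₀ (Real.smoothTransition.le_one _) (Real.smoothTransition.nonneg _)
        (Real.smoothTransition.le_one _)⟩
  have hκc : ∀ n, IsCut (κ n) := by
    intro n
    refine ⟨(Real.smoothTransition.contDiff.comp (contDiff_id.add contDiff_const)).mul
      (Real.smoothTransition.contDiff.comp (contDiff_const.sub contDiff_id)), ?_⟩
    refine HasCompactSupport.intro (isCompact_Icc (a := -(n : ℝ)) (b := 2)) fun s hs => ?_
    rcases not_and_or.1 hs with h | h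
    · simp only [hκ]
      rw [Real.smoothTransition.zero_of_nonpos (by linarith [not_le.1 h]), zero_mul]
    · simp only [hκ]
      rw [Real.smoothTransition.zero_of_nonpos (x := 2 - s) (by linarith [not_le.1 h]), mul_zero]
  have hder : ∀ n s, HasDerivAt (fun s => κ n s * Real.exp ((-2) * s))
      (((deriv Real.smoothTransition (s + n) * Real.smoothTransition (2 - s)
        - Real.smoothTransition (s + n) * deriv Real.smoothTransition (2 - s)) - 2 * κ n s)
        * Real.exp ((-2) * s)) s := by
    intro n s
    have hdiff : ∀ t, HasDerivAt Real.smoothTransition (deriv Real.smoothTransition t) t := fun t =>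
      (Real.smoothTransition.contDiff.differentiable (n := 1) (by simp) t).hasDerivAt
    have h1 : HasDerivAt (fun s => Real.smoothTransition (s + n))
        (deriv Real.smoothTransition (s + n)) s := (hdiff _).comp_add_const s (n : ℝ)
    have h2 : HasDerivAt (fun s => Real.smoothTransition (2 - s))
        (-deriv Real.smoothTransition (2 - s)) s := (hdiff _).comp_const_sub 2 s
    have h3 : HasDerivAt (fun s : ℝ => Real.exp ((-2) * s)) (Real.exp ((-2) * s) * (-2)) s := by
      simpa using ((hasDerivAt_id s).const_mul (-2 : ℝ)).exp
    refine ((h1.mul h2).mul h3).congr_deriv ?_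
    simp only [hκ, Pi.mul_apply]
    ring
  set K : ℕ → ℝ → ℝ := fun n s => κ n s * Real.exp ((-2) * s) with hK
  have hKc : ∀ n, IsCut (K n) := fun n => (hκc n).mul_exp (-2)
  -- Since `K = κ e^{-2s}`, the divergence profile is `(d-2)K + κ' e^{-2s}`, and `d ≥ 3` makes the
  -- first term at least `K`. The rising edge contributes nonnegatively; the falling edge lives
  -- where `s ≥ 1`, so its weight is at most `1` and it costs at most `C`.
  have hlow : ∀ n s, K n s - C ≤ d * K n s + deriv (K n) s := by
    intro n s
    rw [(hder n s).deriv]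
    simp only [hK]
    have he := Real.exp_pos ((-2) * s)
    have h1 := hκ01 n s
    have h2 : 0 ≤ deriv Real.smoothTransition (s + n) * Real.smoothTransition (2 - s) :=
      mul_nonneg (hsT _).1 (Real.smoothTransition.nonneg _)
    have h3 : Real.smoothTransition (s + n) * deriv Real.smoothTransition (2 - s)
        * Real.exp ((-2) * s) ≤ C := by
      by_cases hs : s < 1
      · rw [(hsT (2 - s)).2.2 (by linarith)]
        simpa
      · have h4 : Real.exp ((-2) * s) ≤ 1 := Real.exp_le_one_iff.2 (by linarith)
        have h5 : Real.smoothTransition (s + n) * deriv Real.smoothTransition (2 - s) ≤ C :=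
          (mul_le_of_le_one_left (hsT _).1 (Real.smoothTransition.le_one _)).trans (hsT _).2.1
        exact (mul_le_of_le_one_right (mul_nonneg (Real.smoothTransition.nonneg _) (hsT _).1)
          h4).trans h5
    have h6 := mul_nonneg h2 he.le
    have h7 : 0 ≤ (d - 3) * (κ n s * Real.exp ((-2) * s)) :=
      mul_nonneg (by linarith) (mul_nonneg h1.1 he.le)
    nlinarith
  have hbound : ∀ n, ∫ x, rad (K n) x * ‖f x‖ ^ 2
      ≤ 2 * C * (∫ x, ‖f x‖ ^ 2) + 4 * ∫ x, ‖g x‖ ^ 2 := by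
    intro n
    obtain ⟨m, -, hm⟩ := (hKc n).exists_zero
    have h1 := integral_rad_pow h le_rfl (hKc n) hm (by
      rw [show (2 : ℝ) * 1 - 1 = 1 by norm_num]
      simpa only [Real.rpow_one] using h.left.norm.restrict (annulus d m))
    have e0 : (2 : ℝ) * 1 - 2 = 0 := by norm_num
    have e1 : (2 : ℝ) * 1 = (2 : ℕ) := by norm_num
    rw [e0] at h1
    simp only [Real.rpow_zero, one_mul, mul_one, Real.rpow_ofNat] at h1
    have hi1 := integrable_rad_mul (hKc n) hf2
    have hi2 := integrable_rad_mul ((hKc n).div_profile d) hf2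
    have hle : ∫ x, (rad (K n) x * ‖f x‖ ^ 2 - C * ‖f x‖ ^ 2)
        ≤ ∫ x, rad (fun s => d * K n s + deriv (K n) s) x * ‖f x‖ ^ 2 := by
      refine integral_mono (hi1.sub (hf2.const_mul C)) hi2 fun x => ?_
      simp only
      rw [← sub_mul]
      refine mul_le_mul_of_nonneg_right ?_ (sq_nonneg _)
      by_cases hx : x = 0
      · simp [hx, rad_zero, hC]
      · rw [rad_of_ne _ hx, rad_of_ne _ hx]
        exact hlow n _
    rw [integral_sub hi1 (hf2.const_mul C), integral_const_mul] at hle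
    -- Young's inequality, split so that half of `∫ K|f|²` can be absorbed on the left; this is the
    -- source of the factors `2C` and `4` in `hbound`.
    have hup : -(2 * ∫ x, rad (K n) x * (star (f x) * xdot x (g x)).re)
        ≤ 1 / 2 * (∫ x, rad (K n) x * ‖f x‖ ^ 2) + 2 * ∫ x, ‖g x‖ ^ 2 := by
      rw [← integral_const_mul, ← integral_const_mul, ← integral_const_mul, ← integral_neg,
        ← integral_add (hi1.const_mul _) (hg2.const_mul _)]
      refine integral_mono ((integrable_rad_mul_re (hKc n) h.left h.right).const_mul 2).neg
        ((hi1.const_mul _).add (hg2.const_mul _)) fun x => ?_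
      by_cases hx : x = 0
      · simp only [hx, rad_zero]
        nlinarith [sq_nonneg ‖g 0‖]
      have hx0 : 0 < ‖x‖ := norm_pos_iff.2 hx
      have hre := abs_le.1 (abs_re_conj_mul_xdot_le (f x) x (g x))
      have hr : rad (K n) x = κ n (Real.log ‖x‖) * ‖x‖⁻¹ ^ 2 := by
        rw [hK, rad_mul_exp, rad_of_ne _ hx, Real.rpow_neg hx0.le, Real.rpow_two, inv_pow]
      have h01 := hκ01 n (Real.log ‖x‖)
      rw [hr]
      set y := ‖x‖⁻¹ with hy
      have hyx : y * ‖x‖ = 1 := inv_mul_cancel₀ hx0.ne'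
      have h8 : -(κ n (Real.log ‖x‖) * y ^ 2 * (star (f x) * xdot x (g x)).re)
          ≤ κ n (Real.log ‖x‖) * (y * ‖f x‖ * ‖g x‖) := by
        calc _ = κ n (Real.log ‖x‖) * y ^ 2 * (-(star (f x) * xdot x (g x)).re) := by ring
          _ ≤ κ n (Real.log ‖x‖) * y ^ 2 * (‖x‖ * (‖f x‖ * ‖g x‖)) :=
            mul_le_mul_of_nonneg_left (by linarith [hre.1]) (mul_nonneg h01.1 (sq_nonneg _))
          _ = κ n (Real.log ‖x‖) * ((y * ‖x‖) * y * ‖f x‖ * ‖g x‖) := by ring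
          _ = _ := by rw [hyx]; ring
      have h9 := mul_nonneg h01.1 (sq_nonneg (y * ‖f x‖ - 2 * ‖g x‖))
      have h10 := mul_le_mul_of_nonneg_right h01.2 (sq_nonneg ‖g x‖)
      nlinarith
    have h2 : ∫ x, rad (fun s => d * K n s + deriv (K n) s) x * ‖f x‖ ^ 2
        = -(2 * ∫ x, rad (K n) x * (star (f x) * xdot x (g x)).re) := by
      rw [h1]; ring
    linarith
  have hK0 : ∀ n x, 0 ≤ rad (K n) (x : Space d) := by
    intro n x
    by_cases hx : x = 0
    · simp [hx, rad_zero]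
    · rw [rad_of_ne _ hx]
      exact mul_nonneg (hκ01 n _).1 (Real.exp_pos _).le
  -- Where the outer cutoff is not `1` one has `‖x‖⁻² ≤ 1`, so the added `‖f‖²` suffices there; it
  -- accounts for the `+ 1` in the constant. At the origin the left side is `0` by the convention
  -- for powers of zero.
  have hptw : ∀ x, ENNReal.ofReal (‖x‖ ^ (-2 : ℝ) * ‖f x‖ ^ 2)
      ≤ liminf (fun n => ENNReal.ofReal (rad (K n) x * ‖f x‖ ^ 2 + ‖f x‖ ^ 2)) atTop := by
    intro x
    refine le_liminf_of_le (by isBoundedDefault) ?_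
    by_cases hx : x = 0
    · refine Eventually.of_forall fun n => ENNReal.ofReal_le_ofReal ?_
      rw [hx, norm_zero, Real.zero_rpow (by norm_num)]
      rw [zero_mul]
      exact add_nonneg (mul_nonneg (hK0 n 0) (sq_nonneg _)) (sq_nonneg _)
    filter_upwards [eventually_ge_atTop ⌈1 - Real.log ‖x‖⌉₊] with n hn
    refine ENNReal.ofReal_le_ofReal ?_
    have hn' : 1 - Real.log ‖x‖ ≤ n := Nat.ceil_le.1 hn
    by_cases h1 : Real.log ‖x‖ ≤ 1
    · rw [hK, rad_mul_exp, rad_of_ne _ hx]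
      simp only [hκ]
      rw [Real.smoothTransition.one_of_one_le (by linarith),
        Real.smoothTransition.one_of_one_le (by linarith), one_mul, one_mul]
      linarith [sq_nonneg ‖f x‖]
    · have h2 : ‖x‖ ^ (-2 : ℝ) ≤ 1 := by
        rw [← norm_sq_mul_exp hx]
        exact Real.exp_le_one_iff.2 (by linarith)
      have := mul_le_mul_of_nonneg_right h2 (sq_nonneg ‖f x‖)
      have := mul_nonneg (hK0 n x) (sq_nonneg ‖f x‖)
      linarith
  refine (lintegral_mono hptw).trans ((lintegral_liminf_le' fun n => ?_).trans ?_)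
  · exact ((((hKc n).continuous_rad.aestronglyMeasurable.mul hf2.1).add
      hf2.1).aemeasurable).ennreal_ofReal
  · refine liminf_le_of_frequently_le' (Frequently.of_forall fun n => ?_)
    have hi : Integrable (fun x => rad (K n) x * ‖f x‖ ^ 2 + ‖f x‖ ^ 2) volume :=
      (integrable_rad_mul (hKc n) hf2).add hf2
    rw [← ofReal_integral_eq_lintegral_ofReal hi
      (Eventually.of_forall fun x => add_nonneg (mul_nonneg (hK0 n x) (sq_nonneg _)) (sq_nonneg _))]
    refine ENNReal.ofReal_le_ofReal ?_
    rw [integral_add (integrable_rad_mul (hKc n) hf2) hf2]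
    have := hbound n
    linarith

/-- The critical Sobolev exponent `2d/(d-2)`. -/
def sobolevExp (d : ℕ) : ℝ := 2 * d / ((d : ℝ) - 2)

/-- The weight `1 + ‖x‖⁻²` in the energy density. -/
def hardyWeight (x : Space d) : ℝ := 1 + ‖x‖ ^ (-2 : ℝ)

theorem one_le_hardyWeight (x : Space d) : 1 ≤ hardyWeight x := by
  unfold hardyWeight
  have : 0 ≤ ‖x‖ ^ (-2 : ℝ) := by positivity
  linarith

theorem measurable_hardyWeight : Measurable (hardyWeight : Space d → ℝ) :=
  (measurable_norm.pow_const _).const_add 1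

theorem sobolevExp_pos (hd : 3 ≤ d) : 0 < sobolevExp d := by
  have hd' : (3 : ℝ) ≤ d := by exact_mod_cast hd
  unfold sobolevExp
  apply div_pos <;> linarith

/-- Hardy controls the singular weight and Sobolev the highest power. Since only the `L²` norms of
the pair appear on the right, the bound applies to differences `u(s) - u(t)` and gives continuity in
time. -/
theorem exists_lintegral_dens_le (hd : 3 ≤ d) :
    ∃ C : NNReal, ∀ (f : Space d → ℂ) (g : Space d → EuclideanSpace ℂ (Fin d)), IsPair f g →
      ∫⁻ x, ENNReal.ofReal (dens hardyWeight (sobolevExp d) x (f x) (g x))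
        ≤ C * ((eLpNorm g 2 volume + eLpNorm f 2 volume) ^ 2
          + (eLpNorm g 2 volume + eLpNorm f 2 volume) ^ sobolevExp d) := by
  obtain ⟨C₁, hC₁, hH⟩ := exists_hardy hd
  obtain ⟨C₂, hS⟩ := exists_eLpNorm_sobolev_le hd
  have hq := sobolevExp_pos hd
  refine ⟨(C₁.toNNReal + 6) + C₂ ^ sobolevExp d, fun f g h => ?_⟩
  set A := eLpNorm f 2 volume
  set B := eLpNorm g 2 volume
  have hmf : AEMeasurable (fun x => ENNReal.ofReal (‖f x‖ ^ 2)) volume :=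
    (h.left.1.norm.aemeasurable.pow_const 2).ennreal_ofReal
  have hmg : AEMeasurable (fun x => ENNReal.ofReal (‖g x‖ ^ 2)) volume :=
    (h.right.1.norm.aemeasurable.pow_const 2).ennreal_ofReal
  have hmh : AEMeasurable (fun x => ENNReal.ofReal (‖x‖ ^ (-2 : ℝ) * ‖f x‖ ^ 2)) volume :=
    ((measurable_norm.pow_const (-2 : ℝ)).aemeasurable.mul
      (h.left.1.norm.aemeasurable.pow_const 2)).ennreal_ofReal
  have h1 : ∀ x, ENNReal.ofReal (dens hardyWeight (sobolevExp d) x (f x) (g x))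
      = ENNReal.ofReal (‖f x‖ ^ 2) + (ENNReal.ofReal (‖x‖ ^ (-2 : ℝ) * ‖f x‖ ^ 2)
        + (ENNReal.ofReal (‖g x‖ ^ 2) + ‖f x‖ₑ ^ sobolevExp d)) := by
    intro x
    rw [← ofReal_norm, ENNReal.ofReal_rpow_of_nonneg (norm_nonneg _) hq.le,
      ← ENNReal.ofReal_add (by positivity) (by positivity),
      ← ENNReal.ofReal_add (by positivity) (by positivity),
      ← ENNReal.ofReal_add (by positivity) (by positivity)]
    congr 1
    unfold dens hardyWeight
    ring
  simp only [h1]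
  rw [lintegral_add_left' hmf, lintegral_add_left' hmh, lintegral_add_left' hmg]
  have hfA : ∫⁻ x, ENNReal.ofReal (‖f x‖ ^ 2) = A ^ 2 := by
    rw [← ofReal_integral_norm_sq h.left,
      ofReal_integral_eq_lintegral_ofReal (integrable_norm_sq_of_memLp h.left)
      (Eventually.of_forall fun x => by positivity)]
  have hgB : ∫⁻ x, ENNReal.ofReal (‖g x‖ ^ 2) = B ^ 2 := by
    rw [← ofReal_integral_norm_sq h.right,
      ofReal_integral_eq_lintegral_ofReal (integrable_norm_sq_of_memLp h.right)
      (Eventually.of_forall fun x => by positivity)]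
  have hHle : ∫⁻ x, ENNReal.ofReal (‖x‖ ^ (-2 : ℝ) * ‖f x‖ ^ 2)
      ≤ C₁.toNNReal * A ^ 2 + 4 * B ^ 2 := by
    refine (hH f g h).trans (le_of_eq ?_)
    rw [ENNReal.ofReal_add (mul_nonneg hC₁ (integral_nonneg fun x => by positivity))
      (mul_nonneg (by norm_num) (integral_nonneg fun x => by positivity)),
      ENNReal.ofReal_mul hC₁, ENNReal.ofReal_mul (by norm_num), ofReal_integral_norm_sq h.left,
      ofReal_integral_norm_sq h.right]
    simp [ENNReal.ofReal, A, B]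
  have hSle : ∫⁻ x, ‖f x‖ₑ ^ sobolevExp d ≤ C₂ ^ sobolevExp d * (B + A) ^ sobolevExp d := by
    have h2 := ENNReal.rpow_le_rpow (hS f g h) hq.le
    rw [ENNReal.mul_rpow_of_nonneg _ _ hq.le] at h2
    refine le_trans (le_of_eq ?_) h2
    have hq' : 0 < 2 * (d : ℝ) / ((d : ℝ) - 2) := hq
    rw [eLpNorm_eq_lintegral_rpow_enorm_toReal (by simpa using hq') ENNReal.ofReal_ne_top,
      ENNReal.toReal_ofReal hq'.le, ← ENNReal.rpow_mul, one_div, sobolevExp,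
      inv_mul_cancel₀ hq'.ne', ENNReal.rpow_one]
  have hA2 : A ^ 2 ≤ (B + A) ^ 2 := pow_le_pow_left' le_add_self 2
  have hB2 : B ^ 2 ≤ (B + A) ^ 2 := pow_le_pow_left' le_self_add 2
  rw [hfA, hgB]
  calc A ^ 2 + ((∫⁻ x, ENNReal.ofReal (‖x‖ ^ (-2 : ℝ) * ‖f x‖ ^ 2))
        + (B ^ 2 + ∫⁻ x, ‖f x‖ₑ ^ sobolevExp d))
      ≤ (B + A) ^ 2 + ((C₁.toNNReal * (B + A) ^ 2 + 4 * (B + A) ^ 2)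
        + ((B + A) ^ 2 + C₂ ^ sobolevExp d * (B + A) ^ sobolevExp d)) := by
        gcongr
        refine hHle.trans ?_
        gcongr
    _ = (C₁.toNNReal + 6) * (B + A) ^ 2 + C₂ ^ sobolevExp d * (B + A) ^ sobolevExp d := by ring
    _ ≤ _ := by
        rw [mul_add]
        push_cast
        rw [ENNReal.coe_rpow_of_nonneg _ hq.le]
        refine add_le_add (mul_le_mul_left le_self_add _) (mul_le_mul_left le_add_self _)

end INLS
end

/-! ### Parameter range, control of the potential energy, and the equation tested with complex
functions. -/

noncomputable section
namespace INLS

variable {d : ℕ}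

/-- The range of parameters under consideration. -/
structure IsAdmissible (d : ℕ) (b σ : ℝ) : Prop where
  three_le : 3 ≤ d
  b_pos : 0 < b
  b_lt : b < 2
  σ_pos : 0 < σ
  σ_le : σ ≤ (4 - 2 * b) / ((d : ℝ) - 2)

namespace IsAdmissible

variable {b σ : ℝ}

theorem three_le_cast (h : IsAdmissible d b σ) : (3 : ℝ) ≤ d := by exact_mod_cast h.three_le

/-- Makes the nonlinearity locally integrable away from the origin, by the Sobolev exponent alone.
-/
theorem add_one_le (h : IsAdmissible d b σ) : σ + 1 ≤ sobolevExp d := by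
  have hd := h.three_le_cast
  have hd2 : 0 < (d : ℝ) - 2 := by linarith
  have h1 := h.σ_le
  have h2 : (4 - 2 * b) / ((d : ℝ) - 2) + 1 ≤ sobolevExp d := by
    rw [sobolevExp, div_add_one hd2.ne']
    exact div_le_div_of_nonneg_right (by linarith [h.b_pos]) hd2.le
  linarith

theorem rpow_norm_le (h : IsAdmissible d b σ) (x : Space d) : ‖x‖ ^ (-b) ≤ hardyWeight x := by
  unfold hardyWeight
  rcases (norm_nonneg x).eq_or_lt with h0 | h0
  · rw [← h0, Real.zero_rpow (by linarith [h.b_pos]), Real.zero_rpow (by norm_num)]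
    norm_num
  rcases le_total 1 ‖x‖ with h1 | h1
  · have := Real.rpow_le_one_of_one_le_of_nonpos h1 (z := -b) (by linarith [h.b_pos])
    have h2 : 0 ≤ ‖x‖ ^ (-2 : ℝ) := by positivity
    linarith
  · have := Real.rpow_le_rpow_of_exponent_ge h0 h1 (show (-2 : ℝ) ≤ -b by linarith [h.b_lt])
    linarith

/-- The potential energy density is controlled by the energy density. -/
theorem potential_le (h : IsAdmissible d b σ) (x : Space d) (z : ℂ)
    (w : EuclideanSpace ℂ (Fin d)) :
    ‖x‖ ^ (-b) * ‖z‖ ^ (σ + 2) ≤ dens hardyWeight (sobolevExp d) x z w := by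
  have hd := h.three_le_cast
  have hd2 : 0 < (d : ℝ) - 2 := by linarith
  have hσ := h.σ_le
  have hσ0 := h.σ_pos
  have hb := h.b_pos
  have hb2 := h.b_lt
  have hzq : 0 ≤ ‖z‖ ^ sobolevExp d := by positivity
  have hw : 0 ≤ hardyWeight x * ‖z‖ ^ 2 :=
    mul_nonneg (zero_le_one.trans (one_le_hardyWeight x)) (sq_nonneg _)
  unfold dens
  -- For small `‖z‖` the power `σ + 2` is at most the square; for large `‖z‖` the exponent may be
  -- raised to its critical value, where the interpolation is exact.
  rcases le_total ‖z‖ 1 with h1 | h1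
  · have h2 : ‖z‖ ^ (σ + 2) ≤ ‖z‖ ^ 2 := by
      have := Real.rpow_le_rpow_of_exponent_ge' (norm_nonneg z) h1 (z := 2) (y := σ + 2)
        (by norm_num) (by linarith)
      rwa [Real.rpow_two] at this
    have h3 : ‖x‖ ^ (-b) * ‖z‖ ^ (σ + 2) ≤ hardyWeight x * ‖z‖ ^ 2 :=
      mul_le_mul (h.rpow_norm_le x) h2 (by positivity) (zero_le_one.trans (one_le_hardyWeight x))
    nlinarith [sq_nonneg ‖w‖]
  · set σc := (4 - 2 * b) / ((d : ℝ) - 2) with hσc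
    have h2 : ‖z‖ ^ (σ + 2) ≤ ‖z‖ ^ (σc + 2) := Real.rpow_le_rpow_of_exponent_le h1 (by linarith)
    have hz0 : 0 < ‖z‖ := by linarith
    -- At the critical exponent the potential is a geometric mean of the Hardy and Sobolev densities
    -- with weights `b/2` and `1 - b/2`; weighted Young finishes.
    have h3 : ‖x‖ ^ (-b) * ‖z‖ ^ (σc + 2)
        = (‖x‖ ^ (-2 : ℝ) * ‖z‖ ^ 2) ^ (b / 2) * (‖z‖ ^ sobolevExp d) ^ (1 - b / 2) := by
      rw [Real.mul_rpow (by positivity) (by positivity), ← Real.rpow_mul (norm_nonneg x), sq_rpow_eq,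
        ← Real.rpow_mul (norm_nonneg z), mul_assoc, ← Real.rpow_add hz0]
      congr 2
      · ring
      · rw [hσc, sobolevExp]
        field_simp
        ring
    have h4 := Real.geom_mean_le_arith_mean2_weighted (w₁ := b / 2) (w₂ := 1 - b / 2)
      (p₁ := ‖x‖ ^ (-2 : ℝ) * ‖z‖ ^ 2) (p₂ := ‖z‖ ^ sobolevExp d) (by linarith) (by linarith)
      (by positivity) hzq (by ring)
    have h5 : ‖x‖ ^ (-2 : ℝ) * ‖z‖ ^ 2 ≤ hardyWeight x * ‖z‖ ^ 2 := by
      unfold hardyWeight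
      nlinarith [sq_nonneg ‖z‖]
    have h6 : 0 ≤ ‖x‖ ^ (-2 : ℝ) * ‖z‖ ^ 2 := by positivity
    calc ‖x‖ ^ (-b) * ‖z‖ ^ (σ + 2) ≤ ‖x‖ ^ (-b) * ‖z‖ ^ (σc + 2) := by gcongr
      _ ≤ b / 2 * (‖x‖ ^ (-2 : ℝ) * ‖z‖ ^ 2) + (1 - b / 2) * ‖z‖ ^ sobolevExp d := by rw [h3]; exact h4
      _ ≤ _ := by nlinarith [sq_nonneg ‖w‖]

end IsAdmissible

/-- The energy `∫ (1 + ‖x‖⁻²) |f|² + |g|² + |f|^{2d/(d-2)}`. -/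
def energy (f : Space d → ℂ) (g : Space d → EuclideanSpace ℂ (Fin d)) : ℝ :=
  ∫ x, dens hardyWeight (sobolevExp d) x (f x) (g x)

theorem IsPair.lintegral_dens_ne_top (hd : 3 ≤ d) {f : Space d → ℂ}
    {g : Space d → EuclideanSpace ℂ (Fin d)} (h : IsPair f g) :
    ∫⁻ x, ENNReal.ofReal (dens hardyWeight (sobolevExp d) x (f x) (g x)) ≠ ⊤ := by
  obtain ⟨C, hC⟩ := exists_lintegral_dens_le hd
  refine ((hC f g h).trans_lt ?_).ne
  have h1 : eLpNorm g 2 volume + eLpNorm f 2 volume < ⊤ := ENNReal.add_lt_top.2 ⟨h.right.2, h.left.2⟩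
  exact ENNReal.mul_lt_top ENNReal.coe_lt_top (ENNReal.add_lt_top.2 ⟨ENNReal.pow_lt_top h1,
    ENNReal.rpow_lt_top_of_nonneg (sobolevExp_pos hd).le h1.ne⟩)

theorem IsPair.integrable_dens (hd : 3 ≤ d) {f : Space d → ℂ}
    {g : Space d → EuclideanSpace ℂ (Fin d)} (h : IsPair f g) :
    Integrable (fun x => dens hardyWeight (sobolevExp d) x (f x) (g x)) volume := by
  refine ⟨aestronglyMeasurable_comp_pair (measurable_dens measurable_hardyWeight _)
    h.left.1 h.right.1, ?_⟩
  rw [hasFiniteIntegral_iff_ofReal (Eventually.of_forall fun x =>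
    dens_nonneg one_le_hardyWeight _ x _ _)]
  exact (h.lintegral_dens_ne_top hd).lt_top

theorem le_dens (q : ℝ) (x : Space d) (z : ℂ) (w : EuclideanSpace ℂ (Fin d)) :
    ‖z‖ ^ 2 ≤ dens hardyWeight q x z w ∧ ‖w‖ ^ 2 ≤ dens hardyWeight q x z w ∧
      ‖x‖ ^ (-2 : ℝ) * ‖z‖ ^ 2 ≤ dens hardyWeight q x z w ∧ ‖z‖ ^ q ≤ dens hardyWeight q x z w := by
  have h1 : 0 ≤ ‖x‖ ^ (-2 : ℝ) * ‖z‖ ^ 2 := by positivity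
  have h2 : 0 ≤ ‖z‖ ^ q := by positivity
  unfold dens hardyWeight
  refine ⟨?_, ?_, ?_, ?_⟩ <;> nlinarith [sq_nonneg ‖z‖, sq_nonneg ‖w‖]

/-- Smooth complex test functions supported in the annulus of parameter `m`. -/
structure TestOn (m : ℝ) (Φ : Space d → ℂ) : Prop where
  contDiff : ContDiff ℝ ∞ Φ
  zero : ∀ x, x ∉ annulus d m → Φ x = 0

namespace TestOn

variable {m : ℝ} {Φ : Space d → ℂ}

theorem hasCompactSupport (h : TestOn m Φ) : HasCompactSupport Φ :=
  HasCompactSupport.intro (isCompact_annulus m) h.zero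

theorem fderiv_zero (h : TestOn m Φ) {x : Space d} (hx : x ∉ annulus d m) : fderiv ℝ Φ x = 0 := by
  have : Φ =ᶠ[𝓝 x] fun _ => 0 := by
    filter_upwards [(isCompact_annulus m).isClosed.isOpen_compl.mem_nhds hx] with y hy
    exact h.zero y hy
  rw [this.fderiv_eq]
  simp

theorem isTest_re (h : TestOn m Φ) : IsTest fun x => (Φ x).re :=
  ⟨Complex.reCLM.contDiff.comp h.contDiff, h.hasCompactSupport.comp_left (g := Complex.re) rfl⟩

theorem isTest_im (h : TestOn m Φ) : IsTest fun x => (Φ x).im :=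
  ⟨Complex.imCLM.contDiff.comp h.contDiff, h.hasCompactSupport.comp_left (g := Complex.im) rfl⟩

theorem fderiv_apply (h : TestOn m Φ) (x : Space d) (j : Fin d) :
    fderiv ℝ Φ x (EuclideanSpace.single j 1)
      = (pderiv j (fun x => (Φ x).re) x : ℂ) + Complex.I * pderiv j (fun x => (Φ x).im) x := by
  have hd := (h.contDiff.differentiable (by simp) x).hasFDerivAt
  have h1 : fderiv ℝ (fun x => (Φ x).re) x = _ := (Complex.reCLM.hasFDerivAt.comp x hd).fderiv
  have h2 : fderiv ℝ (fun x => (Φ x).im) x = _ := (Complex.imCLM.hasFDerivAt.comp x hd).fderiv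
  rw [pderiv, pderiv, h1, h2]
  simp only [ContinuousLinearMap.comp_apply, Complex.reCLM_apply, Complex.imCLM_apply]
  rw [mul_comm Complex.I]
  exact (Complex.re_add_im _).symm

theorem continuous_fderiv (h : TestOn m Φ) : Continuous (fderiv ℝ Φ) :=
  h.contDiff.continuous_fderiv (by simp)

end TestOn

/-- The integrand of the pairing of `Δf - c ‖x‖⁻² f + ‖x‖⁻ᵇ |f|^σ f` with a complex test function. -/
def pairingDensity (c b σ : ℝ) (Φ : Space d → ℂ) (x : Space d) (z : ℂ)
    (w : EuclideanSpace ℂ (Fin d)) : ℂ :=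
  -(∑ j : Fin d, fderiv ℝ Φ x (EuclideanSpace.single j 1) * w j)
    - c * (Φ x * (‖x‖ ^ (-2 : ℝ) • z)) + Φ x * ((‖x‖ ^ (-b) * ‖z‖ ^ σ) • z)

/-- The pairing of `Δf - c ‖x‖⁻² f + ‖x‖⁻ᵇ |f|^σ f` with a complex test function. -/
def pairing (c b σ : ℝ) (f : Space d → ℂ) (g : Space d → EuclideanSpace ℂ (Fin d))
    (Φ : Space d → ℂ) : ℂ :=
  ∫ x, pairingDensity c b σ Φ x (f x) (g x)

theorem norm_nonlinVal (b σ : ℝ) (hσ : 0 < σ) (x : Space d) (z : ℂ) :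
    ‖(‖x‖ ^ (-b) * ‖z‖ ^ σ) • z‖ = ‖x‖ ^ (-b) * ‖z‖ ^ (σ + 1) := by
  rw [norm_smul, Real.norm_eq_abs, abs_of_nonneg (by positivity), mul_assoc]
  have := rpow_mul_self_of_one_le (norm_nonneg z) (s := σ + 1) (by linarith)
  rw [add_sub_cancel_right] at this
  rw [this]

theorem rpow_le_one_add_rpow {t r q : ℝ} (ht : 0 ≤ t) (hr : 0 ≤ r) (hrq : r ≤ q) :
    t ^ r ≤ 1 + t ^ q := by
  rcases le_total t 1 with h | h
  · have := Real.rpow_le_one ht h hr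
    have := Real.rpow_nonneg ht q
    linarith
  · have := Real.rpow_le_rpow_of_exponent_le h hrq
    linarith

/-- Pointwise bounds on an annulus. -/
theorem exists_annulus_bound {b σ : ℝ} (h : IsAdmissible d b σ) (m : ℝ) :
    ∃ C : ℝ, 0 ≤ C ∧ ∀ x ∈ annulus d m, ∀ (z : ℂ) (w : EuclideanSpace ℂ (Fin d)),
      ‖w‖ ≤ C * (1 + dens hardyWeight (sobolevExp d) x z w) ∧
      ‖‖x‖ ^ (-2 : ℝ) • z‖ ≤ C * (1 + dens hardyWeight (sobolevExp d) x z w) ∧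
      ‖z‖ ≤ C * (1 + dens hardyWeight (sobolevExp d) x z w) ∧
      ‖(‖x‖ ^ (-b) * ‖z‖ ^ σ) • z‖ ≤ C * (1 + dens hardyWeight (sobolevExp d) x z w) := by
  -- On the annulus `|log ‖x‖| ≤ |m|`, so `E` bounds every weight `‖x‖^(-a)` with `0 ≤ a ≤ 2`, in
  -- particular `a = 2` and `a = b`.
  set E := Real.exp (2 * |m|) with hE
  have hE1 : 1 ≤ E := Real.one_le_exp (by positivity)
  have hw : ∀ x ∈ annulus d m, ∀ a : ℝ, 0 ≤ a → a ≤ 2 → ‖x‖ ^ (-a) ≤ E := by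
    intro x hx a ha ha2
    have hx0 := ne_zero_of_mem_annulus hx
    have hl := (mem_annulus_iff hx0).1 hx
    rw [← norm_sq_mul_exp hx0, hE]
    apply Real.exp_le_exp.2
    have h1 := abs_le.1 hl
    have h2 := le_abs_self m
    have h3 : -(a * Real.log ‖x‖) ≤ a * |m| := by nlinarith
    nlinarith [abs_nonneg m]
  refine ⟨E, by positivity, fun x hx z w => ?_⟩
  obtain ⟨h1, h2, -, h4⟩ := le_dens (sobolevExp d) x z w
  set D := dens hardyWeight (sobolevExp d) x z w
  have hD : 0 ≤ D := (sq_nonneg _).trans h1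
  have hz : ‖z‖ ≤ 1 + D := by nlinarith [sq_nonneg (‖z‖ - 1)]
  have hww : ‖w‖ ≤ 1 + D := by nlinarith [sq_nonneg (‖w‖ - 1)]
  refine ⟨?_, ?_, ?_, ?_⟩
  · nlinarith
  · rw [norm_smul, Real.norm_eq_abs, abs_of_nonneg (by positivity)]
    exact mul_le_mul (hw x hx 2 (by norm_num) le_rfl) hz (norm_nonneg _) (by positivity)
  · nlinarith
  · rw [norm_nonlinVal b σ h.σ_pos]
    refine mul_le_mul (hw x hx b h.b_pos.le h.b_lt.le) ?_ (by positivity) (by positivity)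
    have := rpow_le_one_add_rpow (norm_nonneg z) (by linarith [h.σ_pos]) h.add_one_le
    linarith

theorem integrableOn_annulus_of_le (hd : 3 ≤ d) {E : Type*} [NormedAddCommGroup E] {f : Space d → ℂ}
    {g : Space d → EuclideanSpace ℂ (Fin d)} (h : IsPair f g) {m C : ℝ} {φ : Space d → E}
    (hφ : AEStronglyMeasurable φ volume)
    (hb : ∀ x ∈ annulus d m, ‖φ x‖ ≤ C * (1 + dens hardyWeight (sobolevExp d) x (f x) (g x))) :
    IntegrableOn φ (annulus d m) volume := by
  have h1 : IntegrableOn (fun x => C * (1 + dens hardyWeight (sobolevExp d) x (f x) (g x)))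
      (annulus d m) volume :=
    ((integrableOn_const (isCompact_annulus m).measure_lt_top.ne).add
      (h.integrable_dens hd).integrableOn).const_mul C
  exact h1.mono' hφ.restrict ((ae_restrict_mem (measurableSet_annulus m)).mono hb)

theorem integrable_mul_of_annulus {m : ℝ} {Ψ φ : Space d → ℂ} (hΨ : Continuous Ψ)
    (h0 : ∀ x, x ∉ annulus d m → Ψ x = 0) (hφ : IntegrableOn φ (annulus d m) volume) :
    Integrable (fun x => Ψ x * φ x) volume := by
  obtain ⟨C, hC⟩ := (HasCompactSupport.intro (isCompact_annulus m) h0).exists_bound_of_continuous hΨ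
  have h1 : IntegrableOn (fun x => Ψ x * φ x) (annulus d m) volume :=
    hφ.bdd_mul hΨ.aestronglyMeasurable (Eventually.of_forall hC)
  rw [← integrableOn_univ]
  refine h1.of_forall_sdiff_eq_zero MeasurableSet.univ fun x hx => ?_
  rw [h0 x hx.2, zero_mul]

section pairing

variable {c b σ : ℝ} {f : Space d → ℂ} {g : Space d → EuclideanSpace ℂ (Fin d)} {m : ℝ}

theorem aestronglyMeasurable_nonlinVal (hf : AEStronglyMeasurable f volume) :
    AEStronglyMeasurable (fun x => (‖x‖ ^ (-b) * ‖f x‖ ^ σ) • f x) volume :=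
  ((measurable_norm.pow_const (-b)).aemeasurable.mul
    (hf.norm.aemeasurable.pow_const σ)).aestronglyMeasurable.smul hf

theorem aestronglyMeasurable_hardyVal (hf : AEStronglyMeasurable f volume) :
    AEStronglyMeasurable (fun x => ‖x‖ ^ (-2 : ℝ) • f x) volume :=
  (measurable_norm.pow_const (-2 : ℝ)).aestronglyMeasurable.smul hf

theorem IsPair.integrableOn_annulus (hA : IsAdmissible d b σ) (h : IsPair f g) (m : ℝ) :
    (∀ j, IntegrableOn (fun x => g x j) (annulus d m) volume) ∧
    IntegrableOn (fun x => ‖x‖ ^ (-2 : ℝ) • f x) (annulus d m) volume ∧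
    IntegrableOn f (annulus d m) volume ∧
    IntegrableOn (fun x => (‖x‖ ^ (-b) * ‖f x‖ ^ σ) • f x) (annulus d m) volume := by
  obtain ⟨C, -, hb⟩ := exists_annulus_bound hA m
  refine ⟨fun j => ?_, ?_, ?_, ?_⟩
  · exact integrableOn_annulus_of_le hA.three_le h (memLp_eval h.right j).1 fun x hx =>
      (PiLp.norm_apply_le (g x) j).trans (hb x hx (f x) (g x)).1
  · exact integrableOn_annulus_of_le hA.three_le h (aestronglyMeasurable_hardyVal h.left.1)
      fun x hx => (hb x hx (f x) (g x)).2.1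
  · exact integrableOn_annulus_of_le hA.three_le h h.left.1 fun x hx => (hb x hx (f x) (g x)).2.2.1
  · exact integrableOn_annulus_of_le hA.three_le h (aestronglyMeasurable_nonlinVal h.left.1)
      fun x hx => (hb x hx (f x) (g x)).2.2.2

theorem pairing_eq (hA : IsAdmissible d b σ) (h : IsPair f g) {Φ : Space d → ℂ} (hΦ : TestOn m Φ) :
    pairing c b σ f g Φ = -(∑ j : Fin d, ∫ x, fderiv ℝ Φ x (EuclideanSpace.single j 1) * g x j)
      - c * (∫ x, Φ x * (‖x‖ ^ (-2 : ℝ) • f x))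
      + ∫ x, Φ x * ((‖x‖ ^ (-b) * ‖f x‖ ^ σ) • f x) := by
  obtain ⟨h1, h2, -, h3⟩ := h.integrableOn_annulus hA m
  have i1 : ∀ j, Integrable (fun x => fderiv ℝ Φ x (EuclideanSpace.single j 1) * g x j) volume :=
    fun j => integrable_mul_of_annulus (hΦ.continuous_fderiv.clm_apply continuous_const)
      (fun x hx => by rw [hΦ.fderiv_zero hx]; rfl) (h1 j)
  have i2 := integrable_mul_of_annulus hΦ.contDiff.continuous hΦ.zero h2
  have i3 := integrable_mul_of_annulus hΦ.contDiff.continuous hΦ.zero h3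
  unfold pairing pairingDensity
  have i4 : Integrable (fun x => -(∑ j : Fin d, fderiv ℝ Φ x (EuclideanSpace.single j 1) * g x j))
    volume := (integrable_finsetSum _ fun j _ => i1 j).neg
  have i5 : Integrable (fun x => -(∑ j : Fin d, fderiv ℝ Φ x (EuclideanSpace.single j 1) * g x j)
      - c * (Φ x * (‖x‖ ^ (-2 : ℝ) • f x))) volume := i4.sub (i2.const_mul (c : ℂ))
  rw [integral_add i5 i3, integral_sub i4 (i2.const_mul _), integral_neg,
    integral_finsetSum _ fun j _ => i1 j, integral_const_mul]

theorem integral_re_add_im {m : ℝ} {Ψ φ : Space d → ℂ} (hΨ : Continuous Ψ)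
    (h0 : ∀ x, x ∉ annulus d m → Ψ x = 0) (hφ : IntegrableOn φ (annulus d m) volume) :
    ∫ x, Ψ x * φ x = (∫ x, (Ψ x).re • φ x) + Complex.I * ∫ x, (Ψ x).im • φ x := by
  have h1 := integrable_mul_of_annulus (Ψ := fun x => ((Ψ x).re : ℂ)) (by fun_prop)
    (fun x hx => by rw [h0 x hx]; simp) hφ
  have h2 := integrable_mul_of_annulus (Ψ := fun x => ((Ψ x).im : ℂ)) (by fun_prop)
    (fun x hx => by rw [h0 x hx]; simp) hφ
  simp only [Complex.real_smul]
  rw [← integral_const_mul, ← integral_add h1 (h2.const_mul _)]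
  congr 1
  ext x
  conv_lhs => rw [← Complex.re_add_im (Ψ x)]
  ring

/-- The equation is postulated for real test functions only; splitting into real and imaginary parts
extends it to the complex ones produced by `act`. -/
theorem pairing_eq_rhsPairing (hA : IsAdmissible d b σ) (h : IsPair f (weakGrad f))
    {Φ : Space d → ℂ} (hΦ : TestOn m Φ) :
    pairing c b σ f (weakGrad f) Φ = rhsPairing c b σ f (fun x => (Φ x).re)
      + Complex.I * rhsPairing c b σ f (fun x => (Φ x).im) := by
  obtain ⟨h1, h2, -, h3⟩ := h.integrableOn_annulus hA m
  have hre : ∀ x j, (fderiv ℝ Φ x (EuclideanSpace.single j 1)).re = pderiv j (fun x => (Φ x).re) x :=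
    fun x j => by rw [hΦ.fderiv_apply]; simp
  have him : ∀ x j, (fderiv ℝ Φ x (EuclideanSpace.single j 1)).im = pderiv j (fun x => (Φ x).im) x :=
    fun x j => by rw [hΦ.fderiv_apply]; simp
  have e1 : ∀ j : Fin d, ∫ x, fderiv ℝ Φ x (EuclideanSpace.single j 1) * weakGrad f x j
      = (∫ x, pderiv j (fun x => (Φ x).re) x • weakGrad f x j)
        + Complex.I * ∫ x, pderiv j (fun x => (Φ x).im) x • weakGrad f x j := by
    intro j
    rw [integral_re_add_im (hΦ.continuous_fderiv.clm_apply continuous_const)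
      (fun x hx => by rw [hΦ.fderiv_zero hx]; rfl) (h1 j)]
    simp only [hre, him]
  rw [pairing_eq hA h hΦ, integral_re_add_im hΦ.contDiff.continuous hΦ.zero h2,
    integral_re_add_im hΦ.contDiff.continuous hΦ.zero h3]
  simp only [e1, rhsPairing, nonlin, Finset.sum_add_distrib, ← Finset.mul_sum]
  ring

/-- The pairing is bounded by the `C¹` norm of the test function and the energy. -/
theorem exists_norm_pairing_le (hA : IsAdmissible d b σ) (c m : ℝ) :
    ∃ C : ℝ, 0 ≤ C ∧ ∀ (f : Space d → ℂ) (g : Space d → EuclideanSpace ℂ (Fin d))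
      (Φ : Space d → ℂ) (M : ℝ), IsPair f g → TestOn m Φ → (∀ x, ‖Φ x‖ ≤ M) →
      (∀ x j, ‖fderiv ℝ Φ x (EuclideanSpace.single j 1)‖ ≤ M) →
      ‖pairing c b σ f g Φ‖ ≤ C * M * (1 + energy f g) := by
  obtain ⟨C, hC, hb⟩ := exists_annulus_bound hA m
  set v := (volume : Measure (Space d)).real (annulus d m) with hv
  have hv0 : 0 ≤ v := measureReal_nonneg
  refine ⟨(d + |c| + 1) * C * (v + 1), by positivity, fun f g Φ M h hΦ hM1 hM2 => ?_⟩
  have hM : 0 ≤ M := (norm_nonneg _).trans (hM1 0)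
  have hdi := h.integrable_dens hA.three_le
  have hd0 : ∀ x, 0 ≤ dens hardyWeight (sobolevExp d) x (f x) (g x) := fun x =>
    dens_nonneg one_le_hardyWeight _ x _ _
  have hint : Integrable ((annulus d m).indicator fun x => (d + |c| + 1) * C * M *
      (1 + dens hardyWeight (sobolevExp d) x (f x) (g x))) volume := by
    rw [integrable_indicator_iff (measurableSet_annulus m)]
    exact ((integrableOn_const (isCompact_annulus m).measure_lt_top.ne).add
      hdi.integrableOn).const_mul _
  have hpt : ∀ x, ‖pairingDensity c b σ Φ x (f x) (g x)‖ ≤ (annulus d m).indicator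
      (fun x => (d + |c| + 1) * C * M * (1 + dens hardyWeight (sobolevExp d) x (f x) (g x))) x := by
    intro x
    by_cases hx : x ∈ annulus d m
    · rw [Set.indicator_of_mem hx]
      obtain ⟨b1, b2, -, b3⟩ := hb x hx (f x) (g x)
      set D := dens hardyWeight (sobolevExp d) x (f x) (g x)
      unfold pairingDensity
      refine (norm_add_le _ _).trans ((add_le_add_left (norm_sub_le _ _) _).trans ?_)
      have t1 : ‖-(∑ j : Fin d, fderiv ℝ Φ x (EuclideanSpace.single j 1) * g x j)‖
          ≤ d * (M * (C * (1 + D))) := by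
        rw [norm_neg]
        refine (norm_sum_le _ _).trans ?_
        calc _ ≤ ∑ _j : Fin d, M * (C * (1 + D)) := by
              refine Finset.sum_le_sum fun j _ => ?_
              rw [norm_mul]
              exact mul_le_mul (hM2 x j) ((PiLp.norm_apply_le (g x) j).trans b1) (norm_nonneg _) hM
          _ = _ := by simp
      have t2 : ‖(c : ℂ) * (Φ x * (‖x‖ ^ (-2 : ℝ) • f x))‖ ≤ |c| * (M * (C * (1 + D))) := by
        rw [norm_mul, norm_mul, Complex.norm_real, Real.norm_eq_abs]
        exact mul_le_mul_of_nonneg_left (mul_le_mul (hM1 x) b2 (norm_nonneg _) hM) (abs_nonneg _)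
      have t3 : ‖Φ x * ((‖x‖ ^ (-b) * ‖f x‖ ^ σ) • f x)‖ ≤ M * (C * (1 + D)) := by
        rw [norm_mul]
        exact mul_le_mul (hM1 x) b3 (norm_nonneg _) hM
      calc _ ≤ d * (M * (C * (1 + D))) + |c| * (M * (C * (1 + D))) + M * (C * (1 + D)) := by
            gcongr
        _ = _ := by ring
    · rw [Set.indicator_of_notMem hx, pairingDensity, hΦ.zero x hx, hΦ.fderiv_zero hx]
      simp
  refine (norm_integral_le_of_norm_le hint (Eventually.of_forall hpt)).trans ?_
  have hc : Integrable (fun _ : Space d => (1 : ℝ)) (volume.restrict (annulus d m)) :=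
    integrableOn_const (isCompact_annulus m).measure_lt_top.ne
  rw [integral_indicator (measurableSet_annulus m), integral_const_mul,
    integral_add hc hdi.integrableOn]
  have e1 : ∫ x in annulus d m, dens hardyWeight (sobolevExp d) x (f x) (g x) ≤ energy f g :=
    setIntegral_le_integral hdi (Eventually.of_forall hd0)
  have e2 : 0 ≤ energy f g := integral_nonneg hd0
  rw [setIntegral_const, smul_eq_mul, mul_one]
  calc _ ≤ (d + |c| + 1) * C * M * (v + energy f g) := by gcongr
    _ ≤ (d + |c| + 1) * C * M * ((v + 1) * (1 + energy f g)) := by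
        gcongr
        nlinarith
    _ = _ := by ring

end pairing

end INLS
end

/-! ### Continuity in time of energy functionals; the symmetric first order operator. -/

noncomputable section
namespace INLS

variable {d : ℕ}

section Time

variable {I : Set ℝ} {u : ℝ → Space d → ℂ}

theorem ContL2.tendsto_subtype {F : Type*} [NormedAddCommGroup F] {f : ℝ → Space d → F}
    (h : ContL2 I f) (t : I) :
    Tendsto (fun s : I => eLpNorm (f s - f t) 2 volume) (𝓝 t) (𝓝 0) := by
  have := h.2 t t.2
  rw [nhdsWithin_eq_map_subtype_coe t.2, tendsto_map'_iff] at this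
  exact this

theorem ContH1.tendsto_lintegral_dens (hd : 3 ≤ d) (hu : ContH1 I u) (t : I) :
    Tendsto (fun s : I => ∫⁻ x, ENNReal.ofReal (dens hardyWeight (sobolevExp d) x
      (u s x - u t x) (weakGrad (u s) x - weakGrad (u t) x))) (𝓝 t) (𝓝 0) := by
  obtain ⟨C, hC⟩ := exists_lintegral_dens_le hd
  have hq := sobolevExp_pos hd
  have h1 := (hu.2.2.tendsto_subtype t).add (hu.2.1.tendsto_subtype t)
  rw [add_zero] at h1
  have h2 := ((ENNReal.continuous_pow 2).tendsto 0).comp h1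
  have h3 := ((ENNReal.continuous_rpow_const (y := sobolevExp d)).tendsto 0).comp h1
  have h4 := ENNReal.Tendsto.const_mul (h2.add h3) (a := C) (Or.inr ENNReal.coe_ne_top)
  simp only [ne_eq, OfNat.ofNat_ne_zero, not_false_eq_true, zero_pow, ENNReal.zero_rpow_of_pos hq,
    add_zero, mul_zero] at h4
  refine tendsto_of_tendsto_of_tendsto_of_le_of_le tendsto_const_nhds h4 (fun _ => zero_le)
    fun s => ?_
  -- The difference of the two times is again a pair of function and weak gradient, so the energy
  -- bound applies to it.
  exact hC _ _ ((hu.1 s s.2).isPair.sub (hu.1 t t.2).isPair)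

/-- Functionals controlled by the energy density are continuous in time. -/
theorem ContH1.continuousOn_integral (hd : 3 ≤ d) (hu : ContH1 I u) {μ : Measure (Space d)}
    (hμ : μ ≤ volume) {E : Type*}
    [NormedAddCommGroup E] [NormedSpace ℝ E] [MeasurableSpace E] [BorelSpace E]
    [SecondCountableTopology E] {Φ : Space d → ℂ → EuclideanSpace ℂ (Fin d) → E}
    (hΦm : Measurable fun p : Space d × ℂ × EuclideanSpace ℂ (Fin d) => Φ p.1 p.2.1 p.2.2)
    (hΦc : ∀ x, Continuous fun p : ℂ × EuclideanSpace ℂ (Fin d) => Φ x p.1 p.2)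
    {h : Space d → ℝ} (hh : Integrable h μ) {C : ℝ} (hC : 0 ≤ C)
    (hb : ∀ x z w, ‖Φ x z w‖ ≤ h x + C * dens hardyWeight (sobolevExp d) x z w) :
    ContinuousOn (fun t => ∫ x, Φ x (u t x) (weakGrad (u t) x) ∂μ) I := by
  rw [continuousOn_iff_continuous_domRestrict, continuous_iff_continuousAt]
  intro t
  have hp := fun s : I => (hu.1 s s.2).isPair
  refine (tendsto_integral_of_dens (l := 𝓝 t) one_le_hardyWeight measurable_hardyWeight
    (sobolevExp_pos hd).le (fun s => (hp s).left.1.mono_measure hμ)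
    (fun s => (hp s).right.1.mono_measure hμ)
    ((hp t).left.1.mono_measure hμ) ((hp t).right.1.mono_measure hμ)
    ?_ ?_ hΦm hΦc hh hC hb).2
  · exact ((lintegral_mono' hμ le_rfl).trans_lt ((hp t).lintegral_dens_ne_top hd).lt_top).ne
  · exact tendsto_of_tendsto_of_tendsto_of_le_of_le tendsto_const_nhds
      (hu.tendsto_lintegral_dens hd t) (fun _ => zero_le) fun s => lintegral_mono' hμ le_rfl

theorem ContH1.continuousOn_energy (hd : 3 ≤ d) (hu : ContH1 I u) :
    ContinuousOn (fun t => energy (u t) (weakGrad (u t))) I := by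
  refine hu.continuousOn_integral hd le_rfl (measurable_dens measurable_hardyWeight _) (fun x => ?_)
    (integrable_zero _ _ _) zero_le_one fun x z w => ?_
  · have := sobolevExp_pos hd
    unfold dens
    have h2 : Continuous fun p : ℂ × EuclideanSpace ℂ (Fin d) => ‖p.1‖ ^ sobolevExp d :=
      continuous_fst.norm.rpow_const fun _ => Or.inr this.le
    fun_prop
  · rw [Real.norm_eq_abs, abs_of_nonneg (dens_nonneg one_le_hardyWeight _ x z w)]
    simp

theorem ContH1.exists_energy_le (hd : 3 ≤ d) (hu : ContH1 I u) {a b : ℝ} (hab : Set.Icc a b ⊆ I) :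
    ∃ C : ℝ, 0 ≤ C ∧ ∀ t ∈ Set.Icc a b, energy (u t) (weakGrad (u t)) ≤ C := by
  obtain ⟨C, hC⟩ := isCompact_Icc.exists_bound_of_continuousOn
    ((hu.continuousOn_energy hd).mono hab)
  exact ⟨max C 0, le_max_right _ _, fun t ht =>
    (le_abs_self _).trans ((hC t ht).trans (le_max_left _ _))⟩

end Time

/-- The symmetric first order differential operator `f ↦ ψ f - i (k x·∇f + (d k + k') f / 2)`. -/
def act (ψ k : ℝ → ℝ) (x : Space d) (z : ℂ) (w : EuclideanSpace ℂ (Fin d)) : ℂ :=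
  rad ψ x * z - Complex.I * (rad k x * xdot x w
    + (1 / 2) * rad (fun s => d * k s + deriv k s) x * z)

section Act

variable {ψ k : ℝ → ℝ}

theorem continuous_act (hψ : IsCut ψ) (hk : IsCut k) :
    Continuous fun p : Space d × ℂ × EuclideanSpace ℂ (Fin d) => act ψ k p.1 p.2.1 p.2.2 := by
  have h1 : Continuous fun p : Space d × ℂ × EuclideanSpace ℂ (Fin d) => rad ψ p.1 :=
    hψ.continuous_rad.comp continuous_fst
  have h2 : Continuous fun p : Space d × ℂ × EuclideanSpace ℂ (Fin d) => rad k p.1 :=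
    hk.continuous_rad.comp continuous_fst
  have h3 : Continuous fun p : Space d × ℂ × EuclideanSpace ℂ (Fin d) =>
      rad (fun s => d * k s + deriv k s) p.1 :=
    (hk.div_profile d).continuous_rad.comp continuous_fst
  have h4 : Continuous fun p : Space d × ℂ × EuclideanSpace ℂ (Fin d) => xdot p.1 p.2.2 := by
    unfold xdot
    fun_prop
  unfold act
  fun_prop

theorem exists_norm_act_le (hψ : IsCut ψ) (hk : IsCut k) :
    ∃ C : ℝ, 0 ≤ C ∧ ∀ (x : Space d) (z : ℂ) (w : EuclideanSpace ℂ (Fin d)),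
      ‖act ψ k x z w‖ ≤ C * (‖z‖ + ‖w‖) := by
  obtain ⟨C₁, h1, b1⟩ := hψ.exists_bound
  obtain ⟨C₂, h2, b2⟩ := hk.abs_rad_mul_norm_le (d := d)
  obtain ⟨C₃, h3, b3⟩ := (hk.div_profile d).exists_bound
  refine ⟨C₁ + C₂ + C₃, by positivity, fun x z w => ?_⟩
  have t1 : ‖(rad ψ x : ℂ) * z‖ ≤ C₁ * ‖z‖ := by
    rw [norm_mul, Complex.norm_real]
    exact mul_le_mul_of_nonneg_right (IsCut.abs_rad_le h1.le b1 x) (norm_nonneg _)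
  have t2 : ‖(rad k x : ℂ) * xdot x w‖ ≤ C₂ * ‖w‖ := by
    rw [norm_mul, Complex.norm_real, Real.norm_eq_abs]
    calc _ ≤ |rad k x| * (‖x‖ * ‖w‖) :=
          mul_le_mul_of_nonneg_left (norm_xdot_le x w) (abs_nonneg _)
      _ = |rad k x| * ‖x‖ * ‖w‖ := by ring
      _ ≤ _ := mul_le_mul_of_nonneg_right (b2 x) (norm_nonneg _)
  have t3 : ‖(1 / 2 : ℂ) * rad (fun s => d * k s + deriv k s) x * z‖ ≤ C₃ * ‖z‖ := by
    rw [norm_mul, norm_mul, Complex.norm_real]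
    have e : ‖(1 / 2 : ℂ)‖ = 1 / 2 := by norm_num
    have := mul_le_mul_of_nonneg_right (IsCut.abs_rad_le h3.le b3 x) (norm_nonneg z)
    rw [e, mul_assoc, Real.norm_eq_abs]
    nlinarith [mul_nonneg (abs_nonneg (rad (fun s => d * k s + deriv k s) x)) (norm_nonneg z)]
  unfold act
  calc _ ≤ C₁ * ‖z‖ + (C₂ * ‖w‖ + C₃ * ‖z‖) := by
        refine (norm_sub_le _ _).trans (add_le_add t1 ?_)
        rw [norm_mul, Complex.norm_I, one_mul]
        exact (norm_add_le _ _).trans (add_le_add t2 t3)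
    _ ≤ _ := by nlinarith [norm_nonneg z, norm_nonneg w, mul_nonneg h1.le (norm_nonneg w),
        mul_nonneg h2 (norm_nonneg z), mul_nonneg h3.le (norm_nonneg w)]

theorem aestronglyMeasurable_act (hψ : IsCut ψ) (hk : IsCut k) {f : Space d → ℂ}
    {g : Space d → EuclideanSpace ℂ (Fin d)} {μ : Measure (Space d)}
    (hf : AEStronglyMeasurable f μ) (hg : AEStronglyMeasurable g μ) :
    AEStronglyMeasurable (fun x => act ψ k x (f x) (g x)) μ :=
  ((continuous_act hψ hk).measurable.comp_aemeasurable
    (aemeasurable_id.prodMk (hf.aemeasurable.prodMk hg.aemeasurable))).aestronglyMeasurable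

theorem exists_eLpNorm_act_le (hψ : IsCut ψ) (hk : IsCut k) :
    ∃ C : NNReal, ∀ (f : Space d → ℂ) (g : Space d → EuclideanSpace ℂ (Fin d)),
      AEStronglyMeasurable f volume → AEStronglyMeasurable g volume →
      eLpNorm (fun x => act ψ k x (f x) (g x)) 2 volume
        ≤ C * (eLpNorm f 2 volume + eLpNorm g 2 volume) := by
  obtain ⟨C, hC, hb⟩ := exists_norm_act_le (d := d) hψ hk
  refine ⟨C.toNNReal, fun f g hf hg => ?_⟩
  have h1 := eLpNorm_le_mul_eLpNorm_of_ae_le_mul (f := fun x => act ψ k x (f x) (g x))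
    (g := fun x => ‖f x‖ + ‖g x‖) (μ := volume) (c := C)
    (Eventually.of_forall fun x => (hb x (f x) (g x)).trans_eq (by
      rw [Real.norm_of_nonneg (by positivity)])) 2
  refine h1.trans (mul_le_mul_right ?_ _)
  refine (eLpNorm_add_le hf.norm hg.norm (by norm_num)).trans_eq ?_
  rw [eLpNorm_norm, eLpNorm_norm]

theorem act_sub (x : Space d) (z z' : ℂ) (w w' : EuclideanSpace ℂ (Fin d)) :
    act ψ k x (z - z') (w - w') = act ψ k x z w - act ψ k x z' w' := by
  unfold act
  rw [xdot_sub]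
  ring

theorem act_eq_zero {m : ℝ} (hψ : ∀ s, m < |s| → ψ s = 0) (hk : ∀ s, m < |s| → k s = 0)
    {x : Space d} (hx : x ∉ annulus d m) (z : ℂ) (w : EuclideanSpace ℂ (Fin d)) :
    act ψ k x z w = 0 := by
  have hk' : ∀ s, m < |s| → (fun s => d * k s + deriv k s) s = 0 := by
    intro s hs
    have he : k =ᶠ[𝓝 s] fun _ => 0 := by
      filter_upwards [continuous_abs.continuousAt.eventually (lt_mem_nhds hs)] with r hr
      exact hk r hr
    simp [hk s hs, he.deriv_eq]
  unfold act
  rw [IsCut.rad_eq_zero hψ hx, IsCut.rad_eq_zero hk hx, IsCut.rad_eq_zero hk' hx]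
  simp

/-- A smooth function together with its gradient. -/
structure SmoothPair (v : Space d → ℂ) (w : Space d → EuclideanSpace ℂ (Fin d)) : Prop where
  left : ContDiff ℝ ∞ v
  right : ContDiff ℝ ∞ w
  fderiv_apply : ∀ x y, fderiv ℝ v x y = xdot y (w x)

theorem IsPair.smoothPair_mol {f : Space d → ℂ} {g : Space d → EuclideanSpace ℂ (Fin d)}
    (h : IsPair f g) (n : ℕ) : SmoothPair (mol n f) (mol n g) :=
  ⟨contDiff_mol n h.weak.1, contDiff_mol n h.weak.2.1, fderiv_mol_eq_xdot h.weak n⟩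

theorem contDiff_xdot {w : Space d → EuclideanSpace ℂ (Fin d)} (hw : ContDiff ℝ ∞ w) :
    ContDiff ℝ ∞ fun x => xdot x (w x) := by
  unfold xdot
  refine ContDiff.sum fun j _ => ContDiff.mul ?_ ?_
  · exact Complex.ofRealCLM.contDiff.comp (EuclideanSpace.proj (𝕜 := ℝ) j).contDiff
  · exact (((EuclideanSpace.proj j : EuclideanSpace ℂ (Fin d) →L[ℂ] ℂ)).restrictScalars
      ℝ).contDiff.comp hw

theorem IsCut.contDiff_ofReal_rad (hk : IsCut k) :
    ContDiff ℝ ∞ fun x : Space d => (rad k x : ℂ) :=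
  Complex.ofRealCLM.contDiff.comp hk.contDiff_rad

theorem SmoothPair.contDiff_act (hψ : IsCut ψ) (hk : IsCut k) {v : Space d → ℂ}
    {w : Space d → EuclideanSpace ℂ (Fin d)} (h : SmoothPair v w) :
    ContDiff ℝ ∞ fun x => act ψ k x (v x) (w x) := by
  unfold act
  have h1 := hψ.contDiff_ofReal_rad (d := d)
  have h2 := hk.contDiff_ofReal_rad (d := d)
  have h3 := (hk.div_profile d).contDiff_ofReal_rad (d := d)
  exact (h1.mul h.left).sub (contDiff_const.mul ((h2.mul (contDiff_xdot h.right)).add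
    ((contDiff_const.mul h3).mul h.left)))

theorem SmoothPair.testOn_act (hψ : IsCut ψ) (hk : IsCut k) {m : ℝ}
    (hmψ : ∀ s, m < |s| → ψ s = 0) (hmk : ∀ s, m < |s| → k s = 0) {v : Space d → ℂ}
    {w : Space d → EuclideanSpace ℂ (Fin d)} (h : SmoothPair v w) :
    TestOn m fun x => star (act ψ k x (v x) (w x)) := by
  refine ⟨?_, fun x hx => by rw [act_eq_zero hmψ hmk hx, star_zero]⟩
  exact (starL' ℝ (A := ℂ)).contDiff.comp (h.contDiff_act hψ hk)

/-- The operator `act` is symmetric for the real inner product of `L²`. -/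
theorem SmoothPair.integral_act_symm (hψ : IsCut ψ) (hk : IsCut k)
    {p q : Space d → ℂ} {P Q : Space d → EuclideanSpace ℂ (Fin d)}
    (hp : SmoothPair p P) (hq : SmoothPair q Q) :
    ∫ x, (p x * star (act ψ k x (q x) (Q x))).re = ∫ x, (q x * star (act ψ k x (p x) (P x))).re := by
  -- The two integrands differ by `-(rad k x·∇G + (d k + k')G)`, which is minus the divergence of `G
  -- · rad k · x` and integrates to zero. The `ψ` parts agree since `ψ` is real.
  set G : Space d → ℝ := fun x => (p x * star (q x)).im with hG
  have hGd : ∀ x, HasFDerivAt (fun x => p x * star (q x))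
      (p x • ((starL' ℝ (A := ℂ)).toContinuousLinearMap.comp (fderiv ℝ q x))
        + star (q x) • fderiv ℝ p x) x := fun x => by
    have h1 := (hp.left.differentiable (by simp) x).hasFDerivAt
    have h2 := (starL' ℝ (A := ℂ)).toContinuousLinearMap.hasFDerivAt.comp x
      (hq.left.differentiable (by simp) x).hasFDerivAt
    exact h1.mul h2
  have hGd2 : ∀ x, fderiv ℝ G x x = (p x * star (xdot x (Q x)) + star (q x) * xdot x (P x)).im := by
    intro x
    have : HasFDerivAt G _ x := Complex.imCLM.hasFDerivAt.comp x (hGd x)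
    rw [this.fderiv]
    simp [hp.fderiv_apply, hq.fderiv_apply]
  have hGs : ContDiff ℝ 1 G :=
    (Complex.imCLM.contDiff.comp (hp.left.mul
      ((starL' ℝ (A := ℂ)).contDiff.comp hq.left))).of_le (by simp)
  have key := integral_rad_mul_fderiv hk hGs
  have c1 : Integrable (fun x => rad k x * fderiv ℝ G x x) volume :=
    (hk.continuous_rad.mul ((hGs.continuous_fderiv (by simp)).clm_apply
      continuous_id)).integrable_of_hasCompactSupport hk.hasCompactSupport_rad.mul_right
  have c2 : Integrable (fun x => rad (fun s => d * k s + deriv k s) x * G x) volume :=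
    ((hk.div_profile d).continuous_rad.mul hGs.continuous).integrable_of_hasCompactSupport
      (hk.div_profile d).hasCompactSupport_rad.mul_right
  obtain ⟨m₁, -, hm₁⟩ := hψ.exists_zero
  obtain ⟨m₂, -, hm₂⟩ := hk.exists_zero
  have ci : ∀ {p q : Space d → ℂ} {Q : Space d → EuclideanSpace ℂ (Fin d)}, Continuous p →
      SmoothPair q Q → Integrable (fun x => (p x * star (act ψ k x (q x) (Q x))).re) volume := by
    intro p q Q hp hq
    have ht := hq.testOn_act hψ hk (m := max m₁ m₂)
      (fun s hs => hm₁ s ((le_max_left _ _).trans_lt hs))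
      (fun s hs => hm₂ s ((le_max_right _ _).trans_lt hs))
    exact ((hp.mul ht.contDiff.continuous).integrable_of_hasCompactSupport
      ht.hasCompactSupport.mul_left).re
  rw [← sub_eq_zero, ← integral_sub (ci hp.left.continuous hq) (ci hq.left.continuous hp)]
  have e : ∀ x, (p x * star (act ψ k x (q x) (Q x))).re - (q x * star (act ψ k x (p x) (P x))).re
      = -(rad k x * fderiv ℝ G x x + rad (fun s => d * k s + deriv k s) x * G x) := by
    intro x
    rw [hGd2, hG]
    simp [act, Complex.mul_re, Complex.mul_im]
    ring
  simp only [e]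
  rw [integral_neg, integral_add c1 c2, key]
  ring

end Act

end INLS
end

/-! ### Time derivative of the quadratic form along the mollified solution. -/

noncomputable section
namespace INLS

variable {d : ℕ}

/-- Here the derivative falls on the smooth factor and not on the mollifier, so that the mollifier
can afterwards be moved to the other side of a pairing. -/
theorem fderiv_mol_of_smooth (n : ℕ) {Φ : Space d → ℂ} (hΦ : ContDiff ℝ 1 Φ)
    (hs : HasCompactSupport Φ) (x v : Space d) :
    fderiv ℝ (mol n Φ) x v = mol n (fun y => fderiv ℝ Φ y v) x := by
  have h := (hs.hasFDerivAt_convolution_right (μ := volume)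
    (ContinuousLinearMap.lsmul ℝ ℝ (E := ℂ)) (continuous_mollifier n).locallyIntegrable hΦ x).fderiv
  rw [mol, h]
  have hc : ConvolutionExistsAt (mollifier d n) (fderiv ℝ Φ) x
      ((ContinuousLinearMap.lsmul ℝ ℝ (E := ℂ)).precompR (Space d)) volume :=
    (hs.fderiv ℝ).convolutionExists_right _ (continuous_mollifier n).locallyIntegrable
      (hΦ.continuous_fderiv (by simp)) x
  exact (ContinuousLinearMap.integral_apply hc v)

theorem exists_sub_mem_annulus (d : ℕ) (m : ℝ) : ∃ δ : ℝ, 0 < δ ∧ ∀ x ∈ annulus d m, ∀ y : Space d,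
    ‖y‖ < δ → x - y ∈ annulus d (m + 1) := by
  have h1 : 0 < Real.exp (-m) - Real.exp (-(m + 1)) := by
    rw [sub_pos]
    exact Real.exp_lt_exp.2 (by linarith)
  have h2 : 0 < Real.exp (m + 1) - Real.exp m := by
    rw [sub_pos]
    exact Real.exp_lt_exp.2 (by linarith)
  refine ⟨_, lt_min h1 h2, fun x hx y hy => ⟨?_, ?_⟩⟩
  · have := norm_sub_norm_le x y
    have := hy.trans_le (min_le_left _ _)
    linarith [hx.1]
  · have := norm_sub_le x y
    have := hy.trans_le (min_le_right _ _)
    linarith [hx.2]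

/-- The threshold depends on the radius of the mollifier only and not on the test function, which
matters because the test functions used later vary with time. -/
theorem exists_testOn_mol (d : ℕ) (m : ℝ) : ∃ N : ℕ, ∀ n, N ≤ n → ∀ Φ : Space d → ℂ, TestOn m Φ →
    TestOn (m + 1) (mol n Φ) := by
  obtain ⟨δ, hδ, hδm⟩ := exists_sub_mem_annulus d m
  obtain ⟨N, hN⟩ := eventually_atTop.1 ((tendsto_bump_rOut (d := d)).eventually (gt_mem_nhds hδ))
  refine ⟨N, fun n hn Φ hΦ =>
    ⟨contDiff_mol n hΦ.contDiff.continuous.locallyIntegrable, fun x hx => ?_⟩⟩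
  rw [mol_apply']
  refine integral_eq_zero_of_ae (Eventually.of_forall fun y => ?_)
  rcases le_or_gt (bump d n).rOut ‖y‖ with hy | hy
  · simp [mollifier_eq_zero hy]
  · have hz : x - y ∉ annulus d m := fun h => hx <| by
      have := hδm _ h (-y) (by rw [norm_neg]; exact hy.trans (hN n hn))
      simpa using this
    simp [hΦ.zero _ hz]

/-- For fixed `n`, mollification maps `L²` into `C¹`. The constant may blow up with `n`: it only
serves to discard a remainder at fixed `n`. -/
theorem exists_enorm_mol_le (d n : ℕ) : ∃ C : NNReal, ∀ φ : Space d → ℂ, MemLp φ 2 volume →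
    ∀ x, ‖mol n φ x‖ₑ ≤ C * eLpNorm φ 2 volume ∧
      ∀ j, ‖fderiv ℝ (mol n φ) x (EuclideanSpace.single j 1)‖ₑ ≤ C * eLpNorm φ 2 volume := by
  have h0 : MemLp (mollifier d n) 2 volume :=
    (continuous_mollifier n).memLp_of_hasCompactSupport (hasCompactSupport_mollifier n)
  have hc : ∀ j : Fin d, Continuous fun x => fderiv ℝ (mollifier d n) x (EuclideanSpace.single j 1) :=
    fun j => ((contDiff_mollifier n).continuous_fderiv (by simp)).clm_apply continuous_const
  have h1 : ∀ j : Fin d, MemLp (fun x => fderiv ℝ (mollifier d n) x (EuclideanSpace.single j 1)) 2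
      volume := fun j => (hc j).memLp_of_hasCompactSupport
    (((hasCompactSupport_mollifier n).fderiv ℝ).comp_left
      (g := fun L : Space d →L[ℝ] ℝ => L (EuclideanSpace.single j 1)) rfl)
  set C : ℝ≥0∞ := eLpNorm (mollifier d n) 2 volume + ∑ j : Fin d,
    eLpNorm (fun x => fderiv ℝ (mollifier d n) x (EuclideanSpace.single j 1)) 2 volume with hC
  have hCt : C ≠ ⊤ := ENNReal.add_ne_top.2 ⟨h0.2.ne, ENNReal.sum_ne_top.2 fun j _ => (h1 j).2.ne⟩
  refine ⟨C.toNNReal, fun φ hφ x => ?_⟩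
  rw [ENNReal.coe_toNNReal hCt]
  refine ⟨?_, fun j => ?_⟩
  · rw [mol_apply]
    exact (enorm_integral_kernel_le h0.1 hφ.1 x).trans (mul_le_mul_left le_self_add _)
  · rw [fderiv_mol n (locallyIntegrable_of_memLp_two hφ)]
    refine (enorm_integral_kernel_le (h1 j).1 hφ.1 x).trans (mul_le_mul_left ?_ _)
    exact (Finset.single_le_sum (f := fun j : Fin d =>
      eLpNorm (fun x => fderiv ℝ (mollifier d n) x (EuclideanSpace.single j 1)) 2 volume)
      (fun _ _ => zero_le) (Finset.mem_univ j)).trans le_add_self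

section Solution

variable {c b σ : ℝ} {I : Set ℝ} {u₀ : Space d → ℂ} {u : ℝ → Space d → ℂ}

/-- The equation tested with complex functions. -/
theorem IsSolution.hasDerivWithinAt_integral (hA : IsAdmissible d b σ) (hu : IsSolution c b σ I u₀ u)
    {m : ℝ} {Φ : Space d → ℂ} (hΦ : TestOn m Φ) {t : ℝ} (ht : t ∈ I) :
    HasDerivWithinAt (fun s => ∫ x, Φ x * u s x)
      (Complex.I * pairing c b σ (u t) (weakGrad (u t)) Φ) I t := by
  have h1 := hu.equation _ hΦ.isTest_re t ht
  have h2 := hu.equation _ hΦ.isTest_im t ht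
  have hp := fun s (hs : s ∈ I) => (hu.contH1.1 s hs).isPair
  have h3 := h1.add (h2.const_mul Complex.I)
  have he : ∀ s ∈ I, ∫ x, Φ x * u s x
      = (∫ x, (Φ x).re • u s x) + Complex.I * ∫ x, (Φ x).im • u s x := fun s hs =>
    integral_re_add_im hΦ.contDiff.continuous hΦ.zero ((hp s hs).integrableOn_annulus hA m).2.2.1
  rw [pairing_eq_rhsPairing hA (hp t ht) hΦ]
  refine (h3.congr_deriv ?_).congr he (he t ht)
  ring

/-- Mean value inequality: the pairing is bounded by the `C¹` size of the test function times the
energy, and the energy is bounded on compact time intervals. The constant is uniform over test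
functions on the annulus. -/
theorem IsSolution.exists_norm_integral_sub_le (hA : IsAdmissible d b σ)
    (hu : IsSolution c b σ I u₀ u) (m : ℝ) {α β : ℝ} (hI : Set.Icc α β ⊆ I) :
    ∃ C : ℝ, 0 ≤ C ∧ ∀ (Φ : Space d → ℂ) (M : ℝ), TestOn m Φ → (∀ x, ‖Φ x‖ ≤ M) →
      (∀ x j, ‖fderiv ℝ Φ x (EuclideanSpace.single j 1)‖ ≤ M) → ∀ s ∈ Set.Icc α β,
      ∀ t ∈ Set.Icc α β, ‖(∫ x, Φ x * u s x) - ∫ x, Φ x * u t x‖ ≤ C * M * |s - t| := by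
  obtain ⟨C, hC, hb⟩ := exists_norm_pairing_le hA c m
  obtain ⟨E, hE, hE'⟩ := hu.contH1.exists_energy_le hA.three_le hI
  refine ⟨C * (1 + E), by positivity, fun Φ M hΦ h1 h2 s hs t ht => ?_⟩
  have hM : 0 ≤ M := (norm_nonneg _).trans (h1 0)
  refine (convex_Icc α β).norm_image_sub_le_of_norm_hasDerivWithin_le
    (fun τ hτ => (hu.hasDerivWithinAt_integral hA hΦ (hI hτ)).mono hI) (fun τ hτ => ?_) ht hs
  rw [norm_mul, Complex.norm_I, one_mul]
  refine (hb _ _ Φ M (hu.contH1.1 τ (hI hτ)).isPair hΦ h1 h2).trans ?_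
  calc _ ≤ C * M * (1 + E) := by gcongr; exact hE' τ hτ
    _ = _ := by ring

/-- The quadratic form of the operator `act`. -/
def actForm (ψ k : ℝ → ℝ) (f : Space d → ℂ) (g : Space d → EuclideanSpace ℂ (Fin d)) : ℝ :=
  ∫ x, (f x * star (act ψ k x (f x) (g x))).re

theorem TestOn.memLp_two {m : ℝ} {Φ : Space d → ℂ} (hΦ : TestOn m Φ) : MemLp Φ 2 volume :=
  hΦ.contDiff.continuous.memLp_of_hasCompactSupport hΦ.hasCompactSupport

theorem integrable_mul_testOn {m : ℝ} {p Φ : Space d → ℂ} (hΦ : TestOn m Φ) (hp : Continuous p) :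
    Integrable (fun x => p x * Φ x) volume :=
  (hp.mul hΦ.contDiff.continuous).integrable_of_hasCompactSupport hΦ.hasCompactSupport.mul_left

/-- Second order expansion of a quadratic form. Symmetry of `act` merges the two cross terms, and
symmetry of mollification lets `f' - f` be paired with smooth test functions, where the equation is
available. -/
theorem IsPair.actForm_mol_sub {ψ k : ℝ → ℝ} (hψ : IsCut ψ) (hk : IsCut k) {m : ℝ}
    (hmψ : ∀ s, m < |s| → ψ s = 0) (hmk : ∀ s, m < |s| → k s = 0) {f f' : Space d → ℂ}
    {g g' : Space d → EuclideanSpace ℂ (Fin d)} (h : IsPair f g) (h' : IsPair f' g') (n : ℕ) :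
    actForm ψ k (mol n f') (mol n g') = actForm ψ k (mol n f) (mol n g)
      + 2 * (∫ x, mol n (fun x => star (act ψ k x (mol n f x) (mol n g x))) x * (f' x - f x)).re
      + (∫ x, mol n (fun x => star (act ψ k x (mol n (f' - f) x) (mol n (g' - g) x))) x
          * (f' x - f x)).re := by
  have hw := h'.sub h
  have s1 := h.smoothPair_mol n
  have s3 := hw.smoothPair_mol n
  have t1 := s1.testOn_act hψ hk hmψ hmk
  have t3 := s3.testOn_act hψ hk hmψ hmk
  have e1 : mol n f' = mol n f + mol n (f' - f) := by
    rw [mol_sub n h'.weak.1 h.weak.1]; abel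
  have e2 : mol n g' = mol n g + mol n (g' - g) := by
    rw [mol_sub n h'.weak.2.1 h.weak.2.1]; abel
  have k1 : ∀ {Φ : Space d → ℂ}, TestOn m Φ →
      ∫ x, mol n Φ x * (f' x - f x) = ∫ x, mol n (f' - f) x * Φ x := fun {Φ} hΦ => by
    rw [show (∫ x, mol n Φ x * (f' x - f x)) = ∫ x, mol n Φ x * (f' - f) x from rfl,
      integral_mol_mul hΦ.memLp_two hw.left]
    exact integral_congr_ae (Eventually.of_forall fun x => mul_comm _ _)
  have i1 := (integrable_mul_testOn t1 s1.left.continuous).re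
  have i2 := (integrable_mul_testOn t1 s3.left.continuous).re
  have i3 := (integrable_mul_testOn t3 s1.left.continuous).re
  have i4 := (integrable_mul_testOn t3 s3.left.continuous).re
  have hre : ∀ {φ : Space d → ℂ}, Integrable φ volume → (∫ x, φ x).re = ∫ x, (φ x).re := fun hφ =>
    (integral_re hφ).symm
  rw [k1 t1, k1 t3, hre (integrable_mul_testOn t1 s3.left.continuous),
    hre (integrable_mul_testOn t3 s3.left.continuous)]
  have sym := s1.integral_act_symm hψ hk s3
  have ep : ∀ x, (mol n f' x * star (act ψ k x (mol n f' x) (mol n g' x))).re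
      = (mol n f x * star (act ψ k x (mol n f x) (mol n g x))).re
        + (mol n (f' - f) x * star (act ψ k x (mol n f x) (mol n g x))).re
        + (mol n f x * star (act ψ k x (mol n (f' - f) x) (mol n (g' - g) x))).re
        + (mol n (f' - f) x * star (act ψ k x (mol n (f' - f) x) (mol n (g' - g) x))).re := by
    intro x
    have hz : act ψ k x (mol n f' x) (mol n g' x) = act ψ k x (mol n f x) (mol n g x)
        + act ψ k x (mol n (f' - f) x) (mol n (g' - g) x) := by
      rw [← sub_eq_iff_eq_add', ← act_sub, e1, e2]
      simp
    rw [hz, e1, Pi.add_apply, star_add, ← Complex.add_re, ← Complex.add_re, ← Complex.add_re]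
    congr 1
    ring
  unfold actForm
  simp only [ep]
  simp only [RCLike.re_to_complex] at i1 i2 i3 i4
  have add4 : ∀ {a b c e : Space d → ℝ}, Integrable a volume → Integrable b volume →
      Integrable c volume → Integrable e volume →
      ∫ x, (a x + b x + c x + e x) = (∫ x, a x) + (∫ x, b x) + (∫ x, c x) + ∫ x, e x := by
    intro a b c e ha hb hc he
    have hab : Integrable (fun x => a x + b x) volume := ha.add hb
    have habc : Integrable (fun x => a x + b x + c x) volume := hab.add hc
    rw [integral_add habc he, integral_add hab hc, integral_add ha hb]
  rw [add4 i1 i2 i3 i4, sym]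
  ring

/-- Time derivative of the quadratic form along the mollified solution. -/
theorem IsSolution.hasDerivWithinAt_actForm_mol (hA : IsAdmissible d b σ)
    (hu : IsSolution c b σ I u₀ u) {ψ k : ℝ → ℝ} (hψ : IsCut ψ) (hk : IsCut k) {m : ℝ}
    (hmψ : ∀ s, m < |s| → ψ s = 0) (hmk : ∀ s, m < |s| → k s = 0) {n : ℕ}
    (hn : ∀ Φ : Space d → ℂ, TestOn m Φ → TestOn (m + 1) (mol n Φ)) {α β : ℝ}
    (hI : Set.Icc α β ⊆ I) {t : ℝ} (ht : t ∈ Set.Icc α β) :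
    HasDerivWithinAt (fun s => actForm ψ k (mol n (u s)) (mol n (weakGrad (u s))))
      (2 * (Complex.I * pairing c b σ (u t) (weakGrad (u t))
        (mol n fun x => star (act ψ k x (mol n (u t) x) (mol n (weakGrad (u t)) x)))).re)
      (Set.Icc α β) t := by
  have hp := fun s (hs : s ∈ I) => (hu.contH1.1 s hs).isPair
  have hpt := hp t (hI ht)
  set Φ : Space d → ℂ := fun x => star (act ψ k x (mol n (u t) x) (mol n (weakGrad (u t)) x))
  set Ψ : ℝ → Space d → ℂ := fun s x =>
    star (act ψ k x (mol n (u s - u t) x) (mol n (weakGrad (u s) - weakGrad (u t)) x)) with hΨ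
  have hΦt : TestOn m Φ := (hpt.smoothPair_mol n).testOn_act hψ hk hmψ hmk
  have hΨt : ∀ s ∈ I, TestOn m (Ψ s) := fun s hs =>
    (((hp s hs).sub hpt).smoothPair_mol n).testOn_act hψ hk hmψ hmk
  have hint : ∀ {Θ : Space d → ℂ}, TestOn (m + 1) Θ → ∀ s ∈ I,
      ∫ x, Θ x * (u s x - u t x) = (∫ x, Θ x * u s x) - ∫ x, Θ x * u t x := fun {Θ} hΘ s hs => by
    simp only [mul_sub]
    exact integral_sub
      (integrable_mul_of_annulus hΘ.contDiff.continuous hΘ.zero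
        ((hp s hs).integrableOn_annulus hA (m + 1)).2.2.1)
      (integrable_mul_of_annulus hΘ.contDiff.continuous hΘ.zero
        (hpt.integrableOn_annulus hA (m + 1)).2.2.1)
  -- The quadratic remainder. The test function itself tends to zero in `C¹` as `s → t`, while the
  -- pairing with `u s - u t` is Lipschitz in time; the product is `o(|s - t|)`.
  set Rem : ℝ → ℝ := fun s => (∫ x, mol n (Ψ s) x * (u s x - u t x)).re with hRem
  obtain ⟨C, hC, hCb⟩ := hu.exists_norm_integral_sub_le hA (m + 1) hI
  obtain ⟨C₁, hC₁⟩ := exists_enorm_mol_le d n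
  obtain ⟨C₂, hC₂⟩ := exists_eLpNorm_act_le (d := d) hψ hk
  set e : ℝ → ℝ≥0∞ := fun s => C₁ * (C₂ * (eLpNorm (u s - u t) 2 volume
    + eLpNorm (weakGrad (u s) - weakGrad (u t)) 2 volume)) with he
  have het : Tendsto e (𝓝[Set.Icc α β] t) (𝓝 0) := by
    have h1 := (hu.contH1.2.1.2 t (hI ht)).add (hu.contH1.2.2.2 t (hI ht))
    have h2 := ENNReal.Tendsto.const_mul (ENNReal.Tendsto.const_mul h1 (a := C₂)
      (Or.inr ENNReal.coe_ne_top)) (a := C₁) (Or.inr ENNReal.coe_ne_top)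
    simp only [add_zero, mul_zero] at h2
    exact h2.mono_left (nhdsWithin_mono t hI)
  have hefin : ∀ s ∈ I, e s ≠ ⊤ := fun s hs => by
    have := (hp s hs).sub hpt
    exact ENNReal.mul_ne_top ENNReal.coe_ne_top (ENNReal.mul_ne_top ENNReal.coe_ne_top
      (ENNReal.add_ne_top.2 ⟨this.left.2.ne, this.right.2.ne⟩))
  have hΨe : ∀ s ∈ I, C₁ * eLpNorm (Ψ s) 2 volume ≤ e s := fun s hs => by
    have hq := (hp s hs).sub hpt
    refine mul_le_mul_right ?_ _
    have h1 : eLpNorm (Ψ s) 2 volume = eLpNorm (fun x => act ψ k x (mol n (u s - u t) x)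
        (mol n (weakGrad (u s) - weakGrad (u t)) x)) 2 volume :=
      eLpNorm_congr_norm_ae (Eventually.of_forall fun x => norm_star _)
    rw [h1]
    refine (hC₂ _ _ (memLp_mol n hq.left).1 (memLp_mol n hq.right).1).trans ?_
    gcongr
    · exact eLpNorm_two_mol_le n hq.left.1
    · exact eLpNorm_two_mol_le n hq.right.1
  have hRb : ∀ s ∈ Set.Icc α β, |Rem s| ≤ C * (e s).toReal * |s - t| := by
    intro s hs
    have hT := hn _ (hΨt s (hI hs))
    have hm2 := (hΨt s (hI hs)).memLp_two
    have hle : ∀ z : ℂ, ‖z‖ₑ ≤ C₁ * eLpNorm (Ψ s) 2 volume → ‖z‖ ≤ (e s).toReal := fun z hz => by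
      rw [← toReal_enorm]
      exact ENNReal.toReal_mono (hefin s (hI hs)) (hz.trans (hΨe s (hI hs)))
    refine (Complex.abs_re_le_norm _).trans ?_
    rw [hint hT s (hI hs)]
    exact hCb _ _ hT (fun x => hle _ (hC₁ _ hm2 x).1) (fun x j => hle _ ((hC₁ _ hm2 x).2 j)) s hs t ht
  have hRt : Rem t = 0 := by simp [hRem]
  -- Only continuity of `u` in `H¹` is used here, so no strong time derivative of `u` is needed.
  have hRd : HasDerivWithinAt Rem 0 (Set.Icc α β) t := by
    rw [hasDerivWithinAt_iff_isLittleO, Asymptotics.isLittleO_iff]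
    intro ε hε
    have h1 : Tendsto (fun s => C * (e s).toReal) (𝓝[Set.Icc α β] t) (𝓝 0) := by
      have := ((ENNReal.tendsto_toReal ENNReal.zero_ne_top).comp het).const_mul C
      simpa using this
    filter_upwards [h1.eventually (gt_mem_nhds hε), self_mem_nhdsWithin] with s hs hsI
    rw [hRt, smul_zero, sub_zero, sub_zero, Real.norm_eq_abs, Real.norm_eq_abs]
    exact (hRb s hsI).trans (mul_le_mul_of_nonneg_right hs.le (abs_nonneg _))
  have hL := (hu.hasDerivWithinAt_integral hA (hn Φ hΦt) (hI ht)).mono hI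
  have hLre : HasDerivWithinAt (fun s => (∫ x, mol n Φ x * u s x).re)
      (Complex.I * pairing c b σ (u t) (weakGrad (u t)) (mol n Φ)).re (Set.Icc α β) t :=
    Complex.reCLM.hasFDerivAt.comp_hasDerivWithinAt t hL
  have htot := (((hLre.sub_const (∫ x, mol n Φ x * u t x).re).const_mul 2).const_add
    (actForm ψ k (mol n (u t)) (mol n (weakGrad (u t))))).add hRd
  rw [add_zero] at htot
  have hfin : ∀ s ∈ Set.Icc α β, actForm ψ k (mol n (u s)) (mol n (weakGrad (u s)))
      = actForm ψ k (mol n (u t)) (mol n (weakGrad (u t)))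
        + 2 * ((∫ x, mol n Φ x * u s x).re - (∫ x, mol n Φ x * u t x).re) + Rem s := by
    intro s hs
    rw [hpt.actForm_mol_sub hψ hk hmψ hmk (hp s (hI hs)) n, ← Complex.sub_re,
      ← hint (hn Φ hΦt) s (hI hs)]
  exact htot.congr hfin (hfin t ht)

end Solution

end INLS
end

/-! ### The commutator of the Laplacian with the first order operator. -/

noncomputable section
namespace INLS

variable {d : ℕ}

theorem IsCut.exists_abs_rad_mul_norm_sq_le {k : ℝ → ℝ} (hk : IsCut k) :
    ∃ C : ℝ, 0 ≤ C ∧ ∀ x : Space d, |rad k x| * ‖x‖ ^ 2 ≤ C := by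
  obtain ⟨C, hC, h⟩ := (hk.mul_exp 2).exists_bound
  refine ⟨C, hC.le, fun x => ?_⟩
  have := IsCut.abs_rad_le hC.le h x
  rwa [rad_mul_exp, Real.rpow_two, abs_mul, abs_of_nonneg (sq_nonneg ‖x‖)] at this

/-- The profile of the radial derivative divided by the radius. -/
def radDeriv (k : ℝ → ℝ) (s : ℝ) : ℝ := deriv k s * Real.exp ((-2) * s)

theorem IsCut.radDeriv {k : ℝ → ℝ} (hk : IsCut k) : IsCut (radDeriv k) := hk.deriv.mul_exp (-2)

/-- The density of the commutator of the Laplacian with `act ψ k`. -/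
def commDens (ψ k : ℝ → ℝ) (x : Space d) (z : ℂ) (w : EuclideanSpace ℂ (Fin d)) : ℝ :=
  2 * rad (radDeriv ψ) x * (star z * xdot x w).im + 2 * rad (radDeriv k) x * ‖xdot x w‖ ^ 2
    + 2 * rad k x * ‖w‖ ^ 2
    + rad (radDeriv fun s => d * k s + deriv k s) x * (star z * xdot x w).re

section

variable {ψ k : ℝ → ℝ}

theorem continuous_commDens (hψ : IsCut ψ) (hk : IsCut k) :
    Continuous fun p : Space d × ℂ × EuclideanSpace ℂ (Fin d) => commDens ψ k p.1 p.2.1 p.2.2 := by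
  have h1 : Continuous fun p : Space d × ℂ × EuclideanSpace ℂ (Fin d) => rad (radDeriv ψ) p.1 :=
    hψ.radDeriv.continuous_rad.comp continuous_fst
  have h2 : Continuous fun p : Space d × ℂ × EuclideanSpace ℂ (Fin d) => rad k p.1 :=
    hk.continuous_rad.comp continuous_fst
  have h3 : Continuous fun p : Space d × ℂ × EuclideanSpace ℂ (Fin d) =>
      rad (radDeriv fun s => d * k s + deriv k s) p.1 :=
    (hk.div_profile d).radDeriv.continuous_rad.comp continuous_fst
  have h4 : Continuous fun p : Space d × ℂ × EuclideanSpace ℂ (Fin d) => rad (radDeriv k) p.1 :=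
    hk.radDeriv.continuous_rad.comp continuous_fst
  have h5 : Continuous fun p : Space d × ℂ × EuclideanSpace ℂ (Fin d) => xdot p.1 p.2.2 := by
    unfold xdot
    fun_prop
  have h6 : Continuous fun p : Space d × ℂ × EuclideanSpace ℂ (Fin d) =>
      star p.2.1 * xdot p.1 p.2.2 := (continuous_star.comp (by fun_prop)).mul h5
  unfold commDens
  have h7 := Complex.continuous_re.comp h6
  have h8 := Complex.continuous_im.comp h6
  simp only [Function.comp_def] at h7 h8
  fun_prop

theorem exists_abs_commDens_le (hψ : IsCut ψ) (hk : IsCut k) :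
    ∃ C : ℝ, 0 ≤ C ∧ ∀ (x : Space d) (z : ℂ) (w : EuclideanSpace ℂ (Fin d)),
      |commDens ψ k x z w| ≤ C * (‖z‖ ^ 2 + ‖w‖ ^ 2) := by
  obtain ⟨C₁, h1, b1⟩ := hψ.radDeriv.abs_rad_mul_norm_le (d := d)
  obtain ⟨C₂, h2, b2⟩ := hk.radDeriv.exists_abs_rad_mul_norm_sq_le (d := d)
  obtain ⟨C₃, h3, b3⟩ := hk.exists_bound
  obtain ⟨C₄, h4, b4⟩ := (hk.div_profile d).radDeriv.abs_rad_mul_norm_le (d := d)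
  refine ⟨2 * C₁ + 2 * C₂ + 2 * C₃ + C₄, by positivity, fun x z w => ?_⟩
  have hzw : ‖z‖ * ‖w‖ ≤ ‖z‖ ^ 2 + ‖w‖ ^ 2 := by nlinarith [sq_nonneg (‖z‖ - ‖w‖)]
  set S := ‖z‖ ^ 2 + ‖w‖ ^ 2 with hS
  have hn : ‖star z * xdot x w‖ ≤ ‖x‖ * (‖z‖ * ‖w‖) := by
    rw [norm_mul, norm_star]
    calc _ ≤ ‖z‖ * (‖x‖ * ‖w‖) := by gcongr; exact norm_xdot_le x w
      _ = _ := by ring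
  have t1 : |2 * rad (radDeriv ψ) x * (star z * xdot x w).im| ≤ 2 * C₁ * S := by
    rw [abs_mul, abs_mul, abs_two]
    calc _ ≤ 2 * |rad (radDeriv ψ) x| * (‖x‖ * (‖z‖ * ‖w‖)) := by
          gcongr
          exact (Complex.abs_im_le_norm _).trans hn
      _ = 2 * (|rad (radDeriv ψ) x| * ‖x‖) * (‖z‖ * ‖w‖) := by ring
      _ ≤ 2 * C₁ * S := by gcongr; exact b1 x
  have t2 : |2 * rad (radDeriv k) x * ‖xdot x w‖ ^ 2| ≤ 2 * C₂ * S := by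
    rw [abs_mul, abs_mul, abs_two, abs_of_nonneg (sq_nonneg ‖xdot x w‖)]
    calc _ ≤ 2 * |rad (radDeriv k) x| * (‖x‖ * ‖w‖) ^ 2 := by gcongr; exact norm_xdot_le x w
      _ = 2 * (|rad (radDeriv k) x| * ‖x‖ ^ 2) * ‖w‖ ^ 2 := by ring
      _ ≤ 2 * C₂ * S := by
          gcongr
          · exact b2 x
          · rw [hS]; nlinarith [sq_nonneg ‖z‖]
  have t3 : |2 * rad k x * ‖w‖ ^ 2| ≤ 2 * C₃ * S := by
    rw [abs_mul, abs_mul, abs_two, abs_of_nonneg (sq_nonneg ‖w‖)]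
    gcongr
    · exact IsCut.abs_rad_le h3.le b3 x
    · rw [hS]; nlinarith [sq_nonneg ‖z‖]
  have t4 : |rad (radDeriv fun s => d * k s + deriv k s) x * (star z * xdot x w).re| ≤ C₄ * S := by
    rw [abs_mul]
    calc _ ≤ |rad (radDeriv fun s => d * k s + deriv k s) x| * (‖x‖ * (‖z‖ * ‖w‖)) := by
          gcongr
          exact (Complex.abs_re_le_norm _).trans hn
      _ = (|rad (radDeriv fun s => d * k s + deriv k s) x| * ‖x‖) * (‖z‖ * ‖w‖) := by ring
      _ ≤ C₄ * S := by gcongr; exact b4 x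
  unfold commDens
  calc _ ≤ 2 * C₁ * S + 2 * C₂ * S + 2 * C₃ * S + C₄ * S := by
        refine (abs_add_le _ _).trans (add_le_add ((abs_add_le _ _).trans (add_le_add
          ((abs_add_le _ _).trans (add_le_add t1 t2)) t3)) t4)
    _ = _ := by ring

variable {v : Space d → ℂ} {w : Space d → EuclideanSpace ℂ (Fin d)}

/-- `xdot` in its second argument, as a continuous linear map. -/
def xdotL (x : Space d) : EuclideanSpace ℂ (Fin d) →L[ℝ] ℂ :=
  ∑ j : Fin d, (x j) • (EuclideanSpace.proj j : EuclideanSpace ℂ (Fin d) →L[ℂ] ℂ).restrictScalars ℝ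

theorem xdotL_apply (x : Space d) (y : EuclideanSpace ℂ (Fin d)) : xdotL x y = xdot x y := by
  simp [xdotL, xdot]

/-- `xdot` in its first argument, as a continuous linear map. -/
def xdotR (y : EuclideanSpace ℂ (Fin d)) : Space d →L[ℝ] ℂ :=
  ∑ j : Fin d, (EuclideanSpace.proj (𝕜 := ℝ) j).smulRight (y j)

theorem xdotR_apply (x : Space d) (y : EuclideanSpace ℂ (Fin d)) : xdotR y x = xdot x y := by
  simp [xdotR, xdot]

/-- Symmetry of the second derivative. -/
theorem SmoothPair.xdot_fderiv_symm (h : SmoothPair v w) (x y z : Space d) :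
    xdot y (fderiv ℝ w x z) = xdot z (fderiv ℝ w x y) := by
  have hs : IsSymmSndFDerivAt ℝ v x :=
    h.left.contDiffAt.isSymmSndFDerivAt
      (by simpa using WithTop.coe_le_coe.2 (le_top (a := (2 : ℕ∞))))
  have key : ∀ y z, fderiv ℝ (fderiv ℝ v) x z y = xdot y (fderiv ℝ w x z) := by
    intro y z
    have h1 : DifferentiableAt ℝ (fderiv ℝ v) x :=
      (h.left.fderiv_right (m := ∞) (by simp)).differentiable (by simp) x
    have h2 : HasFDerivAt (fun x' => fderiv ℝ v x' y) _ x :=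
      h1.hasFDerivAt.clm_apply (hasFDerivAt_const y x)
    have h3 : (fun x' => fderiv ℝ v x' y) = fun x' => xdotL y (w x') := by
      ext x'
      rw [h.fderiv_apply, xdotL_apply]
    have h4 : HasFDerivAt (fun x' => xdotL y (w x')) _ x := (xdotL y).hasFDerivAt.comp x
      (h.right.differentiable (by simp) x).hasFDerivAt
    rw [h3] at h2
    have := congrArg (fun L => L z) (h2.unique h4)
    simpa [xdotL_apply] using this
  rw [← key, ← key]
  exact hs z y

theorem SmoothPair.hasFDerivAt_xdot (h : SmoothPair v w) (x : Space d) :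
    HasFDerivAt (fun x => xdot x (w x)) (xdotR (w x) + (xdotL x).comp (fderiv ℝ w x)) x := by
  have hw := (h.right.differentiable (by simp) x).hasFDerivAt
  have hj : ∀ j : Fin d, HasFDerivAt (fun x : Space d => x j • w x j) _ x := fun j =>
    (EuclideanSpace.proj (𝕜 := ℝ) j).hasFDerivAt.smul
      (((EuclideanSpace.proj j : EuclideanSpace ℂ (Fin d) →L[ℂ] ℂ).restrictScalars
        ℝ).hasFDerivAt.comp x hw)
  have hs := HasFDerivAt.fun_sum (u := Finset.univ) fun j _ => hj j
  refine (hs.congr_fderiv ?_).congr_of_eventuallyEq (Eventually.of_forall fun y => ?_)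
  · ext y
    simp [xdotR, xdotL, Finset.sum_add_distrib, add_comm]
  · simp [xdot]

theorem IsCut.hasFDerivAt_rad_smul (hk : IsCut k) {F : Space d → ℂ} {F' : Space d →L[ℝ] ℂ}
    {x : Space d} (hF : HasFDerivAt F F' x) :
    HasFDerivAt (fun x => (rad k x : ℂ) * F x)
      (rad k x • F' + (rad (INLS.radDeriv k) x • innerSL ℝ x).smulRight (F x)) x := by
  have := (hk.hasFDerivAt_rad x).smul hF
  exact this

theorem SmoothPair.fderiv_act (hψ : IsCut ψ) (hk : IsCut k) (h : SmoothPair v w) (x : Space d)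
    (j : Fin d) :
    fderiv ℝ (fun x => act ψ k x (v x) (w x)) x (EuclideanSpace.single j 1)
      = rad ψ x * w x j + rad (radDeriv ψ) x * x j * v x
        - Complex.I * (rad k x * (w x j + fderiv ℝ w x x j)
          + rad (radDeriv k) x * x j * xdot x (w x)
          + 1 / 2 * (rad (fun s => d * k s + deriv k s) x * w x j
            + rad (radDeriv fun s => d * k s + deriv k s) x * x j * v x)) := by
  have hv := (h.left.differentiable (by simp) x).hasFDerivAt
  have h1 := hψ.hasFDerivAt_rad_smul hv
  have h2 := hk.hasFDerivAt_rad_smul (h.hasFDerivAt_xdot x)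
  have h3 := (hk.div_profile d).hasFDerivAt_rad_smul hv
  have h4 : HasFDerivAt (fun x => act ψ k x (v x) (w x)) _ x :=
    ((h1.sub ((h2.add (h3.const_mul (1 / 2 : ℂ))).const_mul Complex.I))).congr_of_eventuallyEq
      (Eventually.of_forall fun y => by simp only [act, Pi.add_apply, Pi.sub_apply]; ring)
  rw [h4.fderiv]
  -- Symmetry of the Hessian turns `∂_j (x·w)` into `w_j + x·∇w_j`, so second derivatives enter only
  -- along the radial direction.
  have hsym := h.xdot_fderiv_symm x x (EuclideanSpace.single j 1)
  rw [xdot_single] at hsym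
  have hin : inner ℝ x (EuclideanSpace.single j (1 : ℝ)) = x j := by
    rw [EuclideanSpace.inner_single_right]; simp
  simp [h.fderiv_apply, xdotR_apply, xdotL_apply, xdot_single, hsym, hin, -one_div]
  ring

theorem SmoothPair.hasFDerivAt_norm_sq (h : SmoothPair v w) (x : Space d) :
    fderiv ℝ (fun x => ‖w x‖ ^ 2) x x = 2 * (∑ j, star (fderiv ℝ w x x j) * w x j).re := by
  have hw := (h.right.differentiable (by simp) x).hasFDerivAt
  have hj : ∀ j : Fin d, HasFDerivAt (fun x : Space d => ‖w x j‖ ^ 2) _ x := fun j =>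
    (((EuclideanSpace.proj j : EuclideanSpace ℂ (Fin d) →L[ℂ] ℂ).restrictScalars
        ℝ).hasFDerivAt.comp x hw).norm_sq
  have hs := HasFDerivAt.fun_sum (u := Finset.univ) fun j _ => hj j
  have he : (fun x => ‖w x‖ ^ 2) = fun x => ∑ j, ‖w x j‖ ^ 2 := by
    ext y
    rw [EuclideanSpace.norm_sq_eq]
  rw [he, hs.fderiv]
  simp [Finset.mul_sum, Complex.inner, mul_comm]
  exact Finset.sum_congr rfl fun _ _ => by ring

/-- The second derivatives combine to `rad k x·∇‖w‖²`; adding `(d k + k')‖w‖²` makes an exact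
divergence, and what is left is of first order. -/
theorem SmoothPair.two_mul_re_sum (hψ : IsCut ψ) (hk : IsCut k) (h : SmoothPair v w) (x : Space d) :
    2 * (Complex.I * -∑ j, fderiv ℝ (fun x => star (act ψ k x (v x) (w x))) x
        (EuclideanSpace.single j 1) * w x j).re
      = commDens ψ k x (v x) (w x) + (rad k x * fderiv ℝ (fun x => ‖w x‖ ^ 2) x x
        + rad (fun s => d * k s + deriv k s) x * ‖w x‖ ^ 2) := by
  have hst : ∀ y, fderiv ℝ (fun x => star (act ψ k x (v x) (w x))) x y
      = star (fderiv ℝ (fun x => act ψ k x (v x) (w x)) x y) := fun y => by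
    have h1 := ((starL' ℝ (A := ℂ)).toContinuousLinearMap.hasFDerivAt.comp x
      ((h.contDiff_act hψ hk).differentiable (by simp) x).hasFDerivAt).fderiv
    exact congrArg (fun L => L y) h1
  rw [h.hasFDerivAt_norm_sq]
  set Z := ∑ j, star (fderiv ℝ w x x j) * w x j with hZ
  set D := xdot x (w x) with hD
  have hsq : ((‖w x‖ ^ 2 : ℝ) : ℂ) = ∑ j, star (w x j) * w x j := by
    rw [EuclideanSpace.norm_sq_eq]
    push_cast
    refine Finset.sum_congr rfl fun j _ => ?_
    rw [mul_comm]
    exact (Complex.mul_conj' (w x j)).symm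
  have hsum : ∑ j, fderiv ℝ (fun x => star (act ψ k x (v x) (w x))) x
        (EuclideanSpace.single j 1) * w x j
      = rad ψ x * (‖w x‖ ^ 2 : ℝ) + rad (radDeriv ψ) x * (star (v x) * D)
        + Complex.I * (rad k x * ((‖w x‖ ^ 2 : ℝ) + Z) + rad (radDeriv k) x * (star D * D)
          + 1 / 2 * (rad (fun s => d * k s + deriv k s) x * (‖w x‖ ^ 2 : ℝ)
            + rad (radDeriv fun s => d * k s + deriv k s) x * (star (v x) * D))) := by
    have hDs : D = ∑ j, (x j : ℂ) * w x j := rfl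
    rw [hsq, hZ]
    have e : ∀ j, fderiv ℝ (fun x => star (act ψ k x (v x) (w x))) x
        (EuclideanSpace.single j 1) * w x j
        = (rad ψ x : ℂ) * (star (w x j) * w x j)
          + rad (radDeriv ψ) x * (star (v x) * (x j * w x j))
          + Complex.I * (rad k x * (star (w x j) * w x j + star (fderiv ℝ w x x j) * w x j)
            + rad (radDeriv k) x * (star D * (x j * w x j))
          + 1 / 2 * (rad (fun s => d * k s + deriv k s) x * (star (w x j) * w x j)
            + rad (radDeriv fun s => d * k s + deriv k s) x * (star (v x) * (x j * w x j)))) := by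
      intro j
      rw [hst, h.fderiv_act hψ hk]
      simp
      ring
    simp only [e, Finset.sum_add_distrib, ← Finset.mul_sum]
    rw [← hDs]
  have hDD : star D * D = ((‖D‖ ^ 2 : ℝ) : ℂ) := by
    rw [mul_comm]
    push_cast
    exact Complex.mul_conj' D
  rw [hsum, hDD, commDens]
  simp only [Complex.mul_re, Complex.mul_im, Complex.neg_re, Complex.neg_im, Complex.add_re,
    Complex.add_im, Complex.I_re, Complex.I_im, Complex.ofReal_re, Complex.ofReal_im]
  norm_num
  ring

/-- After the divergence has been integrated away, the right side depends on `v` and its gradient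
only, and hence passes to the limit in `H¹`. -/
theorem SmoothPair.two_mul_re_sum_integral (hψ : IsCut ψ) (hk : IsCut k) (h : SmoothPair v w) :
    2 * (Complex.I * -∑ j, ∫ x, fderiv ℝ (fun x => star (act ψ k x (v x) (w x))) x
        (EuclideanSpace.single j 1) * w x j).re = ∫ x, commDens ψ k x (v x) (w x) := by
  obtain ⟨m₁, -, hm₁⟩ := hψ.exists_zero
  obtain ⟨m₂, -, hm₂⟩ := hk.exists_zero
  have ht := h.testOn_act hψ hk (m := max m₁ m₂)
      (fun s hs => hm₁ s ((le_max_left _ _).trans_lt hs))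
      (fun s hs => hm₂ s ((le_max_right _ _).trans_lt hs))
  have hj : ∀ j : Fin d, Integrable (fun x => fderiv ℝ (fun x => star (act ψ k x (v x) (w x))) x
        (EuclideanSpace.single j 1) * w x j) volume := fun j => by
    refine ((ht.continuous_fderiv.clm_apply continuous_const).mul
      ((EuclideanSpace.proj j : EuclideanSpace ℂ (Fin d) →L[ℂ] ℂ).continuous.comp
        h.right.continuous)).integrable_of_hasCompactSupport ?_
    exact HasCompactSupport.mul_right ((ht.hasCompactSupport.fderiv ℝ).comp_left
      (g := fun L : Space d →L[ℝ] ℂ => L (EuclideanSpace.single j 1)) rfl)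
  have hS : Integrable (fun x => -∑ j, fderiv ℝ (fun x => star (act ψ k x (v x) (w x))) x
        (EuclideanSpace.single j 1) * w x j) volume := (integrable_finsetSum _ fun j _ => hj j).neg
  have hS2 := (hS.const_mul Complex.I).re.const_mul 2
  simp only [RCLike.re_to_complex] at hS2
  have hG : ContDiff ℝ 1 fun x => ‖w x‖ ^ 2 := (h.right.norm_sq ℂ).of_le (by simp)
  have c1 : Integrable (fun x => rad k x * fderiv ℝ (fun x => ‖w x‖ ^ 2) x x) volume :=
    (hk.continuous_rad.mul ((hG.continuous_fderiv (by simp)).clm_apply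
      continuous_id)).integrable_of_hasCompactSupport hk.hasCompactSupport_rad.mul_right
  have c2 : Integrable (fun x => rad (fun s => d * k s + deriv k s) x * ‖w x‖ ^ 2) volume :=
    ((hk.div_profile d).continuous_rad.mul hG.continuous).integrable_of_hasCompactSupport
      (hk.div_profile d).hasCompactSupport_rad.mul_right
  have key := integral_rad_mul_fderiv hk hG
  have e1 : ∀ x, commDens ψ k x (v x) (w x) = 2 * (Complex.I * -∑ j, fderiv ℝ
      (fun x => star (act ψ k x (v x) (w x))) x (EuclideanSpace.single j 1) * w x j).re
      - (rad k x * fderiv ℝ (fun x => ‖w x‖ ^ 2) x x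
        + rad (fun s => d * k s + deriv k s) x * ‖w x‖ ^ 2) := fun x => by
    rw [h.two_mul_re_sum hψ hk]
    ring
  have c3 : Integrable (fun x => rad k x * fderiv ℝ (fun x => ‖w x‖ ^ 2) x x
      + rad (fun s => d * k s + deriv k s) x * ‖w x‖ ^ 2) volume := c1.add c2
  simp only [e1]
  rw [integral_sub hS2 c3, integral_add c1 c2, key, neg_add_cancel, sub_zero,
    integral_const_mul]
  have e2 := integral_re (hS.const_mul Complex.I)
  simp only [RCLike.re_to_complex] at e2
  rw [e2, integral_const_mul, integral_neg, integral_finsetSum _ fun j _ => hj j]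

end

end INLS
end

/-! ### Removing the mollification at a fixed time. -/

noncomputable section
namespace INLS

variable {d : ℕ}

theorem lintegral_enorm_mul_le {F H : Space d → ℂ} (hF : AEStronglyMeasurable F volume)
    (hH : AEStronglyMeasurable H volume) :
    ∫⁻ x, ‖F x‖ₑ * ‖H x‖ₑ ≤ eLpNorm F 2 volume * eLpNorm H 2 volume := by
  have h := eLpNorm_smul_le_mul_eLpNorm (p := 2) (q := 2) (r := 1) hH hF
  rw [eLpNorm_one_eq_lintegral_enorm] at h
  refine le_trans (le_of_eq ?_) h
  exact lintegral_congr fun x => by simp [enorm_mul]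

theorem tendsto_integral_mul_of_eLpNorm {F H : Space d → ℂ} {Fn Hn : ℕ → Space d → ℂ}
    (hF : MemLp F 2 volume) (hH : MemLp H 2 volume) (hFn : ∀ n, MemLp (Fn n) 2 volume)
    (hHn : ∀ n, MemLp (Hn n) 2 volume)
    (h1 : Tendsto (fun n => eLpNorm (Fn n - F) 2 volume) atTop (𝓝 0))
    (h2 : Tendsto (fun n => eLpNorm (Hn n - H) 2 volume) atTop (𝓝 0)) :
    Tendsto (fun n => ∫ x, Fn n x * Hn n x) atTop (𝓝 (∫ x, F x * H x)) := by
  refine tendsto_integral_of_L1 _ (hF.integrable_mul hH).1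
    (Eventually.of_forall fun n => (hFn n).integrable_mul (hHn n)) ?_
  have hlim : Tendsto (fun n => eLpNorm (Fn n - F) 2 volume * eLpNorm (Hn n - H) 2 volume
      + eLpNorm (Fn n - F) 2 volume * eLpNorm H 2 volume
      + eLpNorm F 2 volume * eLpNorm (Hn n - H) 2 volume) atTop (𝓝 0) := by
    have t1 := ENNReal.Tendsto.mul h1 (Or.inr ENNReal.zero_ne_top) h2 (Or.inr ENNReal.zero_ne_top)
    have t2 := ENNReal.Tendsto.mul_const h1 (b := eLpNorm H 2 volume) (Or.inr hH.2.ne)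
    have t3 := ENNReal.Tendsto.const_mul h2 (a := eLpNorm F 2 volume) (Or.inr hF.2.ne)
    simpa using (t1.add t2).add t3
  refine tendsto_of_tendsto_of_tendsto_of_le_of_le tendsto_const_nhds hlim (fun _ => zero_le)
    fun n => ?_
  have a1 := ((hFn n).sub hF).1
  have a2 := ((hHn n).sub hH).1
  calc ∫⁻ x, ‖Fn n x * Hn n x - F x * H x‖ₑ
      ≤ ∫⁻ x, (‖(Fn n - F) x‖ₑ * ‖(Hn n - H) x‖ₑ + ‖(Fn n - F) x‖ₑ * ‖H x‖ₑ
        + ‖F x‖ₑ * ‖(Hn n - H) x‖ₑ) := by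
        refine lintegral_mono fun x => ?_
        have e : Fn n x * Hn n x - F x * H x = (Fn n - F) x * (Hn n - H) x + (Fn n - F) x * H x
            + F x * (Hn n - H) x := by
          simp only [Pi.sub_apply]; ring
        rw [e]
        refine (enorm_add_le _ _).trans (add_le_add ((enorm_add_le _ _).trans ?_) ?_)
        · rw [enorm_mul, enorm_mul]
        · rw [enorm_mul]
    _ = (∫⁻ x, ‖(Fn n - F) x‖ₑ * ‖(Hn n - H) x‖ₑ) + (∫⁻ x, ‖(Fn n - F) x‖ₑ * ‖H x‖ₑ)
        + ∫⁻ x, ‖F x‖ₑ * ‖(Hn n - H) x‖ₑ := by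
        have m1 : AEMeasurable (fun x => ‖(Fn n - F) x‖ₑ * ‖(Hn n - H) x‖ₑ) volume :=
          a1.enorm.mul a2.enorm
        have m2 : AEMeasurable (fun x => ‖(Fn n - F) x‖ₑ * ‖(Hn n - H) x‖ₑ
            + ‖(Fn n - F) x‖ₑ * ‖H x‖ₑ) volume := m1.add (a1.enorm.mul hH.1.enorm)
        rw [lintegral_add_left' m2, lintegral_add_left' m1]
    _ ≤ _ := add_le_add (add_le_add (lintegral_enorm_mul_le a1 a2)
        (lintegral_enorm_mul_le a1 hH.1)) (lintegral_enorm_mul_le hF.1 a2)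

theorem integral_norm_sq_mol_le {F : Type*} [NormedAddCommGroup F] [NormedSpace ℝ F]
    [CompleteSpace F] (n : ℕ) {f : Space d → F} (hf : MemLp f 2 volume) :
    ∫ x, ‖mol n f x‖ ^ 2 ≤ ∫ x, ‖f x‖ ^ 2 := by
  have h0 : 0 ≤ ∫ x, ‖f x‖ ^ 2 := integral_nonneg fun x => by positivity
  rw [← ENNReal.ofReal_le_ofReal_iff h0, ofReal_integral_norm_sq hf,
    ofReal_integral_norm_sq (memLp_mol n hf)]
  exact pow_le_pow_left' (eLpNorm_two_mol_le n hf.1) 2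

/-- The potential terms of the equation. -/
def potVal (c b σ : ℝ) (x : Space d) (z : ℂ) : ℂ :=
  -(c : ℂ) * (‖x‖ ^ (-2 : ℝ) • z) + (‖x‖ ^ (-b) * ‖z‖ ^ σ) • z

/-- The potential terms of the equation, cut off to an annulus. -/
def cutPot (c b σ m : ℝ) (f : Space d → ℂ) : Space d → ℂ :=
  (annulus d m).indicator fun x => potVal c b σ x (f x)

section

variable {c b σ m : ℝ} {f : Space d → ℂ} {g : Space d → EuclideanSpace ℂ (Fin d)} {ψ k : ℝ → ℝ}

theorem aestronglyMeasurable_cutPot (hf : AEStronglyMeasurable f volume) :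
    AEStronglyMeasurable (cutPot c b σ m f) volume :=
  (((aestronglyMeasurable_hardyVal hf).const_mul (-(c : ℂ))).add
    (aestronglyMeasurable_nonlinVal hf)).indicator (measurableSet_annulus m)

/-- On an annulus the weights are bounded, so square integrability of the potential terms reduces to
that of `‖f‖^(σ+1)`, the quantity which the Strichartz condition controls for almost every time. -/
theorem exists_norm_cutPot_sq_le (hA : IsAdmissible d b σ) (c m : ℝ) :
    ∃ C : ℝ, 0 ≤ C ∧ ∀ (f : Space d → ℂ) (x : Space d), ‖cutPot c b σ m f x‖ ^ 2
      ≤ C * ‖f x‖ ^ 2 + C * (annulus d m).indicator (fun x => ‖f x‖ ^ (2 * (σ + 1))) x := by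
  set E := Real.exp (2 * |m|) with hE
  have hw : ∀ x ∈ annulus d m, ∀ a : ℝ, 0 ≤ a → a ≤ 2 → ‖x‖ ^ (-a) ≤ E := by
    intro x hx a ha ha2
    have hx0 := ne_zero_of_mem_annulus hx
    have hl := (mem_annulus_iff hx0).1 hx
    rw [← norm_sq_mul_exp hx0, hE]
    apply Real.exp_le_exp.2
    have h1 := abs_le.1 hl
    have h2 := le_abs_self m
    have h3 : -(a * Real.log ‖x‖) ≤ a * |m| := by nlinarith
    nlinarith [abs_nonneg m]
  refine ⟨2 * c ^ 2 * E ^ 2 + 2 * E ^ 2, by positivity, fun f x => ?_⟩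
  by_cases hx : x ∈ annulus d m
  · rw [cutPot, Set.indicator_of_mem hx, Set.indicator_of_mem hx]
    have h1 : ‖potVal c b σ x (f x)‖ ≤ |c| * (E * ‖f x‖) + E * ‖f x‖ ^ (σ + 1) := by
      refine (norm_add_le _ _).trans (add_le_add ?_ ?_)
      · rw [norm_mul, norm_neg, Complex.norm_real, Real.norm_eq_abs, norm_smul, Real.norm_eq_abs,
          abs_of_nonneg (Real.rpow_nonneg (norm_nonneg x) _)]
        have := hw x hx 2 (by norm_num) le_rfl
        exact mul_le_mul_of_nonneg_left (mul_le_mul_of_nonneg_right this (norm_nonneg _))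
          (abs_nonneg c)
      · rw [norm_nonlinVal b σ hA.σ_pos]
        gcongr
        exact hw x hx b hA.b_pos.le hA.b_lt.le
    have h2 : ‖f x‖ ^ (2 * (σ + 1)) = (‖f x‖ ^ (σ + 1)) ^ 2 := by
      rw [← Real.rpow_natCast, ← Real.rpow_mul (norm_nonneg _)]
      congr 1
      push_cast
      ring
    rw [h2]
    calc _ ≤ (|c| * (E * ‖f x‖) + E * ‖f x‖ ^ (σ + 1)) ^ 2 := by gcongr
      _ ≤ 2 * (|c| * (E * ‖f x‖)) ^ 2 + 2 * (E * ‖f x‖ ^ (σ + 1)) ^ 2 := by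
          nlinarith [sq_nonneg (|c| * (E * ‖f x‖) - E * ‖f x‖ ^ (σ + 1))]
      _ = 2 * c ^ 2 * E ^ 2 * ‖f x‖ ^ 2 + 2 * E ^ 2 * (‖f x‖ ^ (σ + 1)) ^ 2 := by
          rw [mul_pow, mul_pow, mul_pow, sq_abs]; ring
      _ ≤ _ := by
          nlinarith [mul_nonneg (sq_nonneg E) (sq_nonneg ‖f x‖),
            mul_nonneg (sq_nonneg (c * E)) (sq_nonneg (‖f x‖ ^ (σ + 1)))]
  · rw [cutPot, Set.indicator_of_notMem hx, Set.indicator_of_notMem hx]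
    simp only [norm_zero, ne_eq, OfNat.ofNat_ne_zero, not_false_eq_true, zero_pow, mul_zero,
      add_zero]
    positivity

/-- The mollifier is moved from the test function onto the gradient and the potential terms. The
latter are cut off to the larger annulus, where the mollified test function lives, and must be in
`L²` for this to be legitimate. -/
theorem pairing_mol_eq (hA : IsAdmissible d b σ) (h : IsPair f g) {Φ : Space d → ℂ}
    (hΦ : TestOn m Φ) {n : ℕ} (hn : TestOn (m + 1) (mol n Φ))
    (hL : MemLp (cutPot c b σ (m + 1) f) 2 volume) :
    pairing c b σ f g (mol n Φ)
      = -(∑ j : Fin d, ∫ x, fderiv ℝ Φ x (EuclideanSpace.single j 1) * mol n g x j)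
        + ∫ x, Φ x * mol n (cutPot c b σ (m + 1) f) x := by
  obtain ⟨-, h2, -, h3⟩ := h.integrableOn_annulus hA (m + 1)
  have i2 := integrable_mul_of_annulus hn.contDiff.continuous hn.zero h2
  have i3 := integrable_mul_of_annulus hn.contDiff.continuous hn.zero h3
  have e1 : ∫ x, Φ x * mol n (cutPot c b σ (m + 1) f) x
      = -c * (∫ x, mol n Φ x * (‖x‖ ^ (-2 : ℝ) • f x))
        + ∫ x, mol n Φ x * ((‖x‖ ^ (-b) * ‖f x‖ ^ σ) • f x) := by
    rw [← integral_mol_mul hΦ.memLp_two hL, ← integral_const_mul, ← integral_add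
      (i2.const_mul _) i3]
    refine integral_congr_ae (Eventually.of_forall fun x => ?_)
    by_cases hx : x ∈ annulus d (m + 1)
    · simp only [cutPot, Set.indicator_of_mem hx, potVal]
      ring
    · simp only [hn.zero x hx]
      ring
  have e2 : ∀ j : Fin d, ∫ x, fderiv ℝ (mol n Φ) x (EuclideanSpace.single j 1) * g x j
      = ∫ x, fderiv ℝ Φ x (EuclideanSpace.single j 1) * mol n g x j := by
    intro j
    have hm : MemLp (fun x => fderiv ℝ Φ x (EuclideanSpace.single j 1)) 2 volume := by
      refine (hΦ.continuous_fderiv.clm_apply continuous_const).memLp_of_hasCompactSupport ?_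
      exact (hΦ.hasCompactSupport.fderiv ℝ).comp_left
        (g := fun L : Space d →L[ℝ] ℂ => L (EuclideanSpace.single j 1)) rfl
    simp only [fderiv_mol_of_smooth n (hΦ.contDiff.of_le (by simp)) hΦ.hasCompactSupport]
    rw [integral_mol_mul hm (memLp_eval h.right j)]
    simp only [mol_eval h.weak.2.1]
  rw [pairing_eq hA h hn, e1]
  simp only [e2]
  ring

theorem two_mul_re_pairing_mol (hA : IsAdmissible d b σ) (h : IsPair f g) (hψ : IsCut ψ)
    (hk : IsCut k) (hmψ : ∀ s, m < |s| → ψ s = 0) (hmk : ∀ s, m < |s| → k s = 0) {n : ℕ}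
    (hn : ∀ Φ : Space d → ℂ, TestOn m Φ → TestOn (m + 1) (mol n Φ))
    (hL : MemLp (cutPot c b σ (m + 1) f) 2 volume) :
    2 * (Complex.I * pairing c b σ f g
        (mol n fun x => star (act ψ k x (mol n f x) (mol n g x)))).re
      = (∫ x, commDens ψ k x (mol n f x) (mol n g x))
        + 2 * (Complex.I * ∫ x, star (act ψ k x (mol n f x) (mol n g x))
          * mol n (cutPot c b σ (m + 1) f) x).re := by
  have ht := (h.smoothPair_mol n).testOn_act hψ hk hmψ hmk
  rw [pairing_mol_eq hA h ht (hn _ ht) hL, mul_add, Complex.add_re, mul_add,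
    (h.smoothPair_mol n).two_mul_re_sum_integral hψ hk]

theorem memLp_act (hψ : IsCut ψ) (hk : IsCut k) (hf : MemLp f 2 volume) (hg : MemLp g 2 volume) :
    MemLp (fun x => star (act ψ k x (f x) (g x))) 2 volume := by
  obtain ⟨C, hC⟩ := exists_eLpNorm_act_le (d := d) hψ hk
  have h1 : MemLp (fun x => act ψ k x (f x) (g x)) 2 volume :=
    ⟨aestronglyMeasurable_act hψ hk hf.1 hg.1, (hC f g hf.1 hg.1).trans_lt
      (ENNReal.mul_lt_top ENNReal.coe_lt_top (ENNReal.add_lt_top.2 ⟨hf.2, hg.2⟩))⟩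
  exact h1.star

theorem tendsto_act_mol (hψ : IsCut ψ) (hk : IsCut k) (hf : MemLp f 2 volume)
    (hg : MemLp g 2 volume) :
    Tendsto (fun n => eLpNorm ((fun x => star (act ψ k x (mol n f x) (mol n g x)))
      - fun x => star (act ψ k x (f x) (g x))) 2 volume) atTop (𝓝 0) := by
  obtain ⟨C, hC⟩ := exists_eLpNorm_act_le (d := d) hψ hk
  have h1 := ENNReal.Tendsto.const_mul ((tendsto_eLpNorm_mol_sub hf).add (tendsto_eLpNorm_mol_sub hg))
    (a := C) (Or.inr ENNReal.coe_ne_top)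
  rw [add_zero, mul_zero] at h1
  refine tendsto_of_tendsto_of_tendsto_of_le_of_le tendsto_const_nhds h1 (fun _ => zero_le)
    fun n => ?_
  refine le_trans (le_of_eq ?_) (hC _ _ ((memLp_mol n hf).sub hf).1 ((memLp_mol n hg).sub hg).1)
  refine eLpNorm_congr_norm_ae (Eventually.of_forall fun x => ?_)
  simp only [Pi.sub_apply]
  rw [← star_sub, norm_star, act_sub]

/-- The commutator density is quadratic in `(f, g)`, and the potential term is an `L²` pairing of
two strongly convergent sequences. -/
theorem tendsto_two_mul_re_pairing_mol (hA : IsAdmissible d b σ) (h : IsPair f g) (hψ : IsCut ψ)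
    (hk : IsCut k) (hmψ : ∀ s, m < |s| → ψ s = 0) (hmk : ∀ s, m < |s| → k s = 0)
    (hL : MemLp (cutPot c b σ (m + 1) f) 2 volume) :
    Tendsto (fun n => 2 * (Complex.I * pairing c b σ f g
        (mol n fun x => star (act ψ k x (mol n f x) (mol n g x)))).re) atTop
      (𝓝 ((∫ x, commDens ψ k x (f x) (g x))
        + 2 * (Complex.I * ∫ x, star (act ψ k x (f x) (g x)) * cutPot c b σ (m + 1) f x).re)) := by
  obtain ⟨N, hN⟩ := exists_testOn_mol d m
  obtain ⟨C, hC, hCb⟩ := exists_abs_commDens_le (d := d) hψ hk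
  have t1 := tendsto_integral_mol h.left h.right (Φ := commDens ψ k)
    (continuous_commDens hψ hk).measurable
    (fun x => (continuous_commDens hψ hk).comp (by fun_prop : Continuous
      fun p : ℂ × EuclideanSpace ℂ (Fin d) => (x, p.1, p.2))) hC hCb
  have t2 := tendsto_integral_mul_of_eLpNorm (memLp_act hψ hk h.left h.right) hL
    (fun n => memLp_act hψ hk (memLp_mol n h.left) (memLp_mol n h.right))
    (fun n => memLp_mol n hL) (tendsto_act_mol hψ hk h.left h.right) (tendsto_eLpNorm_mol_sub hL)
  have t3 := (((Complex.continuous_re.comp (continuous_const.mul continuous_id)).tendsto _).comp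
    t2 : Tendsto (fun n => (Complex.I * ∫ x, star (act ψ k x (mol n f x) (mol n g x))
          * mol n (cutPot c b σ (m + 1) f) x).re) atTop _)
  refine (t1.add (t3.const_mul 2)).congr' ?_
  filter_upwards [eventually_ge_atTop N] with n hn
  exact (two_mul_re_pairing_mol hA h hψ hk hmψ hmk (hN n hn) hL).symm

/-- A bound uniform in `n`, which becomes the dominating function in time: mollification does not
increase `L²` norms. -/
theorem exists_two_mul_re_pairing_mol_le (hA : IsAdmissible d b σ) (c : ℝ) (hψ : IsCut ψ)
    (hk : IsCut k) (hmψ : ∀ s, m < |s| → ψ s = 0) (hmk : ∀ s, m < |s| → k s = 0) :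
    ∃ C : ℝ, 0 ≤ C ∧ ∀ n, (∀ Φ : Space d → ℂ, TestOn m Φ → TestOn (m + 1) (mol n Φ)) →
      ∀ (f : Space d → ℂ) (g : Space d → EuclideanSpace ℂ (Fin d)), IsPair f g →
      MemLp (cutPot c b σ (m + 1) f) 2 volume →
      |2 * (Complex.I * pairing c b σ f g
        (mol n fun x => star (act ψ k x (mol n f x) (mol n g x)))).re|
        ≤ C * ((∫ x, ‖f x‖ ^ 2) + ∫ x, ‖g x‖ ^ 2) + ∫ x, ‖cutPot c b σ (m + 1) f x‖ ^ 2 := by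
  obtain ⟨C, hC, hCb⟩ := exists_abs_commDens_le (d := d) hψ hk
  obtain ⟨C', hC', hCb'⟩ := exists_norm_act_le (d := d) hψ hk
  refine ⟨C + 2 * C' ^ 2, by positivity, fun n hn f g h hL => ?_⟩
  rw [two_mul_re_pairing_mol hA h hψ hk hmψ hmk hn hL]
  have mf := memLp_mol n h.left
  have mg := memLp_mol n h.right
  have mL := memLp_mol n hL
  have if2 := integrable_norm_sq_of_memLp mf
  have ig2 := integrable_norm_sq_of_memLp mg
  have iL2 := integrable_norm_sq_of_memLp mL
  have hi : Integrable (fun x => ‖mol n f x‖ ^ 2 + ‖mol n g x‖ ^ 2) volume := if2.add ig2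
  have lf := integral_norm_sq_mol_le n h.left
  have lg := integral_norm_sq_mol_le n h.right
  have lL := integral_norm_sq_mol_le n hL
  have t1 : |∫ x, commDens ψ k x (mol n f x) (mol n g x)|
      ≤ C * ((∫ x, ‖f x‖ ^ 2) + ∫ x, ‖g x‖ ^ 2) := by
    have := norm_integral_le_of_norm_le (f := fun x => commDens ψ k x (mol n f x) (mol n g x))
      (hi.const_mul C)
      (Eventually.of_forall fun x => hCb x (mol n f x) (mol n g x))
    rw [integral_const_mul, integral_add if2 ig2] at this
    exact this.trans (by gcongr)
  have t2 : |2 * (Complex.I * ∫ x, star (act ψ k x (mol n f x) (mol n g x))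
          * mol n (cutPot c b σ (m + 1) f) x).re|
      ≤ 2 * C' ^ 2 * ((∫ x, ‖f x‖ ^ 2) + ∫ x, ‖g x‖ ^ 2)
        + ∫ x, ‖cutPot c b σ (m + 1) f x‖ ^ 2 := by
    have hi2 : Integrable (fun x => C' ^ 2 * (‖mol n f x‖ ^ 2 + ‖mol n g x‖ ^ 2)
        + 1 / 2 * ‖mol n (cutPot c b σ (m + 1) f) x‖ ^ 2) volume :=
      (hi.const_mul _).add (iL2.const_mul _)
    have := norm_integral_le_of_norm_le (f := fun x => star (act ψ k x (mol n f x) (mol n g x))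
          * mol n (cutPot c b σ (m + 1) f) x) hi2 (Eventually.of_forall fun x => by
      rw [norm_mul, norm_star]
      have h1 := hCb' x (mol n f x) (mol n g x)
      have h2 : ‖act ψ k x (mol n f x) (mol n g x)‖ ^ 2
          ≤ 2 * C' ^ 2 * (‖mol n f x‖ ^ 2 + ‖mol n g x‖ ^ 2) := by
        calc _ ≤ (C' * (‖mol n f x‖ + ‖mol n g x‖)) ^ 2 := by gcongr
          _ ≤ _ := by
              nlinarith [mul_nonneg (sq_nonneg C') (sq_nonneg (‖mol n f x‖ - ‖mol n g x‖))]
      nlinarith [sq_nonneg (‖act ψ k x (mol n f x) (mol n g x)‖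
        - ‖mol n (cutPot c b σ (m + 1) f) x‖)])
    rw [integral_add (hi.const_mul _) (iL2.const_mul _), integral_const_mul, integral_const_mul,
      integral_add if2 ig2] at this
    rw [abs_mul, abs_two]
    have h3 : |(Complex.I * ∫ x, star (act ψ k x (mol n f x) (mol n g x))
          * mol n (cutPot c b σ (m + 1) f) x).re| ≤ ‖∫ x, star (act ψ k x (mol n f x) (mol n g x))
          * mol n (cutPot c b σ (m + 1) f) x‖ := by
      refine (Complex.abs_re_le_norm _).trans ?_
      rw [norm_mul, Complex.norm_I, one_mul]
    have h4 := mul_le_mul_of_nonneg_left (add_le_add lf lg) (sq_nonneg C')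
    linarith
  calc _ ≤ _ := (abs_add_le _ _).trans (add_le_add t1 t2)
    _ = _ := by ring

end

end INLS
end

/-! ### Evaluation of the limiting time derivative. -/

noncomputable section
namespace INLS

variable {d : ℕ}

/-- The density of the time derivative of `actForm ψ k`. -/
def virDens (c b σ : ℝ) (ψ k : ℝ → ℝ) (x : Space d) (z : ℂ) (w : EuclideanSpace ℂ (Fin d)) : ℝ :=
  commDens ψ k x z w + 2 * c * (rad k x * (‖x‖ ^ (-2 : ℝ) * ‖z‖ ^ 2))
    + ((2 / (σ + 2) - 1) * (rad (fun s => d * k s + deriv k s) x * (‖x‖ ^ (-b) * ‖z‖ ^ (σ + 2)))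
      - 2 * b / (σ + 2) * (rad k x * (‖x‖ ^ (-b) * ‖z‖ ^ (σ + 2))))

/-- The power `‖x‖^a` is the profile `e^{as}`, whose logarithmic derivative is `a`. The homogeneity
of the potentials enters the virial identity through this extra term, with `a = -2` and `a = -b`. -/
theorem rad_div_profile_mul_exp {k : ℝ → ℝ} (hk : IsCut k) (a : ℝ) (x : Space d) :
    rad (fun s => d * (k s * Real.exp (a * s)) + deriv (fun s => k s * Real.exp (a * s)) s) x
      = rad (fun s => d * k s + deriv k s) x * ‖x‖ ^ a + a * (rad k x * ‖x‖ ^ a) := by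
  by_cases hx : x = 0
  · simp [hx, rad_zero]
  · rw [rad_of_ne _ hx, rad_of_ne _ hx, rad_of_ne _ hx, ← norm_sq_mul_exp hx]
    set s := Real.log ‖x‖
    have h1 := (hk.1.differentiable (by simp) s).hasDerivAt
    have h2 : HasDerivAt (fun s => Real.exp (a * s)) (Real.exp (a * s) * a) s := by
      have := ((hasDerivAt_id s).const_mul a).exp
      simpa using this
    have h3 : HasDerivAt (fun s => k s * Real.exp (a * s)) _ s := h1.mul h2
    rw [h3.deriv]
    ring

section

variable {c b σ m : ℝ} {f : Space d → ℂ} {g : Space d → EuclideanSpace ℂ (Fin d)} {ψ k : ℝ → ℝ}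

theorem memLp_rpow_of_integrableOn (hf : AEStronglyMeasurable f volume)
    (h : IntegrableOn (fun x => ‖f x‖ ^ (2 * (σ + 1))) (annulus d m) volume) :
    MemLp (fun x => ‖f x‖ ^ (σ + 1)) 2 (volume.restrict (annulus d m)) := by
  have hm : AEStronglyMeasurable (fun x => ‖f x‖ ^ (σ + 1)) (volume.restrict (annulus d m)) :=
    (hf.norm.aemeasurable.pow_const _).aestronglyMeasurable.restrict
  rw [memLp_two_iff_integrable_sq hm]
  refine h.congr (Eventually.of_forall fun x => ?_)
  simp only
  rw [← Real.rpow_natCast, ← Real.rpow_mul (norm_nonneg _)]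
  congr 1
  push_cast
  ring

theorem memLp_cutPot (hA : IsAdmissible d b σ) (hf : MemLp f 2 volume)
    (h : IntegrableOn (fun x => ‖f x‖ ^ (2 * (σ + 1))) (annulus d m) volume) :
    MemLp (cutPot c b σ m f) 2 volume := by
  obtain ⟨C, hC, hb⟩ := exists_norm_cutPot_sq_le hA c m
  rw [memLp_two_iff_integrable_sq_norm (aestronglyMeasurable_cutPot hf.1)]
  refine (((integrable_norm_sq_of_memLp hf).const_mul C).add
    ((h.integrable_indicator (measurableSet_annulus m)).const_mul C)).mono'
    ((aestronglyMeasurable_cutPot hf.1).norm.pow 2) (Eventually.of_forall fun x => ?_)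
  rw [Real.norm_eq_abs, abs_of_nonneg (sq_nonneg _)]
  exact hb f x

theorem IsPair.integrable_potential (hA : IsAdmissible d b σ) (h : IsPair f g) :
    Integrable (fun x => ‖x‖ ^ (-b) * ‖f x‖ ^ (σ + 2)) volume := by
  refine (h.integrable_dens hA.three_le).mono' ?_ (Eventually.of_forall fun x => ?_)
  · exact ((measurable_norm.pow_const _).aemeasurable.mul
      (h.left.1.norm.aemeasurable.pow_const _)).aestronglyMeasurable
  · rw [Real.norm_eq_abs, abs_of_nonneg (by positivity)]
    exact hA.potential_le x (f x) (g x)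

theorem IsPair.integrable_hardy (hd : 3 ≤ d) (h : IsPair f g) :
    Integrable (fun x => ‖x‖ ^ (-2 : ℝ) * ‖f x‖ ^ 2) volume := by
  refine (h.integrable_dens hd).mono' ?_ (Eventually.of_forall fun x => ?_)
  · exact ((measurable_norm.pow_const _).aemeasurable.mul
      (h.left.1.norm.aemeasurable.pow_const _)).aestronglyMeasurable
  · rw [Real.norm_eq_abs, abs_of_nonneg (by positivity)]
    exact (le_dens _ x (f x) (g x)).2.2.1

theorem integrable_commDens (hψ : IsCut ψ) (hk : IsCut k) (hf : MemLp f 2 volume)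
    (hg : MemLp g 2 volume) : Integrable (fun x => commDens ψ k x (f x) (g x)) volume := by
  obtain ⟨C, hC, hCb⟩ := exists_abs_commDens_le (d := d) hψ hk
  refine (((integrable_norm_sq_of_memLp hf).add (integrable_norm_sq_of_memLp hg)).const_mul C).mono'
    (((continuous_commDens hψ hk).measurable.comp_aemeasurable
    (aemeasurable_id.prodMk (hf.1.aemeasurable.prodMk hg.1.aemeasurable))).aestronglyMeasurable)
    (Eventually.of_forall fun x => hCb x (f x) (g x))

/-- Evaluation of the limit of the time derivatives. -/
theorem IsPair.integral_virDens (hA : IsAdmissible d b σ) (h : IsPair f g) (hψ : IsCut ψ)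
    (hk : IsCut k) (hmψ : ∀ s, m < |s| → ψ s = 0) (hmk : ∀ s, m < |s| → k s = 0)
    (hL : IntegrableOn (fun x => ‖f x‖ ^ (2 * (σ + 1))) (annulus d (m + 1)) volume) :
    (∫ x, commDens ψ k x (f x) (g x))
        + 2 * (Complex.I * ∫ x, star (act ψ k x (f x) (g x)) * cutPot c b σ (m + 1) f x).re
      = ∫ x, virDens c b σ ψ k x (f x) (g x) := by
  have hσ2 : 0 < σ + 2 := by linarith [hA.σ_pos]
  have hmk' : ∀ s, m + 1 < |s| → k s = 0 := fun s hs => hmk s (by linarith)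
  have hLσ := memLp_rpow_of_integrableOn h.left.1 hL
  set ρ : ℝ → ℝ := fun s => d * k s + deriv k s with hρ
  set X1 : Space d → ℝ := fun x => rad k x * ‖x‖ ^ (-2 : ℝ) * (star (f x) * xdot x (g x)).re with hX1
  set X2 : Space d → ℝ := fun x => rad k x * ‖x‖ ^ (-b) *
    (‖f x‖ ^ σ * (star (f x) * xdot x (g x)).re) with hX2
  set Y1 : Space d → ℝ := fun x => rad ρ x * (‖x‖ ^ (-2 : ℝ) * ‖f x‖ ^ 2) with hY1
  set Z1 : Space d → ℝ := fun x => rad k x * (‖x‖ ^ (-2 : ℝ) * ‖f x‖ ^ 2) with hZ1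
  set Y2 : Space d → ℝ := fun x => rad ρ x * (‖x‖ ^ (-b) * ‖f x‖ ^ (σ + 2)) with hY2
  set Z2 : Space d → ℝ := fun x => rad k x * (‖x‖ ^ (-b) * ‖f x‖ ^ (σ + 2)) with hZ2
  have iC := integrable_commDens hψ hk h.left h.right
  have iY1 : Integrable Y1 volume :=
    integrable_rad_mul (hk.div_profile d) (h.integrable_hardy hA.three_le)
  have iZ1 : Integrable Z1 volume := integrable_rad_mul hk (h.integrable_hardy hA.three_le)
  have iY2 : Integrable Y2 volume :=
    integrable_rad_mul (hk.div_profile d) (h.integrable_potential hA)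
  have iZ2 : Integrable Z2 volume := integrable_rad_mul hk (h.integrable_potential hA)
  have iX1 : Integrable X1 volume := by
    have := integrable_rad_mul_re (hk.mul_exp (-2)) h.left h.right
    simpa only [rad_mul_exp] using this
  have iW : Integrable (fun x => star (act ψ k x (f x) (g x)) * cutPot c b σ (m + 1) f x) volume :=
    (memLp_act hψ hk h.left h.right).integrable_mul (memLp_cutPot hA h.left hL)
  have iW2 := (iW.const_mul Complex.I).re.const_mul 2
  simp only [RCLike.re_to_complex] at iW2
  -- The potentials are real, so the contribution of `ψ` is purely imaginary before taking real
  -- parts and drops out; only the radial derivative and half the divergence of the field remain.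
  have hpt : ∀ x, 2 * (Complex.I * (star (act ψ k x (f x) (g x)) * cutPot c b σ (m + 1) f x)).re
      = 2 * c * X1 x + c * Y1 x - 2 * X2 x - Y2 x := by
    intro x
    by_cases hx : x ∈ annulus d (m + 1)
    · have hpow : ‖f x‖ ^ (σ + 2) = ‖f x‖ ^ σ * ‖f x‖ ^ 2 := by
        rw [← Real.rpow_two, ← Real.rpow_add_of_nonneg (norm_nonneg _) hA.σ_pos.le (by norm_num)]
      have hsq : ‖f x‖ ^ 2 = (f x).re * (f x).re + (f x).im * (f x).im := by
        rw [Complex.sq_norm, Complex.normSq_apply]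
      simp only [hX1, hX2, hY1, hY2]
      rw [hpow, hsq, cutPot, Set.indicator_of_mem hx, act, potVal, ← hρ]
      generalize ‖x‖ ^ (-2 : ℝ) = A
      generalize ‖x‖ ^ (-b) = B
      generalize ‖f x‖ ^ σ = N
      simp [Complex.mul_re, Complex.mul_im]
      ring
    · have hk0 : rad k x = 0 := IsCut.rad_eq_zero hmk' hx
      have ha0 := act_eq_zero (d := d) (ψ := ψ) (k := k) (m := m + 1)
        (fun s hs => hmψ s (by linarith)) hmk' hx
      have hρ0 : rad ρ x = 0 := by
        have h1 := ha0 1 0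
        have hψ0 : rad ψ x = 0 := IsCut.rad_eq_zero (fun s hs => hmψ s (by linarith)) hx
        have hxd : xdot x (0 : EuclideanSpace ℂ (Fin d)) = 0 := by simp [xdot]
        simp only [act, hψ0, hk0, hxd] at h1
        simpa using h1
      simp [hX1, hX2, hY1, hY2, ha0, hk0, hρ0]
  -- Integrability of `X2` is read off the identity `hpt`, in which every other term is integrable.
  have iX2 : Integrable X2 volume := by
    have h1 := ((((iX1.const_mul (2 * c)).add (iY1.const_mul c)).sub iY2).sub iW2).const_mul (1 / 2)
    refine h1.congr (Eventually.of_forall fun x => ?_)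
    simp only [Pi.add_apply, Pi.sub_apply, hpt]
    ring
  -- The chain rule with exponent `p = 1` and weight `‖x‖⁻²`.
  have eX1 : ∫ x, X1 x = -(1 / 2) * ((∫ x, Y1 x) - 2 * ∫ x, Z1 x) := by
    have h1 := integral_rad_pow h le_rfl (hk.mul_exp (-2)) (m := m)
      (fun s hs => by rw [hmk s hs, zero_mul]) (by
        have : MemLp (fun x => ‖f x‖) 2 (volume.restrict (annulus d m)) := h.left.norm.restrict _
        refine this.ae_eq (Eventually.of_forall fun x => ?_)
        norm_num)
    simp only [rad_mul_exp, rad_div_profile_mul_exp hk] at h1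
    have e1 : ∀ x, rad k x * ‖x‖ ^ (-2 : ℝ)
        * (‖f x‖ ^ (2 * (1 : ℝ) - 2) * (star (f x) * xdot x (g x)).re) = X1 x := fun x => by
      norm_num [hX1]
    have e2 : ∀ x, (rad (fun s => d * k s + deriv k s) x * ‖x‖ ^ (-2 : ℝ)
        + -2 * (rad k x * ‖x‖ ^ (-2 : ℝ))) * ‖f x‖ ^ (2 * (1 : ℝ)) = Y1 x - 2 * Z1 x := fun x => by
      rw [mul_one, Real.rpow_two]
      simp only [hY1, hZ1, hρ]
      ring
    simp only [e1, e2] at h1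
    rw [h1, integral_sub iY1 (iZ1.const_mul 2), integral_const_mul]
    norm_num
  -- The chain rule with `p = (σ + 2)/2`; then `2p - 1 = σ + 1`, which is why local square
  -- integrability of `‖f‖^(σ+1)` is needed.
  have eX2 : ∫ x, X2 x = -(1 / (σ + 2)) * ((∫ x, Y2 x) - b * ∫ x, Z2 x) := by
    have h1 := integral_rad_pow h (p := (σ + 2) / 2) (by linarith [hA.σ_pos]) (hk.mul_exp (-b))
      (m := m + 1) (fun s hs => by rw [hmk' s hs, zero_mul]) (by
        refine hLσ.ae_eq (Eventually.of_forall fun x => ?_)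
        simp only
        congr 1
        ring)
    simp only [rad_mul_exp, rad_div_profile_mul_exp hk] at h1
    have e1 : ∀ x, rad k x * ‖x‖ ^ (-b)
        * (‖f x‖ ^ (2 * ((σ + 2) / 2) - 2) * (star (f x) * xdot x (g x)).re) = X2 x := fun x => by
      rw [show 2 * ((σ + 2) / 2) - 2 = σ by ring]
    have e2 : ∀ x, (rad (fun s => d * k s + deriv k s) x * ‖x‖ ^ (-b)
        + -b * (rad k x * ‖x‖ ^ (-b))) * ‖f x‖ ^ (2 * ((σ + 2) / 2)) = Y2 x - b * Z2 x := fun x => by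
      rw [show 2 * ((σ + 2) / 2) = σ + 2 by ring]
      simp only [hY2, hZ2, hρ]
      ring
    simp only [e1, e2] at h1
    rw [h1, integral_sub iY2 (iZ2.const_mul b), integral_const_mul]
    congr 2
    field_simp
  have eW : 2 * (Complex.I * ∫ x, star (act ψ k x (f x) (g x)) * cutPot c b σ (m + 1) f x).re
      = 2 * c * (∫ x, X1 x) + c * (∫ x, Y1 x) - 2 * (∫ x, X2 x) - ∫ x, Y2 x := by
    have e2 := integral_re (iW.const_mul Complex.I)
    simp only [RCLike.re_to_complex] at e2
    rw [← integral_const_mul, ← e2, ← integral_const_mul]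
    simp only [hpt]
    have j1 : Integrable (fun x => 2 * c * X1 x + c * Y1 x) volume :=
      (iX1.const_mul _).add (iY1.const_mul _)
    have j2 : Integrable (fun x => 2 * c * X1 x + c * Y1 x - 2 * X2 x) volume :=
      j1.sub (iX2.const_mul 2)
    rw [integral_sub j2 iY2, integral_sub j1 (iX2.const_mul 2),
      integral_add (iX1.const_mul _) (iY1.const_mul _), integral_const_mul, integral_const_mul,
      integral_const_mul]
  have eV : ∫ x, virDens c b σ ψ k x (f x) (g x) = (∫ x, commDens ψ k x (f x) (g x))
      + 2 * c * (∫ x, Z1 x) + ((2 / (σ + 2) - 1) * (∫ x, Y2 x) - 2 * b / (σ + 2) * ∫ x, Z2 x) := by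
    have j1 : Integrable (fun x => commDens ψ k x (f x) (g x) + 2 * c * Z1 x) volume :=
      iC.add (iZ1.const_mul _)
    have j2 : Integrable (fun x => (2 / (σ + 2) - 1) * Y2 x - 2 * b / (σ + 2) * Z2 x) volume :=
      (iY2.const_mul _).sub (iZ2.const_mul _)
    have e : ∀ x, virDens c b σ ψ k x (f x) (g x) = (commDens ψ k x (f x) (g x) + 2 * c * Z1 x)
        + ((2 / (σ + 2) - 1) * Y2 x - 2 * b / (σ + 2) * Z2 x) := fun x => rfl
    simp only [e]
    rw [integral_add j1 j2, integral_add iC (iZ1.const_mul _), integral_sub (iY2.const_mul _)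
      (iZ2.const_mul _), integral_const_mul, integral_const_mul, integral_const_mul]
  -- The terms `c Y1` cancel, leaving `2c Z1`, and the two contributions of `Y2` combine to the
  -- factor `2/(σ+2) - 1`.
  rw [eW, eV, eX1, eX2]
  field_simp
  ring

/-- The density `virDens` is controlled by the energy density. -/
theorem exists_abs_virDens_le (hA : IsAdmissible d b σ) (c : ℝ) (hψ : IsCut ψ) (hk : IsCut k) :
    ∃ C : ℝ, 0 ≤ C ∧ ∀ (x : Space d) (z : ℂ) (w : EuclideanSpace ℂ (Fin d)),
      |virDens c b σ ψ k x z w| ≤ C * dens hardyWeight (sobolevExp d) x z w := by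
  obtain ⟨C₁, h1, b1⟩ := exists_abs_commDens_le (d := d) hψ hk
  obtain ⟨C₂, h2, b2⟩ := hk.exists_bound
  obtain ⟨C₃, h3, b3⟩ := (hk.div_profile d).exists_bound
  have hσ2 : 0 < σ + 2 := by linarith [hA.σ_pos]
  refine ⟨2 * C₁ + |2 * c| * C₂ + |2 / (σ + 2) - 1| * C₃ + |2 * b / (σ + 2)| * C₂, by positivity,
    fun x z w => ?_⟩
  obtain ⟨d1, d2, d3, -⟩ := le_dens (sobolevExp d) x z w
  have d4 := hA.potential_le x z w
  set D := dens hardyWeight (sobolevExp d) x z w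
  have hD : 0 ≤ D := (sq_nonneg _).trans d1
  have t1 : |commDens ψ k x z w| ≤ 2 * C₁ * D := by
    refine (b1 x z w).trans ?_
    calc _ ≤ C₁ * (D + D) := by gcongr
      _ = _ := by ring
  have hr : ∀ {κ : ℝ → ℝ} {C e a : ℝ}, 0 < C → (∀ s, |κ s| ≤ C) → 0 ≤ e → e ≤ D →
      |a * (rad κ x * e)| ≤ |a| * C * D := fun {κ C e a} hC hκ he heD => by
    rw [abs_mul, abs_mul, abs_of_nonneg he, mul_assoc]
    have := IsCut.abs_rad_le hC.le hκ x
    gcongr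
  have t2 := hr (a := 2 * c) h2 b2 (by positivity : 0 ≤ ‖x‖ ^ (-2 : ℝ) * ‖z‖ ^ 2) d3
  have t3 := hr (a := 2 / (σ + 2) - 1) h3 b3 (by positivity : 0 ≤ ‖x‖ ^ (-b) * ‖z‖ ^ (σ + 2)) d4
  have t4 := hr (a := 2 * b / (σ + 2)) h2 b2 (by positivity : 0 ≤ ‖x‖ ^ (-b) * ‖z‖ ^ (σ + 2)) d4
  unfold virDens
  calc _ ≤ 2 * C₁ * D + |2 * c| * C₂ * D
        + (|2 / (σ + 2) - 1| * C₃ * D + |2 * b / (σ + 2)| * C₂ * D) := by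
        refine (abs_add_le _ _).trans (add_le_add ((abs_add_le _ _).trans (add_le_add t1 t2))
          ((abs_sub _ _).trans (add_le_add t3 t4)))
    _ = _ := by ring

theorem measurable_virDens (hψ : IsCut ψ) (hk : IsCut k) :
    Measurable fun p : Space d × ℂ × EuclideanSpace ℂ (Fin d) =>
      virDens c b σ ψ k p.1 p.2.1 p.2.2 := by
  have h1 := (continuous_commDens (d := d) hψ hk).measurable
  have h2 : Measurable fun p : Space d × ℂ × EuclideanSpace ℂ (Fin d) => rad k p.1 :=
    hk.continuous_rad.measurable.comp measurable_fst
  have h3 : Measurable fun p : Space d × ℂ × EuclideanSpace ℂ (Fin d) =>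
      rad (fun s => d * k s + deriv k s) p.1 :=
    (hk.div_profile d).continuous_rad.measurable.comp measurable_fst
  have h4 : ∀ a : ℝ, Measurable fun p : Space d × ℂ × EuclideanSpace ℂ (Fin d) => ‖p.1‖ ^ a :=
    fun a => (measurable_norm.comp measurable_fst).pow_const a
  have h5 : ∀ a : ℝ, Measurable fun p : Space d × ℂ × EuclideanSpace ℂ (Fin d) => ‖p.2.1‖ ^ a :=
    fun a => (measurable_norm.comp (measurable_fst.comp measurable_snd)).pow_const a
  have h6 : Measurable fun p : Space d × ℂ × EuclideanSpace ℂ (Fin d) => ‖p.2.1‖ ^ 2 :=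
    (measurable_norm.comp (measurable_fst.comp measurable_snd)).pow_const 2
  unfold virDens
  exact (h1.add ((h2.mul ((h4 _).mul h6)).const_mul _)).add
    (((h3.mul ((h4 _).mul (h5 _))).const_mul _).sub ((h2.mul ((h4 _).mul (h5 _))).const_mul _))

theorem continuous_virDens (hσ : 0 < σ) (hψ : IsCut ψ) (hk : IsCut k) (x : Space d) :
    Continuous fun p : ℂ × EuclideanSpace ℂ (Fin d) => virDens c b σ ψ k x p.1 p.2 := by
  have h1 : Continuous fun p : ℂ × EuclideanSpace ℂ (Fin d) => commDens ψ k x p.1 p.2 :=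
    (continuous_commDens hψ hk).comp (by fun_prop : Continuous
      fun p : ℂ × EuclideanSpace ℂ (Fin d) => (x, p.1, p.2))
  have h2 : Continuous fun p : ℂ × EuclideanSpace ℂ (Fin d) => ‖p.1‖ ^ (σ + 2) :=
    continuous_fst.norm.rpow_const fun _ => Or.inr (by linarith)
  unfold virDens
  fun_prop

end

end INLS
end

/-! ### Local space-time integrability of the nonlinearity from the Strichartz condition. -/

noncomputable section
namespace INLS

variable {d : ℕ}

/-- The exponent whose Sobolev conjugate is the time exponent of the solution space. -/
def localExp (d : ℕ) (b : ℝ) : ℝ := 2 * d * (d + 2 - 2 * b) / ((d : ℝ) ^ 2 + 4 - 4 * b)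

namespace IsAdmissible

variable {b σ : ℝ}

theorem rExp_den_pos (h : IsAdmissible d b σ) : 0 < (d : ℝ) ^ 2 - 2 * d * b + 4 := by
  have := h.three_le_cast
  nlinarith [h.b_lt, sq_nonneg ((d : ℝ) - 2)]

theorem gammaExp_eq (h : IsAdmissible d b σ) :
    gammaExp d (rExp d b) = 2 * (d + 2 - 2 * b) / ((d : ℝ) - 2) := by
  have hd := h.three_le_cast
  have h1 := h.rExp_den_pos
  have h2 : (d : ℝ) - 2 ≠ 0 := by linarith
  have h3 : (d : ℝ) + 2 - 2 * b ≠ 0 := by linarith [h.b_lt]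
  have h4 : (d : ℝ) ≠ 0 := by linarith
  have h5 : (d : ℝ) / 2 - d / rExp d b = (d - 2) / (d + 2 - 2 * b) := by
    rw [rExp]
    field_simp
    ring
  rw [gammaExp, h5]
  field_simp

/-- Equality holds at the energy-critical exponent: the pair `(γ, r)` is chosen so that `|u|^(σ+1)`
is just locally square integrable in space-time. -/
theorem le_gammaExp (h : IsAdmissible d b σ) : 2 * (σ + 1) ≤ gammaExp d (rExp d b) := by
  have hd := h.three_le_cast
  have h2 : 0 < (d : ℝ) - 2 := by linarith
  have h3 := h.σ_le
  rw [le_div_iff₀ h2] at h3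
  rw [h.gammaExp_eq, le_div_iff₀ h2]
  nlinarith

theorem gammaExp_pos (h : IsAdmissible d b σ) : 0 < gammaExp d (rExp d b) := by
  linarith [h.le_gammaExp, h.σ_pos]

theorem localExp_den_pos (h : IsAdmissible d b σ) : 0 < (d : ℝ) ^ 2 + 4 - 4 * b := by
  have := h.three_le_cast
  nlinarith [h.b_lt]

theorem one_le_localExp (h : IsAdmissible d b σ) : 1 ≤ localExp d b := by
  have hd := h.three_le_cast
  rw [localExp, le_div_iff₀ h.localExp_den_pos]
  nlinarith [h.b_lt, sq_nonneg ((d : ℝ) - 2)]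

theorem localExp_le_rExp (h : IsAdmissible d b σ) : localExp d b ≤ rExp d b := by
  have hd := h.three_le_cast
  have := h.b_lt
  refine div_le_div_of_nonneg_left (mul_nonneg (by linarith) (by linarith)) h.rExp_den_pos ?_
  nlinarith [h.b_pos]

theorem localExp_le_sobolevExp (h : IsAdmissible d b σ) : localExp d b ≤ sobolevExp d := by
  have hd := h.three_le_cast
  have hb := h.b_lt
  have hb0 := h.b_pos
  rw [localExp, sobolevExp, div_le_div_iff₀ h.localExp_den_pos (by linarith), mul_assoc]
  refine mul_le_mul_of_nonneg_left ?_ (by linarith)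
  nlinarith

/-- The Sobolev relation: one derivative in `L^p`, `p = localExp d b`, yields `L^γ` in space with
the same `γ` as in time. -/
theorem inv_gammaExp (h : IsAdmissible d b σ) :
    (gammaExp d (rExp d b))⁻¹ = (localExp d b)⁻¹ - (d : ℝ)⁻¹ := by
  have hd := h.three_le_cast
  have h1 := h.localExp_den_pos
  have h2 : (d : ℝ) - 2 ≠ 0 := by linarith
  have h3 : (d : ℝ) + 2 - 2 * b ≠ 0 := by linarith [h.b_lt]
  have h4 : (d : ℝ) ≠ 0 := by linarith
  rw [h.gammaExp_eq, localExp]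
  field_simp
  ring

end IsAdmissible

theorem ennreal_rpow_le_one_add_rpow {t : ℝ≥0∞} {r q : ℝ} (hr : 0 ≤ r) (hrq : r ≤ q) :
    t ^ r ≤ 1 + t ^ q := by
  rcases le_total t 1 with h | h
  · exact (ENNReal.rpow_le_one h hr).trans le_self_add
  · exact (ENNReal.rpow_le_rpow_of_exponent_le h hrq).trans le_add_self

/-- A radial cutoff which equals one on an annulus. -/
theorem exists_isCut_eq_one (m : ℝ) : ∃ (κ : ℝ → ℝ) (M : ℝ), IsCut κ ∧ (∀ s, |s| ≤ m → κ s = 1) ∧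
    (∀ s, M < |s| → κ s = 0) ∧ ∀ s, |κ s| ≤ 1 := by
  let φ : ContDiffBump (0 : ℝ) := ⟨|m| + 1, |m| + 2, by positivity, by linarith⟩
  refine ⟨φ, |m| + 2, ⟨φ.contDiff, φ.hasCompactSupport⟩, fun s hs => ?_, fun s hs => ?_, fun s => ?_⟩
  · refine φ.one_of_mem_closedBall ?_
    rw [Metric.mem_closedBall, dist_zero_right, Real.norm_eq_abs]
    exact (hs.trans (le_abs_self m)).trans (by simp [φ])
  · refine φ.zero_of_le_dist ?_
    rw [dist_zero_right, Real.norm_eq_abs]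
    exact hs.le
  · rw [abs_of_nonneg φ.nonneg]
    exact φ.le_one

/-- Local control of the square of the nonlinearity. -/
theorem exists_lintegral_rpow_annulus_le {b σ : ℝ} (hA : IsAdmissible d b σ) (m : ℝ) :
    ∃ (C : NNReal) (M : ℝ), ∀ (f : Space d → ℂ) (g : Space d → EuclideanSpace ℂ (Fin d)),
      IsPair f g → ∫⁻ x in annulus d m, ‖f x‖ₑ ^ (2 * (σ + 1))
        ≤ C * (eLpNorm g (ENNReal.ofReal (rExp d b)) (volume.restrict (annulus d M))
            ^ gammaExp d (rExp d b))
          + C * (1 + (eLpNorm g 2 volume + eLpNorm f 2 volume) ^ gammaExp d (rExp d b)) := by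
  have hd := hA.three_le
  set γ := gammaExp d (rExp d b) with hγ
  have hγ0 : 0 < γ := hA.gammaExp_pos
  set p := localExp d b with hp
  have hp1 : 1 ≤ p := hA.one_le_localExp
  have hp0 : 0 < p := by linarith
  -- Sobolev from `localExp` to `γ`. The gradient is known in `L^r` and the function in
  -- `L^(2d/(d-2))`; both exponents are at least `localExp`, so Hölder on the bounded annulus `K'`
  -- suffices, with `a` and `a'` its constants.
  obtain ⟨C₁, hC₁⟩ := exists_eLpNorm_cutoff_le (d := d) (by omega) (p := p.toNNReal)
    (q := γ.toNNReal) (by rw [← Real.toNNReal_one]; exact Real.toNNReal_le_toNNReal hp1) (by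
      rw [Real.coe_toNNReal _ hγ0.le, Real.coe_toNNReal _ hp0.le]
      exact hA.inv_gammaExp)
  obtain ⟨C₂, hC₂⟩ := exists_eLpNorm_sobolev_le hd
  obtain ⟨κ, M, hκ, hκ1, hκ0, hκb⟩ := exists_isCut_eq_one m
  obtain ⟨δ, hδ, hδM⟩ := exists_sub_mem_annulus d M
  have hηc : ContDiff ℝ ∞ (rad κ : Space d → ℝ) := hκ.contDiff_rad
  obtain ⟨C₃, hC₃⟩ := (hκ.hasCompactSupport_rad.fderiv ℝ).exists_bound_of_continuous
    (hηc.continuous_fderiv (by simp) : Continuous (fderiv ℝ (rad κ : Space d → ℝ)))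
  have hηz : ∀ x, x ∉ annulus d M → rad κ x = 0 ∧ fderiv ℝ (rad κ) x = 0 := by
    intro x hx
    refine ⟨IsCut.rad_eq_zero hκ0 hx, ?_⟩
    have : (rad κ : Space d → ℝ) =ᶠ[𝓝 x] fun _ => 0 := by
      filter_upwards [(isCompact_annulus M).isClosed.isOpen_compl.mem_nhds hx] with y hy
      exact IsCut.rad_eq_zero hκ0 hy
    rw [this.fderiv_eq]
    simp
  set K' := annulus d (M + 1)
  set V : ℝ≥0∞ := volume (annulus d m) with hV
  have hVt : V ≠ ⊤ := (isCompact_annulus m).measure_lt_top.ne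
  have hK't : (volume.restrict K') Set.univ ≠ ⊤ := by
    rw [Measure.restrict_apply_univ]
    exact (isCompact_annulus _).measure_lt_top.ne
  set a : ℝ≥0∞ := (volume.restrict K') Set.univ ^ (1 / p - 1 / rExp d b) with ha
  set a' : ℝ≥0∞ := (volume.restrict K') Set.univ ^ (1 / p - 1 / sobolevExp d) with ha'
  have hr0 : 0 < rExp d b := hp0.trans_le hA.localExp_le_rExp
  have hs0 : 0 < sobolevExp d := sobolevExp_pos hd
  have hat : a ≠ ⊤ := ENNReal.rpow_ne_top_of_nonneg
    (sub_nonneg.2 (one_div_le_one_div_of_le hp0 hA.localExp_le_rExp)) hK't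
  have hat' : a' ≠ ⊤ := ENNReal.rpow_ne_top_of_nonneg
    (sub_nonneg.2 (one_div_le_one_div_of_le hp0 hA.localExp_le_sobolevExp)) hK't
  set B : ℝ≥0∞ := C₁ * (a + C₃.toNNReal * (C₂ * a')) with hB
  have hBt : B ≠ ⊤ := ENNReal.mul_ne_top ENNReal.coe_ne_top (ENNReal.add_ne_top.2 ⟨hat,
    ENNReal.mul_ne_top ENNReal.coe_ne_top (ENNReal.mul_ne_top ENNReal.coe_ne_top hat')⟩)
  set D : ℝ≥0∞ := V + B ^ γ * 2 ^ γ with hD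
  have hDt : D ≠ ⊤ := ENNReal.add_ne_top.2 ⟨hVt, ENNReal.mul_ne_top
    (ENNReal.rpow_ne_top_of_nonneg hγ0.le hBt) (ENNReal.rpow_ne_top_of_nonneg hγ0.le (by simp))⟩
  refine ⟨D.toNNReal, M + 1, fun f g h => ?_⟩
  rw [ENNReal.coe_toNNReal hDt]
  set X := eLpNorm g (ENNReal.ofReal (rExp d b)) (volume.restrict K')
  set A := eLpNorm g 2 volume + eLpNorm f 2 volume
  have h1 : eLpNorm f (ENNReal.ofReal γ) (volume.restrict (annulus d m)) ≤ B * (X + A) := by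
    calc eLpNorm f (ENNReal.ofReal γ) (volume.restrict (annulus d m))
        = eLpNorm (fun x => rad κ x • f x) (ENNReal.ofReal γ)
          (volume.restrict (annulus d m)) := by
          refine eLpNorm_congr_ae ((ae_restrict_mem (measurableSet_annulus m)).mono fun x hx => ?_)
          have hx0 := ne_zero_of_mem_annulus hx
          simp only
          rw [rad_of_ne _ hx0, hκ1 _ ((mem_annulus_iff hx0).1 hx), one_smul]
      _ ≤ eLpNorm (fun x => rad κ x • f x) (ENNReal.ofReal γ) volume :=
          eLpNorm_restrict_le _ _ _ _
      _ ≤ C₁ * (eLpNorm g (ENNReal.ofReal p) (volume.restrict K')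
          + C₃.toNNReal * eLpNorm f (ENNReal.ofReal p) (volume.restrict K')) :=
          hC₁ (rad κ) C₃.toNNReal (annulus d M) K' δ f g hηc hκ.hasCompactSupport_rad
            (fun x => IsCut.abs_rad_le zero_le_one hκb x)
            (fun x => (hC₃ x).trans (Real.le_coe_toNNReal _)) (measurableSet_annulus _)
            (measurableSet_annulus _) hηz hδ hδM h
      _ ≤ C₁ * (X * a + C₃.toNNReal * ((C₂ * A) * a')) := by
          gcongr
          · have := eLpNorm_le_eLpNorm_mul_rpow_measure_univ (μ := volume.restrict K')
              (ENNReal.ofReal_le_ofReal hA.localExp_le_rExp) h.right.1.restrict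
            rwa [ENNReal.toReal_ofReal hp0.le, ENNReal.toReal_ofReal hr0.le] at this
          · have := eLpNorm_le_eLpNorm_mul_rpow_measure_univ (μ := volume.restrict K')
              (ENNReal.ofReal_le_ofReal hA.localExp_le_sobolevExp) h.left.1.restrict
            rw [ENNReal.toReal_ofReal hp0.le, ENNReal.toReal_ofReal hs0.le] at this
            refine this.trans (mul_le_mul_left ?_ _)
            exact (eLpNorm_restrict_le _ _ _ _).trans (hC₂ f g h)
      _ ≤ C₁ * ((X + A) * a + C₃.toNNReal * ((C₂ * (X + A)) * a')) := by
          gcongr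
          · exact le_self_add
          · exact le_add_self
      _ = B * (X + A) := by rw [hB]; ring
  have h2 : eLpNorm f (ENNReal.ofReal γ) (volume.restrict (annulus d m)) ^ γ
      = ∫⁻ x in annulus d m, ‖f x‖ₑ ^ γ := by
    rw [eLpNorm_eq_lintegral_rpow_enorm_toReal (by simpa using hγ0) ENNReal.ofReal_ne_top,
      ENNReal.toReal_ofReal hγ0.le, ← ENNReal.rpow_mul, one_div, inv_mul_cancel₀ hγ0.ne',
      ENNReal.rpow_one]
  have h3 : (X + A) ^ γ ≤ 2 ^ γ * (X ^ γ + A ^ γ) := by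
    calc (X + A) ^ γ ≤ (2 * max X A) ^ γ := by
          refine ENNReal.rpow_le_rpow ?_ hγ0.le
          rw [two_mul]
          exact add_le_add (le_max_left _ _) (le_max_right _ _)
      _ = 2 ^ γ * (max X A) ^ γ := ENNReal.mul_rpow_of_nonneg _ _ hγ0.le
      _ ≤ _ := by
          gcongr
          rcases le_total X A with hxa | hxa
          · rw [max_eq_right hxa]; exact le_add_self
          · rw [max_eq_left hxa]; exact le_self_add
  calc ∫⁻ x in annulus d m, ‖f x‖ₑ ^ (2 * (σ + 1))
      ≤ ∫⁻ x in annulus d m, (1 + ‖f x‖ₑ ^ γ) := lintegral_mono fun x =>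
        ennreal_rpow_le_one_add_rpow (by linarith [hA.σ_pos]) hA.le_gammaExp
    _ = V + eLpNorm f (ENNReal.ofReal γ) (volume.restrict (annulus d m)) ^ γ := by
        rw [lintegral_add_left measurable_const, h2, lintegral_const,
          Measure.restrict_apply_univ, one_mul]
    _ ≤ V + (B * (X + A)) ^ γ := by gcongr
    _ = V + B ^ γ * (X + A) ^ γ := by rw [ENNReal.mul_rpow_of_nonneg _ _ hγ0.le]
    _ ≤ V + B ^ γ * (2 ^ γ * (X ^ γ + A ^ γ)) := by gcongr
    _ = V + B ^ γ * 2 ^ γ * (X ^ γ + A ^ γ) := by ring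
    _ ≤ D * 1 + D * (X ^ γ + A ^ γ) := by
        rw [hD, mul_one]
        gcongr
        · exact le_self_add
        · exact le_add_self
    _ = _ := by ring

section Solution

variable {c b σ : ℝ} {I : Set ℝ} {u₀ : Space d → ℂ} {u : ℝ → Space d → ℂ}

theorem ContL2.exists_eLpNorm_le {F : Type*} [NormedAddCommGroup F] {f : ℝ → Space d → F}
    (hf : ContL2 I f) {α β : ℝ} (hI : Set.Icc α β ⊆ I) :
    ∃ C : NNReal, ∀ t ∈ Set.Icc α β, eLpNorm (f t) 2 volume ≤ C := by
  have hc : ContinuousOn (fun t => (eLpNorm (f t) 2 volume).toReal) I := by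
    intro t ht
    have h1 : Tendsto (fun s => (eLpNorm (f s - f t) 2 volume).toReal) (𝓝[I] t) (𝓝 0) :=
      (ENNReal.tendsto_toReal ENNReal.zero_ne_top).comp (hf.2 t ht)
    rw [ContinuousWithinAt, tendsto_iff_norm_sub_tendsto_zero]
    refine squeeze_zero' (Eventually.of_forall fun _ => norm_nonneg _) ?_ h1
    filter_upwards [self_mem_nhdsWithin] with s hs
    have ms := hf.1 s hs
    have mt := hf.1 t ht
    have key : ∀ {p q : Space d → F}, MemLp p 2 volume → MemLp q 2 volume →
        (eLpNorm p 2 volume).toReal ≤ (eLpNorm (p - q) 2 volume).toReal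
          + (eLpNorm q 2 volume).toReal := fun {p q} hp hq => by
      rw [← ENNReal.toReal_add (hp.sub hq).2.ne hq.2.ne]
      refine ENNReal.toReal_mono (ENNReal.add_ne_top.2 ⟨(hp.sub hq).2.ne, hq.2.ne⟩) ?_
      have := eLpNorm_add_le (hp.sub hq).1 hq.1 (p := 2) (by norm_num)
      rwa [sub_add_cancel] at this
    have k1 := key ms mt
    have k2 := key mt ms
    rw [eLpNorm_sub_comm] at k2
    rw [Real.norm_eq_abs, abs_sub_le_iff]
    constructor <;> linarith
  obtain ⟨C, hC⟩ := isCompact_Icc.exists_bound_of_continuousOn (hc.mono hI)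
  refine ⟨C.toNNReal, fun t ht => ?_⟩
  rw [← ENNReal.ofReal_toReal (hf.1 t (hI ht)).2.ne]
  exact ENNReal.ofReal_le_ofReal ((le_abs_self _).trans (hC t ht))

/-- Space and time exponents are both `γ`, so after raising to the power `γ` the Strichartz quantity
enters linearly; the `H¹` norms are bounded on the compact time interval. -/
theorem IsSolution.lintegral_lintegral_rpow_lt_top (hA : IsAdmissible d b σ)
    (hu : IsSolution c b σ I u₀ u) (m : ℝ) {α β : ℝ} (hI : Set.Icc α β ⊆ I) :
    ∫⁻ t in Set.Icc α β, ∫⁻ x in annulus d m, ‖u t x‖ₑ ^ (2 * (σ + 1)) < ⊤ := by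
  obtain ⟨C, M, hC⟩ := exists_lintegral_rpow_annulus_le hA m
  obtain ⟨C₁, h1⟩ := hu.contH1.2.1.exists_eLpNorm_le hI
  obtain ⟨C₂, h2⟩ := hu.contH1.2.2.exists_eLpNorm_le hI
  have hγ0 := hA.gammaExp_pos
  set γ := gammaExp d (rExp d b)
  have hs := hu.strichartz (Set.Icc α β) hI isCompact_Icc (annulus d M) (isCompact_annulus M)
    (zero_notMem_annulus M)
  calc _ ≤ ∫⁻ t in Set.Icc α β, (C * (eLpNorm (weakGrad (u t)) (ENNReal.ofReal (rExp d b))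
        (volume.restrict (annulus d M)) ^ γ) + C * (1 + ((C₂ : ℝ≥0∞) + C₁) ^ γ)) := by
        refine setLIntegral_mono' measurableSet_Icc fun t ht => ?_
        refine (hC _ _ (hu.contH1.1 t (hI ht)).isPair).trans ?_
        gcongr
        · exact h2 t ht
        · exact h1 t ht
    _ < ⊤ := by
        rw [lintegral_add_right _ measurable_const, lintegral_const_mul' _ _ ENNReal.coe_ne_top,
          lintegral_const, Measure.restrict_apply_univ]
        refine ENNReal.add_lt_top.2 ⟨ENNReal.mul_lt_top ENNReal.coe_lt_top hs, ?_⟩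
        refine ENNReal.mul_lt_top (ENNReal.mul_lt_top ENNReal.coe_lt_top
          (ENNReal.add_lt_top.2 ⟨ENNReal.one_lt_top, ?_⟩)) isCompact_Icc.measure_lt_top
        exact ENNReal.rpow_lt_top_of_nonneg hγ0.le
          (ENNReal.add_ne_top.2 ⟨ENNReal.coe_ne_top, ENNReal.coe_ne_top⟩)

/-- Joint measurability of `u` is not assumed. The integral is a countable supremum of integrals of
truncations at height `N`, each continuous in time because `u` is continuous in `H¹`. -/
theorem IsSolution.aemeasurable_lintegral_rpow (hA : IsAdmissible d b σ)
    (hu : IsSolution c b σ I u₀ u) (m : ℝ) {α β : ℝ} (hI : Set.Icc α β ⊆ I) :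
    AEMeasurable (fun t => ∫⁻ x in annulus d m, ‖u t x‖ₑ ^ (2 * (σ + 1)))
      (volume.restrict (Set.Icc α β)) := by
  set q := 2 * (σ + 1) with hq
  have hq0 : 0 < q := by have := hA.σ_pos; positivity
  have hfin : IsFiniteMeasure (volume.restrict (annulus d m)) :=
    ⟨by rw [Measure.restrict_apply_univ]; exact (isCompact_annulus m).measure_lt_top⟩
  have hΦc : ∀ N : ℕ, Continuous fun z : ℂ => min (‖z‖ ^ q) N := fun N =>
    (continuous_norm.rpow_const fun _ => Or.inr hq0.le).min continuous_const
  have hc : ∀ N : ℕ, ContinuousOn (fun t => ∫ x in annulus d m, min (‖u t x‖ ^ q) (N : ℝ)) I := by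
    intro N
    refine hu.contH1.continuousOn_integral hA.three_le (μ := volume.restrict (annulus d m))
      Measure.restrict_le_self (Φ := fun _ z _ => min (‖z‖ ^ q) (N : ℝ))
      ((hΦc N).measurable.comp (measurable_fst.comp measurable_snd))
      (fun x => (hΦc N).comp continuous_fst) (h := fun _ => (N : ℝ)) (integrable_const _)
      le_rfl fun x z w => ?_
    rw [Real.norm_eq_abs, abs_of_nonneg (le_min (by positivity) (by positivity)), zero_mul, add_zero]
    exact min_le_right _ _
  have hm : AEMeasurable (fun t => ⨆ N : ℕ, ENNReal.ofReal
      (∫ x in annulus d m, min (‖u t x‖ ^ q) (N : ℝ))) (volume.restrict (Set.Icc α β)) :=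
    AEMeasurable.iSup fun N =>
      (((hc N).mono hI).aemeasurable measurableSet_Icc).ennreal_ofReal
  refine hm.congr ((ae_restrict_mem measurableSet_Icc).mono fun t ht => ?_)
  have hut := (hu.contH1.1 t (hI ht)).1.1
  have hum : ∀ N : ℕ, AEStronglyMeasurable (fun x => min (‖u t x‖ ^ q) (N : ℝ))
      (volume.restrict (annulus d m)) := fun N =>
    ((hΦc N).comp_aestronglyMeasurable hut).restrict
  have h1 : ∀ N : ℕ, ENNReal.ofReal (∫ x in annulus d m, min (‖u t x‖ ^ q) (N : ℝ))
      = ∫⁻ x in annulus d m, ENNReal.ofReal (min (‖u t x‖ ^ q) (N : ℝ)) := by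
    intro N
    have hnn : ∀ x, 0 ≤ min (‖u t x‖ ^ q) (N : ℝ) := fun x => le_min (by positivity) (by positivity)
    refine ofReal_integral_eq_lintegral_ofReal ?_ (Eventually.of_forall hnn)
    refine (integrable_const (N : ℝ)).mono' (hum N) (Eventually.of_forall fun x => ?_)
    rw [Real.norm_eq_abs, abs_of_nonneg (hnn x)]
    exact min_le_right _ _
  simp only [h1]
  rw [← lintegral_iSup' (fun N => (hum N).aemeasurable.ennreal_ofReal)
    (Eventually.of_forall fun x N N' h => ENNReal.ofReal_le_ofReal
      (min_le_min_left _ (Nat.cast_le.2 h)))]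
  refine lintegral_congr fun x => ?_
  have h2 : ‖u t x‖ₑ ^ q = ENNReal.ofReal (‖u t x‖ ^ q) := by
    rw [← ofReal_norm, ENNReal.ofReal_rpow_of_nonneg (norm_nonneg _) hq0.le]
  rw [h2]
  refine le_antisymm (iSup_le fun N => ENNReal.ofReal_le_ofReal (min_le_left _ _)) ?_
  obtain ⟨N, hN⟩ := exists_nat_ge (‖u t x‖ ^ q)
  exact le_iSup_of_le N (by rw [min_eq_left hN])

end Solution

end INLS
end

/-! ### The integrated virial identity with cutoffs. -/

noncomputable section
namespace INLS

variable {d : ℕ}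

section

variable {c b σ : ℝ} {I : Set ℝ} {u₀ : Space d → ℂ} {u : ℝ → Space d → ℂ} {ψ k : ℝ → ℝ}

theorem actForm_eq_re {f : Space d → ℂ} {g : Space d → EuclideanSpace ℂ (Fin d)} (hψ : IsCut ψ)
    (hk : IsCut k) (hf : MemLp f 2 volume) (hg : MemLp g 2 volume) :
    actForm ψ k f g = (∫ x, f x * star (act ψ k x (f x) (g x))).re := by
  have := integral_re (hf.integrable_mul (memLp_act hψ hk hf hg))
  simp only [RCLike.re_to_complex, Pi.mul_apply] at this
  exact this

theorem tendsto_actForm_mol {f : Space d → ℂ} {g : Space d → EuclideanSpace ℂ (Fin d)}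
    (hψ : IsCut ψ) (hk : IsCut k) (hf : MemLp f 2 volume) (hg : MemLp g 2 volume) :
    Tendsto (fun n => actForm ψ k (mol n f) (mol n g)) atTop (𝓝 (actForm ψ k f g)) := by
  have h := tendsto_integral_mul_of_eLpNorm hf (memLp_act hψ hk hf hg) (fun n => memLp_mol n hf)
    (fun n => memLp_act hψ hk (memLp_mol n hf) (memLp_mol n hg)) (tendsto_eLpNorm_mol_sub hf)
    (tendsto_act_mol hψ hk hf hg)
  rw [actForm_eq_re hψ hk hf hg]
  refine ((Complex.continuous_re.tendsto _).comp h).congr fun n => ?_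
  exact (actForm_eq_re hψ hk (memLp_mol n hf) (memLp_mol n hg)).symm

theorem norm_rpow_eq_toReal (z : ℂ) {q : ℝ} (hq : 0 ≤ q) :
    ‖z‖ₑ ^ q = ENNReal.ofReal (‖z‖ ^ q) := by
  rw [← ofReal_norm, ENNReal.ofReal_rpow_of_nonneg (norm_nonneg _) hq]

/-- The virial identity for quadratic forms with radial cutoffs. -/
theorem IsSolution.actForm_sub_eq (hA : IsAdmissible d b σ) (hu : IsSolution c b σ I u₀ u)
    (hψ : IsCut ψ) (hk : IsCut k) {α β : ℝ} (hαβ : α ≤ β) (hI : Set.Icc α β ⊆ I) :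
    actForm ψ k (u β) (weakGrad (u β)) - actForm ψ k (u α) (weakGrad (u α))
      = ∫ t in α..β, ∫ x, virDens c b σ ψ k x (u t x) (weakGrad (u t) x) := by
  obtain ⟨m, hmψ, hmk⟩ : ∃ m : ℝ, (∀ s, m < |s| → ψ s = 0) ∧ ∀ s, m < |s| → k s = 0 := by
    obtain ⟨m₁, -, h1⟩ := hψ.exists_zero
    obtain ⟨m₂, -, h2⟩ := hk.exists_zero
    exact ⟨max m₁ m₂, fun s hs => h1 s ((le_max_left _ _).trans_lt hs),
      fun s hs => h2 s ((le_max_right _ _).trans_lt hs)⟩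
  have hq0 : 0 ≤ 2 * (σ + 1) := by have := hA.σ_pos; positivity
  have hp := fun t (ht : t ∈ Set.Icc α β) => (hu.contH1.1 t (hI ht)).isPair
  obtain ⟨N, hN⟩ := exists_testOn_mol d m
  set P : ℕ → ℝ → ℝ := fun n t => 2 * (Complex.I * pairing c b σ (u t) (weakGrad (u t))
        (mol n fun x => star (act ψ k x (mol n (u t) x) (mol n (weakGrad (u t)) x)))).re with hP
  set F : ℕ → ℝ → ℝ := fun n t => actForm ψ k (mol n (u t)) (mol n (weakGrad (u t))) with hF
  have hFd : ∀ n, N ≤ n → ∀ t ∈ Set.Icc α β, HasDerivWithinAt (F n) (P n t) (Set.Icc α β) t :=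
    fun n hn t ht => hu.hasDerivWithinAt_actForm_mol hA hψ hk hmψ hmk (hN n hn) hI ht
  have hFd' : ∀ n, N ≤ n → ∀ t ∈ Set.Ioo α β, HasDerivAt (F n) (P n t) t := fun n hn t ht =>
    (hFd n hn t (Set.Ioo_subset_Icc_self ht)).hasDerivAt (Icc_mem_nhds ht.1 ht.2)
  set nl : ℝ → ℝ≥0∞ := fun t => ∫⁻ x in annulus d (m + 1), ‖u t x‖ₑ ^ (2 * (σ + 1)) with hnl
  have hnlm : AEMeasurable nl (volume.restrict (Set.Icc α β)) :=
    hu.aemeasurable_lintegral_rpow hA (m + 1) hI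
  have hnlt := hu.lintegral_lintegral_rpow_lt_top hA (m + 1) hI
  have hnli : Integrable (fun t => (nl t).toReal) (volume.restrict (Set.Icc α β)) :=
    integrable_toReal_of_lintegral_ne_top hnlm hnlt.ne
  -- Finiteness holds for almost every time only, so the limit and the uniform bound below are
  -- statements almost everywhere in `t`.
  have hnlae : ∀ᵐ t ∂(volume.restrict (Set.Icc α β)), nl t < ⊤ := ae_lt_top' hnlm hnlt.ne
  have hIL : ∀ t ∈ Set.Icc α β, nl t < ⊤ →
      IntegrableOn (fun x => ‖u t x‖ ^ (2 * (σ + 1))) (annulus d (m + 1)) volume := by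
    intro t ht hlt
    refine ⟨((hp t ht).left.1.norm.aemeasurable.pow_const _).aestronglyMeasurable.restrict, ?_⟩
    rw [hasFiniteIntegral_iff_ofReal (Eventually.of_forall fun x => by positivity)]
    refine lt_of_le_of_lt (le_of_eq (lintegral_congr fun x => ?_)) hlt
    exact (norm_rpow_eq_toReal _ hq0).symm
  obtain ⟨C, hC, hCb⟩ := exists_two_mul_re_pairing_mol_le (d := d) (b := b) (σ := σ) hA c hψ hk
    hmψ hmk
  obtain ⟨C', hC', hCb'⟩ := exists_norm_cutPot_sq_le (d := d) hA c (m + 1)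
  obtain ⟨E, hE, hEb⟩ := hu.contH1.exists_energy_le hA.three_le hI
  have hbound : ∀ n, N ≤ n → ∀ᵐ t ∂(volume.restrict (Set.Icc α β)),
      ‖P n t‖ ≤ C * (E + E) + C' * E + C' * (nl t).toReal := by
    intro n hn
    filter_upwards [hnlae, ae_restrict_mem measurableSet_Icc] with t hlt ht
    have hpt := hp t ht
    have iL := hIL t ht hlt
    have hd := hpt.integrable_dens hA.three_le
    have e1 : ∫ x, ‖u t x‖ ^ 2 ≤ E := (integral_mono (integrable_norm_sq_of_memLp hpt.left) hd
      fun x => (le_dens _ x _ _).1).trans (hEb t ht)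
    have e2 : ∫ x, ‖weakGrad (u t) x‖ ^ 2 ≤ E := (integral_mono
      (integrable_norm_sq_of_memLp hpt.right) hd fun x => (le_dens _ x _ _).2.1).trans (hEb t ht)
    have hLp := memLp_cutPot (c := c) hA hpt.left iL
    have iI := iL.integrable_indicator (measurableSet_annulus (m + 1))
    have iu := integrable_norm_sq_of_memLp hpt.left
    have e3 : ∫ x, ‖cutPot c b σ (m + 1) (u t) x‖ ^ 2 ≤ C' * E + C' * (nl t).toReal := by
      refine (integral_mono (integrable_norm_sq_of_memLp hLp)
        ((iu.const_mul C').add (iI.const_mul C')) fun x => hCb' (u t) x).trans ?_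
      simp only [Pi.add_apply]
      rw [integral_add (iu.const_mul C') (iI.const_mul C'), integral_const_mul, integral_const_mul,
        integral_indicator (measurableSet_annulus (m + 1))]
      have e4 : ∫ x in annulus d (m + 1), ‖u t x‖ ^ (2 * (σ + 1)) = (nl t).toReal := by
        rw [integral_eq_lintegral_of_nonneg_ae (Eventually.of_forall fun x => by positivity) iL.1]
        congr 1
        exact lintegral_congr fun x => (norm_rpow_eq_toReal _ hq0).symm
      rw [e4]
      gcongr
    have h1 := hCb n (hN n hn) _ _ hpt hLp
    rw [Real.norm_eq_abs]
    have h2 := mul_le_mul_of_nonneg_left (add_le_add e1 e2) hC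
    linarith
  have hbi : Integrable (fun t => C * (E + E) + C' * E + C' * (nl t).toReal)
      (volume.restrict (Set.Icc α β)) := (integrable_const _).add (hnli.const_mul C')
  have hIoc : volume.restrict (Set.Ioc α β) = (volume : Measure ℝ).restrict (Set.Icc α β) :=
    Measure.restrict_congr_set Ioc_ae_eq_Icc
  have hIoo : volume.restrict (Set.Ioo α β) = (volume : Measure ℝ).restrict (Set.Icc α β) :=
    Measure.restrict_congr_set Ioo_ae_eq_Icc
  -- Measurability in time is obtained by recognising `P n` as the derivative of `F n` on the open
  -- interval.
  have hPm : ∀ n, N ≤ n → AEStronglyMeasurable (P n) (volume.restrict (Set.Icc α β)) := by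
    intro n hn
    rw [← hIoo]
    exact (aestronglyMeasurable_deriv (F n) _).congr
      ((ae_restrict_mem measurableSet_Ioo).mono fun t ht => (hFd' n hn t ht).deriv)
  -- For fixed `n` the derivative exists everywhere and is integrable, which is enough for the
  -- fundamental theorem of calculus; continuity of `P n` is not required.
  have hftc : ∀ n, N ≤ n → ∫ t in Set.Icc α β, P n t = F n β - F n α := by
    intro n hn
    have hi : IntervalIntegrable (P n) volume α β := by
      rw [intervalIntegrable_iff_integrableOn_Ioc_of_le hαβ, IntegrableOn, hIoc]
      exact hbi.mono' (hPm n hn) (hbound n hn)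
    rw [← intervalIntegral.integral_eq_sub_of_hasDerivAt_of_le hαβ
      (fun t ht => (hFd n hn t ht).continuousWithinAt) (hFd' n hn) hi,
      intervalIntegral.integral_of_le hαβ, hIoc]
  have hlim : ∀ᵐ t ∂(volume.restrict (Set.Icc α β)), Tendsto (fun n => P n t) atTop
      (𝓝 (∫ x, virDens c b σ ψ k x (u t x) (weakGrad (u t) x))) := by
    filter_upwards [hnlae, ae_restrict_mem measurableSet_Icc] with t hlt ht
    have hpt := hp t ht
    have iL := hIL t ht hlt
    rw [← hpt.integral_virDens hA hψ hk hmψ hmk iL]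
    exact tendsto_two_mul_re_pairing_mol hA hpt hψ hk hmψ hmk (memLp_cutPot hA hpt.left iL)
  -- The mollification is removed under the time integral, the dominating function being `hbi`,
  -- integrable by the space-time bound on the nonlinearity.
  have hdct : Tendsto (fun n => ∫ t in Set.Icc α β, P n t) atTop
      (𝓝 (∫ t in Set.Icc α β, ∫ x, virDens c b σ ψ k x (u t x) (weakGrad (u t) x))) := by
    refine tendsto_integral_filter_of_dominated_convergence _ ?_ ?_ hbi hlim
    · filter_upwards [eventually_ge_atTop N] with n hn using hPm n hn
    · filter_upwards [eventually_ge_atTop N] with n hn using hbound n hn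
  have hFlim : ∀ t ∈ Set.Icc α β, Tendsto (fun n => F n t) atTop
      (𝓝 (actForm ψ k (u t) (weakGrad (u t)))) := fun t ht =>
    tendsto_actForm_mol hψ hk (hp t ht).left (hp t ht).right
  have h1 := (hFlim β (Set.right_mem_Icc.2 hαβ)).sub (hFlim α (Set.left_mem_Icc.2 hαβ))
  have h2 : Tendsto (fun n => F n β - F n α) atTop
      (𝓝 (∫ t in Set.Icc α β, ∫ x, virDens c b σ ψ k x (u t x) (weakGrad (u t) x))) := by
    refine hdct.congr' ?_
    filter_upwards [eventually_ge_atTop N] with n hn using hftc n hn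
  rw [intervalIntegral.integral_of_le hαβ, hIoc]
  exact tendsto_nhds_unique h1 h2

end

end INLS
end

/-! ### Dilated cutoffs and the passage to the limit in them. -/

noncomputable section
namespace INLS

variable {d : ℕ}

/-- Cutoffs whose logarithmic derivatives are uniformly bounded. -/
theorem exists_cutoffs : ∃ (κ : ℕ → ℝ → ℝ) (C : ℝ), 0 ≤ C ∧ (∀ n, IsCut (κ n)) ∧
    (∀ n s, |κ n s| ≤ 1 ∧ |deriv (κ n) s| ≤ C ∧ |deriv (deriv (κ n)) s| ≤ C) ∧
    ∀ s, ∀ᶠ n in atTop, κ n s = 1 ∧ deriv (κ n) s = 0 ∧ deriv (deriv (κ n)) s = 0 := by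
  obtain ⟨κ, -, hκ, hκ1, -, hκb⟩ := exists_isCut_eq_one 1
  obtain ⟨C₁, h1, b1⟩ := hκ.deriv.exists_bound
  obtain ⟨C₂, h2, b2⟩ := hκ.deriv.deriv.exists_bound
  -- Dilation takes place in `log ‖x‖`: each derivative gains a factor `a n ≤ 1`, and near any fixed
  -- `s` the cutoff is eventually identically one.
  set a : ℕ → ℝ := fun n => ((n : ℝ) + 1)⁻¹ with ha
  have ha0 : ∀ n, 0 < a n := fun n => by positivity
  have ha1 : ∀ n, a n ≤ 1 := fun n => inv_le_one_of_one_le₀ (by linarith [n.cast_nonneg (α := ℝ)])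
  have d1 : ∀ n, deriv (fun s => κ (a n * s)) = fun s => a n * deriv κ (a n * s) := fun n => by
    ext s
    rw [deriv_comp_mul_left, smul_eq_mul]
  have d2 : ∀ n, deriv (deriv (fun s => κ (a n * s)))
      = fun s => a n * (a n * deriv (deriv κ) (a n * s)) := fun n => by
    ext s
    rw [d1, deriv_const_mul_field, deriv_comp_mul_left, smul_eq_mul]
  refine ⟨fun n s => κ (a n * s), max C₁ C₂, le_max_of_le_left h1.le, fun n => ?_,
    fun n s => ⟨hκb _, ?_, ?_⟩, fun s => ?_⟩
  · have := hκ.comp_div (a := (n : ℝ) + 1) (by positivity)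
    simpa [ha, div_eq_inv_mul] using this
  · rw [d1, abs_mul, abs_of_pos (ha0 n)]
    calc _ ≤ 1 * C₁ := mul_le_mul (ha1 n) (b1 _) (abs_nonneg _) zero_le_one
      _ ≤ _ := by rw [one_mul]; exact le_max_left _ _
  · rw [d2, abs_mul, abs_mul, abs_of_pos (ha0 n)]
    calc _ ≤ 1 * (1 * C₂) := mul_le_mul (ha1 n) (mul_le_mul (ha1 n) (b2 _) (abs_nonneg _)
          zero_le_one) (mul_nonneg (ha0 n).le (abs_nonneg _)) zero_le_one
      _ ≤ _ := by rw [one_mul, one_mul]; exact le_max_right _ _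
  · obtain ⟨N, hN⟩ := exists_nat_gt |s|
    filter_upwards [eventually_ge_atTop N] with n hn
    have hs : |s| < (n : ℝ) + 1 := hN.trans_le (by
      have : (N : ℝ) ≤ n := Nat.cast_le.2 hn
      linarith)
    have hev : (fun s => κ (a n * s)) =ᶠ[𝓝 s] fun _ => 1 := by
      filter_upwards [continuous_abs.continuousAt.eventually (gt_mem_nhds hs)] with r hr
      refine hκ1 _ ?_
      rw [abs_mul, abs_of_pos (ha0 n), ha, inv_mul_le_iff₀ (by positivity), mul_one]
      exact hr.le
    refine ⟨hev.self_of_nhds, ?_, ?_⟩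
    · rw [hev.deriv_eq, deriv_const]
    · rw [hev.deriv.deriv_eq]
      simp

theorem ae_ne_zero (hd : 3 ≤ d) : ∀ᵐ x : Space d, x ≠ 0 := by
  have : Nonempty (Fin d) := ⟨⟨0, by omega⟩⟩
  exact compl_mem_ae_iff.2 (measure_singleton 0)

/-- The fundamental theorem of calculus on an interval of arbitrary type. -/
theorem hasDerivWithinAt_of_sub_eq_integral {I : Set ℝ} (hI : I.OrdConnected) {F G : ℝ → ℝ}
    (hG : ContinuousOn G I)
    (h : ∀ α ∈ I, ∀ β ∈ I, F β - F α = ∫ t in α..β, G t) {t : ℝ} (ht : t ∈ I) :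
    HasDerivWithinAt F (G t) I t := by
  rw [hasDerivWithinAt_iff_isLittleO, Asymptotics.isLittleO_iff]
  intro ε hε
  obtain ⟨δ, hδ, hδG⟩ := Metric.continuousWithinAt_iff.1 (hG t ht) ε hε
  filter_upwards [self_mem_nhdsWithin, mem_nhdsWithin_of_mem_nhds (Metric.ball_mem_nhds t hδ)] with
    s hs hst
  have hsub : Set.uIcc t s ⊆ I := hI.uIcc_subset ht hs
  have e : F s - F t - (s - t) • G t = ∫ τ in t..s, (G τ - G t) := by
    rw [h t ht s hs, intervalIntegral.integral_sub (hG.mono hsub).intervalIntegrable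
      intervalIntegrable_const, intervalIntegral.integral_const]
  rw [e]
  refine intervalIntegral.norm_integral_le_of_norm_le_const fun τ hτ => ?_
  have hτ' := Set.uIoc_subset_uIcc hτ
  refine (hδG (hsub hτ') ?_).le
  refine lt_of_le_of_lt ?_ hst
  rw [dist_comm τ t, dist_comm s t]
  exact Real.dist_left_le_of_mem_uIcc hτ'

section

variable {c b σ : ℝ} {I : Set ℝ} {u₀ : Space d → ℂ} {u : ℝ → Space d → ℂ}

theorem IsSolution.actForm_sub_eq' (hA : IsAdmissible d b σ) (hu : IsSolution c b σ I u₀ u)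
    {ψ k : ℝ → ℝ} (hψ : IsCut ψ) (hk : IsCut k) {α β : ℝ} (hα : α ∈ I) (hβ : β ∈ I) :
    actForm ψ k (u β) (weakGrad (u β)) - actForm ψ k (u α) (weakGrad (u α))
      = ∫ t in α..β, ∫ x, virDens c b σ ψ k x (u t x) (weakGrad (u t) x) := by
  rcases le_total α β with h | h
  · exact hu.actForm_sub_eq hA hψ hk h (hu.ordConnected.out hα hβ)
  · rw [intervalIntegral.integral_symm, ← hu.actForm_sub_eq hA hψ hk h (hu.ordConnected.out hβ hα)]
    ring

theorem ContH1.continuousOn_integral_virDens (hA : IsAdmissible d b σ) (c : ℝ) (hu : ContH1 I u)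
    {ψ k : ℝ → ℝ} (hψ : IsCut ψ) (hk : IsCut k) :
    ContinuousOn (fun t => ∫ x, virDens c b σ ψ k x (u t x) (weakGrad (u t) x)) I := by
  obtain ⟨C, hC, hb⟩ := exists_abs_virDens_le (d := d) hA c hψ hk
  refine hu.continuousOn_integral hA.three_le le_rfl (measurable_virDens hψ hk)
    (continuous_virDens hA.σ_pos hψ hk) (integrable_zero _ _ _) hC fun x z w => ?_
  rw [Pi.zero_apply, zero_add]
  exact hb x z w

theorem ContH1.continuousOn_actForm (hd : 3 ≤ d) (hu : ContH1 I u) {ψ k : ℝ → ℝ} (hψ : IsCut ψ)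
    (hk : IsCut k) : ContinuousOn (fun t => actForm ψ k (u t) (weakGrad (u t))) I := by
  obtain ⟨C, hC, hb⟩ := exists_norm_act_le (d := d) hψ hk
  have hc : Continuous fun p : Space d × ℂ × EuclideanSpace ℂ (Fin d) =>
      (p.2.1 * star (act ψ k p.1 p.2.1 p.2.2)).re :=
    Complex.continuous_re.comp ((by fun_prop : Continuous
      fun p : Space d × ℂ × EuclideanSpace ℂ (Fin d) => p.2.1).mul
        (continuous_star.comp (continuous_act hψ hk)))
  refine hu.continuousOn_integral hd le_rfl
    (Φ := fun x z w => (z * star (act ψ k x z w)).re) hc.measurable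
    (fun x => hc.comp (by fun_prop : Continuous fun p : ℂ × EuclideanSpace ℂ (Fin d) =>
      (x, p.1, p.2))) (integrable_zero _ _ _) (by positivity : 0 ≤ 2 * C) fun x z w => ?_
  obtain ⟨h1, h2, -, -⟩ := le_dens (sobolevExp d) x z w
  rw [Pi.zero_apply, zero_add]
  refine (Complex.abs_re_le_norm _).trans ?_
  rw [norm_mul, norm_star]
  calc _ ≤ ‖z‖ * (C * (‖z‖ + ‖w‖)) := by gcongr; exact hb x z w
    _ = C * (‖z‖ * (‖z‖ + ‖w‖)) := by ring
    _ ≤ C * (2 * dens hardyWeight (sobolevExp d) x z w) := by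
        refine mul_le_mul_of_nonneg_left ?_ hC
        nlinarith [sq_nonneg (‖z‖ - ‖w‖)]
    _ = _ := by ring

/-- Passing to the limit in the cutoffs. -/
theorem IsSolution.sub_eq_of_tendsto (hA : IsAdmissible d b σ) (hu : IsSolution c b σ I u₀ u)
    {ψ k : ℕ → ℝ → ℝ} (hψ : ∀ n, IsCut (ψ n)) (hk : ∀ n, IsCut (k n)) {F G : ℝ → ℝ}
    (hF : ∀ t ∈ I, Tendsto (fun n => actForm (ψ n) (k n) (u t) (weakGrad (u t))) atTop (𝓝 (F t)))
    (hG : ∀ t ∈ I, Tendsto (fun n => ∫ x, virDens c b σ (ψ n) (k n) x (u t x) (weakGrad (u t) x))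
      atTop (𝓝 (G t)))
    (hb : ∀ t₁ ∈ I, ∀ t₂ ∈ I, ∃ C, ∀ n, ∀ t ∈ Set.uIcc t₁ t₂,
      |∫ x, virDens c b σ (ψ n) (k n) x (u t x) (weakGrad (u t) x)| ≤ C)
    {α β : ℝ} (hα : α ∈ I) (hβ : β ∈ I) : F β - F α = ∫ t in α..β, G t := by
  obtain ⟨C, hC⟩ := hb α hα β hβ
  have hsub : Set.uIcc α β ⊆ I := hu.ordConnected.uIcc_subset hα hβ
  have h1 : Tendsto (fun n => ∫ t in α..β, ∫ x, virDens c b σ (ψ n) (k n) x (u t x)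
      (weakGrad (u t) x)) atTop (𝓝 (∫ t in α..β, G t)) := by
    refine intervalIntegral.tendsto_integral_filter_of_dominated_convergence (fun _ => C)
      (Eventually.of_forall fun n => ?_) (Eventually.of_forall fun n => ?_)
      intervalIntegrable_const ?_
    · exact (((hu.contH1.continuousOn_integral_virDens hA c (hψ n) (hk n)).mono
        (Set.uIoc_subset_uIcc.trans hsub)).aestronglyMeasurable measurableSet_uIoc)
    · exact Eventually.of_forall fun t ht => hC n t (Set.uIoc_subset_uIcc ht)
    · exact Eventually.of_forall fun t ht => hG t (hsub (Set.uIoc_subset_uIcc ht))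
  refine tendsto_nhds_unique ((hF β hβ).sub (hF α hα)) (h1.congr fun n => ?_)
  exact (hu.actForm_sub_eq' hA (hψ n) (hk n) hα hβ).symm

end

end INLS
end

/-! ### Densities for the variance and for the momentum. -/

noncomputable section
namespace INLS

variable {d : ℕ}

/-- The profile of the weight `κ² ‖x‖²`. -/
def sqProfile (κ : ℝ → ℝ) (s : ℝ) : ℝ := κ s * κ s * Real.exp (2 * s)

theorem IsCut.sqProfile {κ : ℝ → ℝ} (hκ : IsCut κ) : IsCut (sqProfile κ) :=
  (hκ.mul_left hκ.1).mul_exp 2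

section

variable {c b σ : ℝ} {κ : ℝ → ℝ} {x : Space d} {z : ℂ} {w : EuclideanSpace ℂ (Fin d)}

theorem rad_sqProfile (hx : x ≠ 0) : rad (sqProfile κ) x = (κ (Real.log ‖x‖) * ‖x‖) ^ 2 := by
  have h : rad (fun s => κ s * κ s * Real.exp (2 * s)) x = _ := rad_mul_exp _ _ _
  rw [show sqProfile κ = fun s => κ s * κ s * Real.exp (2 * s) from rfl, h, rad_of_ne _ hx,
    Real.rpow_two]
  ring

theorem rad_zero_profile (x : Space d) : rad (fun _ => 0) x = 0 := by
  unfold rad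
  split_ifs <;> rfl

theorem radDeriv_zero : radDeriv (fun _ => 0) = fun _ => 0 := by
  ext s
  simp [radDeriv]

theorem rad_radDeriv (k : ℝ → ℝ) (hx : x ≠ 0) :
    rad (radDeriv k) x = deriv k (Real.log ‖x‖) * ‖x‖ ^ (-2 : ℝ) := by
  have h : rad (fun s => deriv k s * Real.exp ((-2) * s)) x = _ := rad_mul_exp _ _ _
  rw [show radDeriv k = fun s => deriv k s * Real.exp ((-2) * s) from rfl, h, rad_of_ne _ hx]

theorem re_mul_star_act_sqProfile (κ : ℝ → ℝ) (x : Space d) (z : ℂ)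
    (w : EuclideanSpace ℂ (Fin d)) :
    (z * star (act (sqProfile κ) (fun _ => 0) x z w)).re = rad (sqProfile κ) x * ‖z‖ ^ 2 := by
  have h : (fun s : ℝ => (d : ℝ) * (fun _ : ℝ => (0 : ℝ)) s + deriv (fun _ => 0) s)
      = fun _ => 0 := by
    ext s
    simp
  rw [act, h, rad_zero_profile, Complex.sq_norm, Complex.normSq_apply]
  simp
  ring

/-- The profile `κ² e^{2s}` has derivative `2κ(κ + κ')e^{2s}`, and the exponential cancels the
`‖x‖⁻²` of the radial derivative. -/
theorem virDens_sqProfile (hκ : IsCut κ) (hx : x ≠ 0) :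
    virDens c b σ (sqProfile κ) (fun _ => 0) x z w
      = 4 * (κ (Real.log ‖x‖) * (κ (Real.log ‖x‖) + deriv κ (Real.log ‖x‖)))
        * (star z * xdot x w).im := by
  have h : (fun s : ℝ => (d : ℝ) * (fun _ : ℝ => (0 : ℝ)) s + deriv (fun _ => 0) s)
      = fun _ => 0 := by
    ext s
    simp
  rw [virDens, commDens, h, radDeriv_zero, rad_zero_profile, rad_radDeriv _ hx,
    ← norm_sq_mul_exp hx]
  set s := Real.log ‖x‖
  have h1 := (hκ.1.differentiable (by simp) s).hasDerivAt
  have h2 : HasDerivAt (fun s => Real.exp (2 * s)) (Real.exp (2 * s) * 2) s := by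
    have := ((hasDerivAt_id s).const_mul 2).exp
    simpa using this
  have h3 : HasDerivAt (sqProfile κ) _ s := (h1.mul h1).mul h2
  have he : Real.exp (2 * s) * Real.exp (-2 * s) = 1 := by
    rw [← Real.exp_add]
    simp
  rw [h3.deriv]
  simp only [Pi.mul_apply]
  linear_combination (2 * (deriv κ s * κ s + κ s * deriv κ s + 2 * κ s * κ s)
    * (star z * xdot x w).im) * he

theorem norm_star_mul_xdot_le (x : Space d) (z : ℂ) (w : EuclideanSpace ℂ (Fin d)) :
    ‖star z * xdot x w‖ ≤ ‖x‖ * ‖z‖ * ‖w‖ := by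
  rw [norm_mul, norm_star]
  calc _ ≤ ‖z‖ * (‖x‖ * ‖w‖) := by gcongr; exact norm_xdot_le x w
    _ = _ := by ring

/-- The cutoff is squared for this estimate: one factor `κ‖x‖‖z‖` is the square root of the
truncated variance density, so Young's inequality closes with an arbitrarily small multiple of that
density. -/
theorem abs_virDens_sqProfile_le (hκ : IsCut κ) (hx : x ≠ 0) {C ε : ℝ} (hε : 0 < ε)
    (h0 : ∀ s, |κ s| ≤ 1) (h1 : ∀ s, |deriv κ s| ≤ C) :
    |virDens c b σ (sqProfile κ) (fun _ => 0) x z w|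
      ≤ ε * (rad (sqProfile κ) x * ‖z‖ ^ 2) + (4 * (1 + C) ^ 2 / ε) * ‖w‖ ^ 2 := by
  have hC : 0 ≤ C := (abs_nonneg _).trans (h1 0)
  rw [virDens_sqProfile hκ hx, rad_sqProfile hx]
  set s := Real.log ‖x‖
  have e1 : |κ s + deriv κ s| ≤ 1 + C := (abs_add_le _ _).trans (add_le_add (h0 s) (h1 s))
  have e2 := (Complex.abs_im_le_norm _).trans (norm_star_mul_xdot_le x z w)
  rw [abs_mul, abs_mul, abs_mul, abs_of_pos (by norm_num : (0 : ℝ) < 4)]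
  set p := |κ s| * ‖x‖ * ‖z‖ with hp
  have hp2 : (κ s * ‖x‖) ^ 2 * ‖z‖ ^ 2 = p ^ 2 := by
    rw [hp, mul_pow, mul_pow, mul_pow, sq_abs]
  rw [hp2]
  calc 4 * (|κ s| * |κ s + deriv κ s|) * |(star z * xdot x w).im|
      ≤ 4 * (|κ s| * (1 + C)) * (‖x‖ * ‖z‖ * ‖w‖) := by gcongr
    _ = 2 * (ε * p) * (2 * (1 + C) / ε * ‖w‖) := by
        rw [hp]
        field_simp
        ring
    _ ≤ _ := by
        have h3 : ε * p ^ 2 + (4 * (1 + C) ^ 2 / ε) * ‖w‖ ^ 2 - 2 * (ε * p) * (2 * (1 + C) / ε * ‖w‖)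
            = ε * (p - 2 * (1 + C) / ε * ‖w‖) ^ 2 := by
          field_simp
          ring
        nlinarith [mul_nonneg hε.le (sq_nonneg (p - 2 * (1 + C) / ε * ‖w‖))]

theorem re_mul_star_act_zero (k : ℝ → ℝ) (x : Space d) (z : ℂ) (w : EuclideanSpace ℂ (Fin d)) :
    (z * star (act (fun _ => 0) k x z w)).re = rad k x * (star z * xdot x w).im := by
  rw [act, rad_zero_profile]
  simp
  ring

/-- The density of the second derivative of the variance, up to the factor `4`. -/
def limDens (c b σ : ℝ) (x : Space d) (z : ℂ) (w : EuclideanSpace ℂ (Fin d)) : ℝ :=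
  2 * (‖w‖ ^ 2 + c * ‖x‖ ^ (-2 : ℝ) * ‖z‖ ^ 2)
    - (d * σ + 2 * b) / (σ + 2) * (‖x‖ ^ (-b) * ‖z‖ ^ (σ + 2))

theorem virDens_zero (hκ : IsCut κ) (hx : x ≠ 0) :
    virDens c b σ (fun _ => 0) κ x z w
      = 2 * (deriv κ (Real.log ‖x‖) * ‖x‖ ^ (-2 : ℝ)) * ‖xdot x w‖ ^ 2
        + 2 * κ (Real.log ‖x‖) * ‖w‖ ^ 2
        + (d * deriv κ (Real.log ‖x‖) + deriv (deriv κ) (Real.log ‖x‖)) * ‖x‖ ^ (-2 : ℝ)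
          * (star z * xdot x w).re
        + 2 * c * (κ (Real.log ‖x‖) * (‖x‖ ^ (-2 : ℝ) * ‖z‖ ^ 2))
        + ((2 / (σ + 2) - 1) * ((d * κ (Real.log ‖x‖) + deriv κ (Real.log ‖x‖))
            * (‖x‖ ^ (-b) * ‖z‖ ^ (σ + 2)))
          - 2 * b / (σ + 2) * (κ (Real.log ‖x‖) * (‖x‖ ^ (-b) * ‖z‖ ^ (σ + 2)))) := by
  rw [virDens, commDens, radDeriv_zero, rad_zero_profile, rad_radDeriv _ hx, rad_radDeriv _ hx,
    rad_of_ne _ hx, rad_of_ne _ hx]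
  set s := Real.log ‖x‖
  have h1 := (hκ.1.differentiable (by simp) s).hasDerivAt
  have h2 := (hκ.deriv.1.differentiable (by simp) s).hasDerivAt
  have h3 : HasDerivAt (fun s => d * κ s + deriv κ s) _ s := (h1.const_mul (d : ℝ)).add h2
  rw [h3.deriv]
  ring

/-- The constant depends on the cutoff only through bounds on its logarithmic derivatives. The
errors carry `‖x‖⁻²|x·w|²` or `‖x‖⁻¹‖z‖‖w‖`, which are bounded by the gradient and Hardy densities.
-/
theorem exists_abs_virDens_zero_le (hA : IsAdmissible d b σ) (c : ℝ) {C : ℝ} (hC : 0 ≤ C) :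
    ∃ C' : ℝ, 0 ≤ C' ∧ ∀ κ : ℝ → ℝ, IsCut κ → (∀ s, |κ s| ≤ 1 ∧ |deriv κ s| ≤ C ∧
      |deriv (deriv κ) s| ≤ C) → ∀ (x : Space d) (z : ℂ) (w : EuclideanSpace ℂ (Fin d)), x ≠ 0 →
      |virDens c b σ (fun _ => 0) κ x z w| ≤ C' * dens hardyWeight (sobolevExp d) x z w := by
  have hσ2 : 0 < σ + 2 := by linarith [hA.σ_pos]
  refine ⟨2 * C + 2 + (d * C + C) + |2 * c| + (|2 / (σ + 2) - 1| * (d + C) + |2 * b / (σ + 2)|),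
    by positivity, fun κ hκ hb x z w hx => ?_⟩
  rw [virDens_zero hκ hx]
  obtain ⟨b0, b1, b2⟩ := hb (Real.log ‖x‖)
  set s := Real.log ‖x‖
  obtain ⟨d1, d2, d3, -⟩ := le_dens (sobolevExp d) x z w
  have d4 := hA.potential_le x z w
  set D := dens hardyWeight (sobolevExp d) x z w
  have hr : 0 < ‖x‖ := norm_pos_iff.2 hx
  have hrr : ‖x‖ ^ (-2 : ℝ) * ‖x‖ ^ 2 = 1 := by
    rw [← Real.rpow_two, ← Real.rpow_add hr]
    norm_num
  have hr2 : 0 ≤ ‖x‖ ^ (-2 : ℝ) := by positivity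
  have hD : 0 ≤ D := (sq_nonneg _).trans d1
  have bρ : |d * κ s + deriv κ s| ≤ d + C := by
    refine (abs_add_le _ _).trans (add_le_add ?_ b1)
    rw [abs_mul, Nat.abs_cast]
    exact (mul_le_mul_of_nonneg_left b0 (Nat.cast_nonneg d)).trans_eq (mul_one _)
  have bρ' : |d * deriv κ s + deriv (deriv κ) s| ≤ d * C + C := by
    refine (abs_add_le _ _).trans (add_le_add ?_ b2)
    rw [abs_mul, Nat.abs_cast]
    exact mul_le_mul_of_nonneg_left b1 (Nat.cast_nonneg d)
  have t1 : |2 * (deriv κ s * ‖x‖ ^ (-2 : ℝ)) * ‖xdot x w‖ ^ 2| ≤ 2 * C * D := by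
    rw [abs_mul, abs_mul, abs_mul, abs_two, abs_of_nonneg hr2, abs_of_nonneg (sq_nonneg ‖xdot x w‖)]
    calc _ ≤ 2 * (C * ‖x‖ ^ (-2 : ℝ)) * (‖x‖ * ‖w‖) ^ 2 := by gcongr; exact norm_xdot_le x w
      _ = 2 * C * ‖w‖ ^ 2 * (‖x‖ ^ (-2 : ℝ) * ‖x‖ ^ 2) := by ring
      _ ≤ _ := by rw [hrr, mul_one]; gcongr
  have t2 : |2 * κ s * ‖w‖ ^ 2| ≤ 2 * D := by
    rw [abs_mul, abs_mul, abs_two, abs_of_nonneg (sq_nonneg ‖w‖)]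
    calc _ ≤ 2 * 1 * D := by gcongr
      _ = _ := by ring
  have t3 : |(d * deriv κ s + deriv (deriv κ) s) * ‖x‖ ^ (-2 : ℝ) * (star z * xdot x w).re|
      ≤ (d * C + C) * D := by
    rw [abs_mul, abs_mul, abs_of_nonneg hr2]
    have e : ‖x‖ ^ (-2 : ℝ) * (‖x‖ * ‖z‖ * ‖w‖) ≤ D := by
      have e1 : ‖x‖ ^ (-2 : ℝ) * (‖x‖ * ‖z‖ * ‖w‖)
          ≤ 1 / 2 * (‖x‖ ^ (-2 : ℝ) * ‖z‖ ^ 2 + ‖x‖ ^ (-2 : ℝ) * ‖x‖ ^ 2 * ‖w‖ ^ 2) := by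
        nlinarith [mul_nonneg hr2 (sq_nonneg (‖z‖ - ‖x‖ * ‖w‖))]
      rw [hrr, one_mul] at e1
      linarith
    calc _ ≤ (d * C + C) * ‖x‖ ^ (-2 : ℝ) * (‖x‖ * ‖z‖ * ‖w‖) := by
          gcongr
          exact (Complex.abs_re_le_norm _).trans (norm_star_mul_xdot_le x z w)
      _ = (d * C + C) * (‖x‖ ^ (-2 : ℝ) * (‖x‖ * ‖z‖ * ‖w‖)) := by ring
      _ ≤ _ := by gcongr
  have t4 : |2 * c * (κ s * (‖x‖ ^ (-2 : ℝ) * ‖z‖ ^ 2))| ≤ |2 * c| * D := by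
    rw [abs_mul, abs_mul (κ s), abs_of_nonneg (by positivity : 0 ≤ ‖x‖ ^ (-2 : ℝ) * ‖z‖ ^ 2)]
    calc _ ≤ |2 * c| * (1 * D) := by gcongr
      _ = _ := by ring
  have hP : 0 ≤ ‖x‖ ^ (-b) * ‖z‖ ^ (σ + 2) := by positivity
  have t5 : |(2 / (σ + 2) - 1) * ((d * κ s + deriv κ s) * (‖x‖ ^ (-b) * ‖z‖ ^ (σ + 2)))|
      ≤ |2 / (σ + 2) - 1| * (d + C) * D := by
    rw [abs_mul, abs_mul (d * κ s + deriv κ s), abs_of_nonneg hP, mul_assoc]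
    gcongr
  have t6 : |2 * b / (σ + 2) * (κ s * (‖x‖ ^ (-b) * ‖z‖ ^ (σ + 2)))| ≤ |2 * b / (σ + 2)| * D := by
    rw [abs_mul, abs_mul (κ s), abs_of_nonneg hP]
    calc _ ≤ |2 * b / (σ + 2)| * (1 * D) := by gcongr
      _ = _ := by ring
  calc _ ≤ 2 * C * D + 2 * D + (d * C + C) * D + |2 * c| * D
        + (|2 / (σ + 2) - 1| * (d + C) * D + |2 * b / (σ + 2)| * D) := by
        refine (abs_add_le _ _).trans (add_le_add ((abs_add_le _ _).trans (add_le_add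
          ((abs_add_le _ _).trans (add_le_add ((abs_add_le _ _).trans (add_le_add t1 t2)) t3)) t4))
          ((abs_sub _ _).trans (add_le_add t5 t6)))
    _ = _ := by ring

/-- Where the cutoff is locally constant only the algebra `d(2/(σ+2) - 1) - 2b/(σ+2) = -(dσ +
2b)/(σ+2)` is left. -/
theorem virDens_zero_eq_limDens (hσ : 0 < σ) (hκ : IsCut κ) (hx : x ≠ 0)
    (h0 : κ (Real.log ‖x‖) = 1) (h1 : deriv κ (Real.log ‖x‖) = 0)
    (h2 : deriv (deriv κ) (Real.log ‖x‖) = 0) :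
    virDens c b σ (fun _ => 0) κ x z w = limDens c b σ x z w := by
  have hσ2 : σ + 2 ≠ 0 := by linarith
  rw [virDens_zero hκ hx, h0, h1, h2, limDens]
  field_simp
  ring

end

section

variable {c b σ : ℝ} {I : Set ℝ} {u : ℝ → Space d → ℂ}

theorem IsPair.integral_limDens (hA : IsAdmissible d b σ) {f : Space d → ℂ}
    (h : IsPair f (weakGrad f)) :
    ∫ x, limDens c b σ x (f x) (weakGrad f x)
      = 2 * normSqH1c c f - (d * σ + 2 * b) / (σ + 2) * potential b σ f := by
  have i1 : Integrable (fun x => ‖weakGrad f x‖ ^ 2 + c * ‖x‖ ^ (-2 : ℝ) * ‖f x‖ ^ 2) volume := by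
    have := (integrable_norm_sq_of_memLp h.right).add ((h.integrable_hardy hA.three_le).const_mul c)
    refine this.congr (Eventually.of_forall fun x => ?_)
    simp only [Pi.add_apply]
    ring
  have i2 := h.integrable_potential hA
  unfold limDens
  rw [integral_sub (i1.const_mul 2) (i2.const_mul _), integral_const_mul, integral_const_mul]
  rfl

theorem ContH1.continuousOn_integral_limDens (hA : IsAdmissible d b σ) (c : ℝ) (hu : ContH1 I u) :
    ContinuousOn (fun t => ∫ x, limDens c b σ x (u t x) (weakGrad (u t) x)) I := by
  have hσ := hA.σ_pos
  set a := (d * σ + 2 * b) / (σ + 2) with ha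
  refine hu.continuousOn_integral hA.three_le le_rfl (Φ := limDens c b σ) ?_ (fun x => ?_)
    (integrable_zero _ _ _) (by positivity : 0 ≤ 2 * (1 + |c|) + |a|) fun x z w => ?_
  · have h4 : ∀ a : ℝ, Measurable fun p : Space d × ℂ × EuclideanSpace ℂ (Fin d) => ‖p.1‖ ^ a :=
      fun a => (measurable_norm.comp measurable_fst).pow_const a
    have h5 : ∀ a : ℝ, Measurable fun p : Space d × ℂ × EuclideanSpace ℂ (Fin d) => ‖p.2.1‖ ^ a :=
      fun a => (measurable_norm.comp (measurable_fst.comp measurable_snd)).pow_const a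
    have h6 : Measurable fun p : Space d × ℂ × EuclideanSpace ℂ (Fin d) => ‖p.2.1‖ ^ 2 :=
      (measurable_norm.comp (measurable_fst.comp measurable_snd)).pow_const 2
    have h7 : Measurable fun p : Space d × ℂ × EuclideanSpace ℂ (Fin d) => ‖p.2.2‖ ^ 2 :=
      (measurable_norm.comp (measurable_snd.comp measurable_snd)).pow_const 2
    unfold limDens
    exact ((h7.add (((h4 _).const_mul c).mul h6)).const_mul 2).sub
      (((h4 _).mul (h5 _)).const_mul _)
  · have h2 : Continuous fun p : ℂ × EuclideanSpace ℂ (Fin d) => ‖p.1‖ ^ (σ + 2) :=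
      continuous_fst.norm.rpow_const fun _ => Or.inr (by linarith)
    unfold limDens
    fun_prop
  · obtain ⟨d1, d2, d3, -⟩ := le_dens (sobolevExp d) x z w
    have d4 := hA.potential_le x z w
    rw [Pi.zero_apply, zero_add, Real.norm_eq_abs]
    set D := dens hardyWeight (sobolevExp d) x z w
    have t1 : |2 * (‖w‖ ^ 2 + c * ‖x‖ ^ (-2 : ℝ) * ‖z‖ ^ 2)| ≤ 2 * (1 + |c|) * D := by
      rw [abs_mul, abs_two, mul_assoc, mul_assoc]
      refine mul_le_mul_of_nonneg_left ((abs_add_le _ _).trans ?_) (by norm_num)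
      rw [abs_mul, abs_of_nonneg (sq_nonneg ‖w‖),
        abs_of_nonneg (by positivity : 0 ≤ ‖x‖ ^ (-2 : ℝ) * ‖z‖ ^ 2), add_mul, one_mul]
      gcongr
    have t2 : |a * (‖x‖ ^ (-b) * ‖z‖ ^ (σ + 2))| ≤ |a| * D := by
      rw [abs_mul, abs_of_nonneg (by positivity : 0 ≤ ‖x‖ ^ (-b) * ‖z‖ ^ (σ + 2))]
      gcongr
    unfold limDens
    calc _ ≤ _ := (abs_sub _ _).trans (add_le_add t1 t2)
      _ = _ := by ring

end

end INLS
end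

/-! ### The variance: uniform bounds, both virial identities, continuity of `|x|u`. -/

noncomputable section
namespace INLS

variable {d : ℕ}

section

variable {c b σ : ℝ} {I : Set ℝ} {u₀ : Space d → ℂ} {u : ℝ → Space d → ℂ}

theorem actForm_sqProfile (κ : ℝ → ℝ) (f : Space d → ℂ) (g : Space d → EuclideanSpace ℂ (Fin d)) :
    actForm (sqProfile κ) (fun _ => 0) f g = ∫ x, rad (sqProfile κ) x * ‖f x‖ ^ 2 := by
  simp only [actForm, re_mul_star_act_sqProfile]

theorem rad_sqProfile_nonneg (κ : ℝ → ℝ) (x : Space d) : 0 ≤ rad (sqProfile κ) x := by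
  by_cases hx : x = 0
  · rw [hx, rad_zero]
  · rw [rad_sqProfile hx]
    positivity

theorem rad_sqProfile_le {κ : ℝ → ℝ} (h : ∀ s, |κ s| ≤ 1) (x : Space d) :
    rad (sqProfile κ) x ≤ ‖x‖ ^ 2 := by
  by_cases hx : x = 0
  · rw [hx, rad_zero]
    positivity
  · rw [rad_sqProfile hx, mul_pow]
    have : κ (Real.log ‖x‖) ^ 2 ≤ 1 := by rw [sq_le_one_iff_abs_le_one]; exact h _
    nlinarith [sq_nonneg ‖x‖]

theorem integrable_weight_mul_sq {f : Space d → ℂ}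
    (hf : MemLp (fun x : Space d => ‖x‖ • f x) 2 volume) :
    Integrable (fun x => ‖x‖ ^ 2 * ‖f x‖ ^ 2) volume := by
  refine (integrable_norm_sq_of_memLp hf).congr (Eventually.of_forall fun x => ?_)
  simp only [norm_smul, norm_norm, mul_pow]

theorem ContH1.energy_ge (hd : 3 ≤ d) (hu : ContH1 I u) {t : ℝ} (ht : t ∈ I) :
    ∫ x, ‖weakGrad (u t) x‖ ^ 2 ≤ energy (u t) (weakGrad (u t)) :=
  integral_mono (integrable_norm_sq_of_memLp (hu.1 t ht).isPair.right)
    ((hu.1 t ht).isPair.integrable_dens hd) fun x => (le_dens _ x _ _).2.1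

/-- The time derivative of the truncated variance. -/
theorem abs_integral_virDens_sqProfile_le (hd : 3 ≤ d) (hu : ContH1 I u) {κ : ℝ → ℝ} {C ε : ℝ}
    (hκ : IsCut κ) (hε : 0 < ε) (h0 : ∀ s, |κ s| ≤ 1) (h1 : ∀ s, |deriv κ s| ≤ C) {t : ℝ}
    (ht : t ∈ I) :
    |∫ x, virDens c b σ (sqProfile κ) (fun _ => 0) x (u t x) (weakGrad (u t) x)|
      ≤ ε * (∫ x, rad (sqProfile κ) x * ‖u t x‖ ^ 2)
        + (4 * (1 + C) ^ 2 / ε) * energy (u t) (weakGrad (u t)) := by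
  have hp := (hu.1 t ht).isPair
  have i1 : Integrable (fun x => rad (sqProfile κ) x * ‖u t x‖ ^ 2) volume :=
    integrable_rad_mul hκ.sqProfile (integrable_norm_sq_of_memLp hp.left)
  have i2 := integrable_norm_sq_of_memLp hp.right
  have h := norm_integral_le_of_norm_le
    (f := fun x => virDens c b σ (sqProfile κ) (fun _ => 0) x (u t x) (weakGrad (u t) x))
    ((i1.const_mul ε).add (i2.const_mul (4 * (1 + C) ^ 2 / ε)))
    ((ae_ne_zero hd).mono fun x hx => abs_virDens_sqProfile_le hκ hx hε h0 h1)
  simp only [Pi.add_apply] at h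
  rw [integral_add (i1.const_mul ε) (i2.const_mul _), integral_const_mul, integral_const_mul] at h
  refine h.trans (add_le_add le_rfl ?_)
  exact mul_le_mul_of_nonneg_left (hu.energy_ge hd ht) (by positivity)

/-- Uniform bound for the truncated variances. -/
theorem IsSolution.exists_truncated_variance_le (hA : IsAdmissible d b σ)
    (hu : IsSolution c b σ I u₀ u) (hxu₀ : MemLp (fun x : Space d => ‖x‖ • u₀ x) 2 volume)
    (C : ℝ) {α β : ℝ} (hI : Set.Icc α β ⊆ I) (h0 : (0 : ℝ) ∈ Set.Icc α β) :
    ∃ B : ℝ, ∀ κ : ℝ → ℝ, IsCut κ → (∀ s, |κ s| ≤ 1) → (∀ s, |deriv κ s| ≤ C) →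
      ∀ t ∈ Set.Icc α β, ∫ x, rad (sqProfile κ) x * ‖u t x‖ ^ 2 ≤ B := by
  have hd := hA.three_le
  obtain ⟨E, hE, hEb⟩ := hu.contH1.exists_energy_le hd hI
  set L := β - α with hL
  have hL0 : 0 ≤ L := by linarith [h0.1, h0.2]
  -- Chosen so that `ε L ≤ 1/2`: the small multiple of the variance can be absorbed at the maximal
  -- time, in place of Gronwall's inequality.
  set ε := 1 / (2 * (L + 1)) with hε
  have hε0 : 0 < ε := by positivity
  set K := 4 * (1 + C) ^ 2 / ε * E with hK
  have hK0 : 0 ≤ K := by positivity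
  set V₀ := ∫ x, ‖x‖ ^ 2 * ‖u₀ x‖ ^ 2 with hV₀
  refine ⟨2 * V₀ + 2 * (K * L), fun κ hκ hκ0 hκ1 => ?_⟩
  set S : ℝ → ℝ := fun t => ∫ x, rad (sqProfile κ) x * ‖u t x‖ ^ 2 with hS
  have hSc : ContinuousOn S (Set.Icc α β) := by
    have := (hu.contH1.continuousOn_actForm hd hκ.sqProfile IsCut.zero).mono hI
    simpa only [actForm_sqProfile] using this
  -- At a maximum time `τ` of the truncated variance one has `S τ ≤ V₀ + (ε S τ + K) L`, hence a
  -- bound that does not depend on the cutoff.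
  obtain ⟨τ, hτ, hmax⟩ := isCompact_Icc.exists_isMaxOn ⟨0, h0⟩ hSc
  have hS0 : S 0 ≤ V₀ := by
    have e : S 0 = ∫ x, rad (sqProfile κ) x * ‖u₀ x‖ ^ 2 :=
      integral_congr_ae (hu.initial.mono fun x hx => by simp only [hx])
    rw [e]
    refine integral_mono_of_nonneg (Eventually.of_forall fun x =>
      mul_nonneg (rad_sqProfile_nonneg κ x) (sq_nonneg _)) (integrable_weight_mul_sq hxu₀)
      (Eventually.of_forall fun x => ?_)
    exact mul_le_mul_of_nonneg_right (rad_sqProfile_le hκ0 x) (sq_nonneg _)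
  have hSτ : 0 ≤ S τ := integral_nonneg fun x =>
    mul_nonneg (rad_sqProfile_nonneg κ x) (sq_nonneg _)
  have hdiff := hu.actForm_sub_eq' hA hκ.sqProfile IsCut.zero (hI h0) (hI hτ)
  rw [actForm_sqProfile, actForm_sqProfile] at hdiff
  have hb : ‖∫ t in (0 : ℝ)..τ, ∫ x, virDens c b σ (sqProfile κ) (fun _ => 0) x (u t x)
      (weakGrad (u t) x)‖ ≤ (ε * S τ + K) * |τ - 0| := by
    refine intervalIntegral.norm_integral_le_of_norm_le_const fun t ht => ?_
    have ht' : t ∈ Set.Icc α β := (Set.ordConnected_Icc.uIcc_subset h0 hτ) (Set.uIoc_subset_uIcc ht)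
    refine (abs_integral_virDens_sqProfile_le hd hu.contH1 hκ hε0 hκ0 hκ1 (hI ht')).trans ?_
    have h1 : S t ≤ S τ := hmax ht'
    have h2 := hEb t ht'
    rw [hK]
    gcongr
  rw [← hdiff] at hb
  have h3 : |τ - 0| ≤ L := by
    rw [sub_zero, abs_le]
    constructor <;> linarith [hτ.1, hτ.2, h0.1, h0.2]
  have h4 : S τ - S 0 ≤ (ε * S τ + K) * L :=
    (le_abs_self _).trans (hb.trans (mul_le_mul_of_nonneg_left h3 (by positivity)))
  have h5 : ε * L ≤ 1 / 2 := by
    rw [hε, div_mul_eq_mul_div, one_mul, div_le_div_iff₀ (by positivity) (by norm_num)]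
    linarith
  have h6 : ε * S τ * L ≤ 1 / 2 * S τ := by nlinarith
  intro t ht
  have h7 : S t ≤ S τ := hmax ht
  have h8 : S τ ≤ 2 * V₀ + 2 * (K * L) := by nlinarith
  exact h7.trans h8

/-- Time `0` is included because the bound on the variance starts from the initial datum. -/
theorem IsSolution.exists_Icc (hu : IsSolution c b σ I u₀ u) {t₁ t₂ : ℝ} (h₁ : t₁ ∈ I)
    (h₂ : t₂ ∈ I) : ∃ α β : ℝ, Set.Icc α β ⊆ I ∧ (0 : ℝ) ∈ Set.Icc α β ∧
      Set.uIcc t₁ t₂ ⊆ Set.Icc α β := by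
  have ha : min 0 (min t₁ t₂) ∈ I := by
    rcases min_choice 0 (min t₁ t₂) with h | h <;> rw [h]
    · exact hu.zero_mem
    · rcases min_choice t₁ t₂ with h | h <;> rwa [h]
  have hb : max 0 (max t₁ t₂) ∈ I := by
    rcases max_choice 0 (max t₁ t₂) with h | h <;> rw [h]
    · exact hu.zero_mem
    · rcases max_choice t₁ t₂ with h | h <;> rwa [h]
  exact ⟨_, _, hu.ordConnected.out ha hb, ⟨min_le_left _ _, le_max_left _ _⟩,
    Set.Icc_subset_Icc (min_le_right _ _) (le_max_right _ _)⟩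

theorem tendsto_rad_sqProfile {κ : ℕ → ℝ → ℝ}
    (h : ∀ s, ∀ᶠ n in atTop, κ n s = 1) {x : Space d} (hx : x ≠ 0) :
    ∀ᶠ n in atTop, rad (sqProfile (κ n)) x = ‖x‖ ^ 2 := by
  filter_upwards [h (Real.log ‖x‖)] with n hn
  rw [rad_sqProfile hx, hn, one_mul]

/-- Fatou's lemma for the truncated variances, whose bound is uniform in the cutoff. -/
theorem IsSolution.memLp_weight (hA : IsAdmissible d b σ)
    (hu : IsSolution c b σ I u₀ u) (hxu₀ : MemLp (fun x : Space d => ‖x‖ • u₀ x) 2 volume)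
    {t : ℝ} (ht : t ∈ I) : MemLp (fun x : Space d => ‖x‖ • u t x) 2 volume := by
  obtain ⟨κ, C, -, hκ, hκb, hκ1⟩ := exists_cutoffs
  obtain ⟨α, β, hI, h0, hsub⟩ := hu.exists_Icc ht ht
  obtain ⟨B, hB⟩ := hu.exists_truncated_variance_le hA hxu₀ C hI h0
  have hp := (hu.contH1.1 t ht).isPair
  have hm : AEStronglyMeasurable (fun x : Space d => ‖x‖ • u t x) volume :=
    continuous_norm.aestronglyMeasurable.smul hp.left.1
  rw [memLp_two_iff_integrable_sq_norm hm]
  refine ⟨hm.norm.pow 2, ?_⟩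
  rw [hasFiniteIntegral_iff_ofReal (Eventually.of_forall fun x => sq_nonneg _)]
  have hnn : ∀ n x, 0 ≤ rad (sqProfile (κ n)) x * ‖u t x‖ ^ 2 := fun n x =>
    mul_nonneg (rad_sqProfile_nonneg _ x) (sq_nonneg _)
  have hi : ∀ n, Integrable (fun x => rad (sqProfile (κ n)) x * ‖u t x‖ ^ 2) volume := fun n =>
    integrable_rad_mul (hκ n).sqProfile (integrable_norm_sq_of_memLp hp.left)
  calc ∫⁻ x, ENNReal.ofReal (‖‖x‖ • u t x‖ ^ 2)
      ≤ ∫⁻ x, liminf (fun n => ENNReal.ofReal (rad (sqProfile (κ n)) x * ‖u t x‖ ^ 2)) atTop := by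
        refine lintegral_mono_ae ((ae_ne_zero hA.three_le).mono fun x hx => ?_)
        have h1 : (fun n => ENNReal.ofReal (rad (sqProfile (κ n)) x * ‖u t x‖ ^ 2)) =ᶠ[atTop]
            fun _ => ENNReal.ofReal (‖‖x‖ • u t x‖ ^ 2) := by
          filter_upwards [tendsto_rad_sqProfile (fun s => (hκ1 s).mono fun n h => h.1) hx] with n hn
          rw [hn, norm_smul, norm_norm, mul_pow]
        rw [(tendsto_const_nhds.congr' h1.symm).liminf_eq]
    _ ≤ liminf (fun n => ∫⁻ x, ENNReal.ofReal (rad (sqProfile (κ n)) x * ‖u t x‖ ^ 2)) atTop :=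
        lintegral_liminf_le' fun n => (hi n).1.aemeasurable.ennreal_ofReal
    _ ≤ ENNReal.ofReal B := by
        refine liminf_le_of_frequently_le' (Frequently.of_forall fun n => ?_)
        rw [← ofReal_integral_eq_lintegral_ofReal (hi n) (Eventually.of_forall (hnn n))]
        exact ENNReal.ofReal_le_ofReal (hB _ (hκ n) (fun s => (hκb n s).1)
          (fun s => (hκb n s).2.1) t (hsub Set.left_mem_uIcc))
    _ < ⊤ := ENNReal.ofReal_lt_top

/-- The functional `Im ∫ ū x·∇u`. -/
def momentum (f : Space d → ℂ) : ℝ := ∫ x, (star (f x) * xdot x (weakGrad f x)).im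

theorem aestronglyMeasurable_im {f : Space d → ℂ} {g : Space d → EuclideanSpace ℂ (Fin d)}
    (hf : AEStronglyMeasurable f volume) (hg : AEStronglyMeasurable g volume) :
    AEStronglyMeasurable (fun x => (star (f x) * xdot x (g x)).im) volume :=
  Complex.continuous_im.comp_aestronglyMeasurable
    ((continuous_star.comp_aestronglyMeasurable hf).mul (aestronglyMeasurable_xdot hg))

theorem tendsto_truncated_variance (hd : 3 ≤ d) {κ : ℕ → ℝ → ℝ} (hκ : ∀ n, IsCut (κ n))
    (h0 : ∀ n s, |κ n s| ≤ 1) (h1 : ∀ s, ∀ᶠ n in atTop, κ n s = 1) {f : Space d → ℂ}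
    (hf : MemLp f 2 volume) (hxf : MemLp (fun x : Space d => ‖x‖ • f x) 2 volume) :
    Tendsto (fun n => ∫ x, rad (sqProfile (κ n)) x * ‖f x‖ ^ 2) atTop
      (𝓝 (∫ x, ‖x‖ ^ 2 * ‖f x‖ ^ 2)) := by
  refine tendsto_integral_of_dominated_convergence _ (fun n =>
    (integrable_rad_mul (hκ n).sqProfile (integrable_norm_sq_of_memLp hf)).1)
    (integrable_weight_mul_sq hxf) (fun n => Eventually.of_forall fun x => ?_)
    ((ae_ne_zero hd).mono fun x hx => ?_)
  · rw [Real.norm_eq_abs, abs_of_nonneg (mul_nonneg (rad_sqProfile_nonneg _ x) (sq_nonneg _))]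
    exact mul_le_mul_of_nonneg_right (rad_sqProfile_le (h0 n) x) (sq_nonneg _)
  · refine tendsto_const_nhds.congr' ?_
    filter_upwards [tendsto_rad_sqProfile h1 hx] with n hn
    rw [hn]

/-- First virial identity, in integrated form. -/
theorem IsSolution.variance_sub_eq (hA : IsAdmissible d b σ)
    (hu : IsSolution c b σ I u₀ u) (hxu₀ : MemLp (fun x : Space d => ‖x‖ • u₀ x) 2 volume)
    {α β : ℝ} (hα : α ∈ I) (hβ : β ∈ I) :
    (∫ x, ‖x‖ ^ 2 * ‖u β x‖ ^ 2) - (∫ x, ‖x‖ ^ 2 * ‖u α x‖ ^ 2)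
      = ∫ t in α..β, 4 * momentum (u t) := by
  have hd := hA.three_le
  obtain ⟨κ, C, hC, hκ, hκb, hκ1⟩ := exists_cutoffs
  refine hu.sub_eq_of_tendsto hA (ψ := fun n => sqProfile (κ n)) (k := fun _ _ => 0)
    (F := fun t => ∫ x, ‖x‖ ^ 2 * ‖u t x‖ ^ 2) (fun n => (hκ n).sqProfile) (fun _ => IsCut.zero)
    (fun t ht => ?_) (fun t ht => ?_) (fun t₁ h₁ t₂ h₂ => ?_) hα hβ
  · simp only [actForm_sqProfile]
    exact tendsto_truncated_variance hd hκ (fun n s => (hκb n s).1)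
      (fun s => (hκ1 s).mono fun n h => h.1) (hu.contH1.1 t ht).1 (hu.memLp_weight hA hxu₀ ht)
  · have hp := (hu.contH1.1 t ht).isPair
    have hw := integrable_weight_mul_sq (hu.memLp_weight hA hxu₀ ht)
    rw [momentum, ← integral_const_mul]
    -- The dominating function is the density estimate with `ε = 1`, integrable now that the
    -- variance is known to be finite.
    refine tendsto_integral_of_dominated_convergence
      (fun x => ‖x‖ ^ 2 * ‖u t x‖ ^ 2 + 4 * (1 + C) ^ 2 * ‖weakGrad (u t) x‖ ^ 2)
      (fun n => ?_) (hw.add ((integrable_norm_sq_of_memLp hp.right).const_mul _)) (fun n => ?_)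
      ((ae_ne_zero hd).mono fun x hx => ?_)
    · exact ((measurable_virDens (hκ n).sqProfile IsCut.zero).comp_aemeasurable
        (aemeasurable_id.prodMk (hp.left.1.aemeasurable.prodMk
          hp.right.1.aemeasurable))).aestronglyMeasurable
    · filter_upwards [ae_ne_zero hd] with x hx
      have h1 := abs_virDens_sqProfile_le (c := c) (b := b) (σ := σ) (z := u t x)
        (w := weakGrad (u t) x) (hκ n) hx one_pos
        (fun s => (hκb n s).1) (fun s => (hκb n s).2.1)
      have h2 := mul_le_mul_of_nonneg_right (rad_sqProfile_le (fun s => (hκb n s).1) x)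
        (sq_nonneg ‖u t x‖)
      rw [Real.norm_eq_abs]
      rw [one_mul, div_one] at h1
      linarith
    · refine tendsto_const_nhds.congr' ?_
      filter_upwards [hκ1 (Real.log ‖x‖)] with n hn
      rw [virDens_sqProfile (hκ n) hx, hn.1, hn.2.1]
      ring
  · obtain ⟨a, e, hI, h0, hsub⟩ := hu.exists_Icc h₁ h₂
    obtain ⟨B, hB⟩ := hu.exists_truncated_variance_le hA hxu₀ C hI h0
    obtain ⟨E, hE, hEb⟩ := hu.contH1.exists_energy_le hd hI
    refine ⟨B + 4 * (1 + C) ^ 2 * E, fun n t ht => ?_⟩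
    have h1 := abs_integral_virDens_sqProfile_le (c := c) (b := b) (σ := σ) hd hu.contH1 (hκ n)
      one_pos (fun s => (hκb n s).1) (fun s => (hκb n s).2.1) (hI (hsub ht))
    have h2 := hB _ (hκ n) (fun s => (hκb n s).1) (fun s => (hκb n s).2.1) t (hsub ht)
    have h3 := mul_le_mul_of_nonneg_left (hEb t (hsub ht)) (by positivity : 0 ≤ 4 * (1 + C) ^ 2)
    rw [one_mul, div_one] at h1
    linarith

/-- Second virial identity, in integrated form. -/
theorem IsSolution.momentum_sub_eq (hA : IsAdmissible d b σ)
    (hu : IsSolution c b σ I u₀ u) (hxu₀ : MemLp (fun x : Space d => ‖x‖ • u₀ x) 2 volume)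
    {α β : ℝ} (hα : α ∈ I) (hβ : β ∈ I) :
    momentum (u β) - momentum (u α)
      = ∫ t in α..β, ∫ x, limDens c b σ x (u t x) (weakGrad (u t) x) := by
  have hd := hA.three_le
  obtain ⟨κ, C, hC, hκ, hκb, hκ1⟩ := exists_cutoffs
  obtain ⟨C', hC', hb⟩ := exists_abs_virDens_zero_le (d := d) hA c hC
  refine hu.sub_eq_of_tendsto hA (ψ := fun _ _ => 0) (k := κ) (F := fun t => momentum (u t))
    (fun _ => IsCut.zero) hκ (fun t ht => ?_) (fun t ht => ?_) (fun t₁ h₁ t₂ h₂ => ?_) hα hβ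
  · have hp := (hu.contH1.1 t ht).isPair
    have hw := integrable_weight_mul_sq (hu.memLp_weight hA hxu₀ ht)
    simp only [actForm, re_mul_star_act_zero]
    have him := aestronglyMeasurable_im hp.left.1 hp.right.1
    refine tendsto_integral_of_dominated_convergence
      (fun x => ‖x‖ ^ 2 * ‖u t x‖ ^ 2 + ‖weakGrad (u t) x‖ ^ 2)
      (fun n => (hκ n).continuous_rad.aestronglyMeasurable.mul him)
      (hw.add (integrable_norm_sq_of_memLp hp.right)) (fun n => Eventually.of_forall fun x => ?_)
      ((ae_ne_zero hd).mono fun x hx => ?_)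
    · rw [Real.norm_eq_abs, abs_mul]
      have h1 := IsCut.abs_rad_le zero_le_one (fun s => (hκb n s).1) x
      have h2 := (Complex.abs_im_le_norm _).trans
        (norm_star_mul_xdot_le x (u t x) (weakGrad (u t) x))
      calc _ ≤ 1 * (‖x‖ * ‖u t x‖ * ‖weakGrad (u t) x‖) := by gcongr
        _ ≤ _ := by
            nlinarith [sq_nonneg (‖x‖ * ‖u t x‖ - ‖weakGrad (u t) x‖),
              sq_nonneg (‖x‖ * ‖u t x‖), sq_nonneg ‖weakGrad (u t) x‖]
    · refine tendsto_const_nhds.congr' ?_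
      filter_upwards [hκ1 (Real.log ‖x‖)] with n hn
      rw [rad_of_ne _ hx, hn.1, one_mul]
  · have hp := (hu.contH1.1 t ht).isPair
    refine tendsto_integral_of_dominated_convergence
      (fun x => C' * dens hardyWeight (sobolevExp d) x (u t x) (weakGrad (u t) x))
      (fun n => ?_) ((hp.integrable_dens hd).const_mul _)
      (fun n => (ae_ne_zero hd).mono fun x hx => hb _ (hκ n) (hκb n) x _ _ hx)
      ((ae_ne_zero hd).mono fun x hx => ?_)
    · exact ((measurable_virDens IsCut.zero (hκ n)).comp_aemeasurable
        (aemeasurable_id.prodMk (hp.left.1.aemeasurable.prodMk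
          hp.right.1.aemeasurable))).aestronglyMeasurable
    · refine tendsto_const_nhds.congr' ?_
      filter_upwards [hκ1 (Real.log ‖x‖)] with n hn
      rw [virDens_zero_eq_limDens hA.σ_pos (hκ n) hx hn.1 hn.2.1 hn.2.2]
  · have hsub : Set.uIcc t₁ t₂ ⊆ I := hu.ordConnected.uIcc_subset h₁ h₂
    obtain ⟨E, hE, hEb⟩ := hu.contH1.exists_energy_le hd hsub
    refine ⟨C' * E, fun n t ht => ?_⟩
    have hp := (hu.contH1.1 t (hsub ht)).isPair
    have h1 := norm_integral_le_of_norm_le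
      (f := fun x => virDens c b σ (fun _ => 0) (κ n) x (u t x) (weakGrad (u t) x))
      ((hp.integrable_dens hd).const_mul C')
      ((ae_ne_zero hd).mono fun x hx => hb _ (hκ n) (hκb n) x _ _ hx)
    rw [integral_const_mul] at h1
    exact h1.trans (mul_le_mul_of_nonneg_left (hEb t ht) hC')

theorem IsSolution.hasDerivWithinAt_momentum (hA : IsAdmissible d b σ)
    (hu : IsSolution c b σ I u₀ u) (hxu₀ : MemLp (fun x : Space d => ‖x‖ • u₀ x) 2 volume)
    {t : ℝ} (ht : t ∈ I) :
    HasDerivWithinAt (fun s => momentum (u s))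
      (∫ x, limDens c b σ x (u t x) (weakGrad (u t) x)) I t :=
  hasDerivWithinAt_of_sub_eq_integral hu.ordConnected
    (hu.contH1.continuousOn_integral_limDens hA c)
    (fun _ hα _ hβ => hu.momentum_sub_eq hA hxu₀ hα hβ) ht

theorem IsSolution.hasDerivWithinAt_variance (hA : IsAdmissible d b σ)
    (hu : IsSolution c b σ I u₀ u) (hxu₀ : MemLp (fun x : Space d => ‖x‖ • u₀ x) 2 volume)
    {t : ℝ} (ht : t ∈ I) :
    HasDerivWithinAt (fun s => ∫ x, ‖x‖ ^ 2 * ‖u s x‖ ^ 2) (4 * momentum (u t)) I t :=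
  hasDerivWithinAt_of_sub_eq_integral hu.ordConnected (G := fun t => 4 * momentum (u t))
    -- Continuity of the momentum, needed to differentiate the variance, comes from the second
    -- virial identity.
    (fun _ hs => ((hu.hasDerivWithinAt_momentum hA hxu₀ hs).const_mul 4).continuousWithinAt)
    (fun _ hα _ hβ => hu.variance_sub_eq hA hxu₀ hα hβ) ht

/-- The weight `‖x‖²` is split into its truncation, bounded and thus handled by continuity in `L²`,
and a tail. The tail of `u(s)` is the difference of two continuous functions of `s`, so it is small
for `s` near `t` as soon as it is small at `t`. -/
theorem IsSolution.contL2_weight (hA : IsAdmissible d b σ)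
    (hu : IsSolution c b σ I u₀ u) (hxu₀ : MemLp (fun x : Space d => ‖x‖ • u₀ x) 2 volume) :
    ContL2 I (fun t (x : Space d) => ‖x‖ • u t x) := by
  have hd := hA.three_le
  refine ⟨fun t ht => hu.memLp_weight hA hxu₀ ht, fun t ht => ?_⟩
  obtain ⟨κ, C, hC, hκ, hκb, hκ1⟩ := exists_cutoffs
  set W : ℝ → ℝ := fun s => ∫ x, ‖(fun x : Space d => ‖x‖ • u s x) x - ‖x‖ • u t x‖ ^ 2 with hW
  set V : ℝ → ℝ := fun s => ∫ x, ‖x‖ ^ 2 * ‖u s x‖ ^ 2 with hV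
  set S : ℕ → ℝ → ℝ := fun n s => ∫ x, rad (sqProfile (κ n)) x * ‖u s x‖ ^ 2 with hS
  have hm := fun s (hs : s ∈ I) => hu.memLp_weight hA hxu₀ hs
  have hl := fun s (hs : s ∈ I) => (hu.contH1.1 s hs).1
  have hVc : Tendsto V (𝓝[I] t) (𝓝 (V t)) :=
    (hu.hasDerivWithinAt_variance hA hxu₀ ht).continuousWithinAt
  have hSc : ∀ n, Tendsto (S n) (𝓝[I] t) (𝓝 (S n t)) := fun n => by
    have := hu.contH1.continuousOn_actForm hd (hκ n).sqProfile IsCut.zero t ht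
    simp only [actForm_sqProfile] at this
    exact this
  have hL2 : Tendsto (fun s => ∫ x, ‖u s x - u t x‖ ^ 2) (𝓝[I] t) (𝓝 0) := by
    have h1 := (((ENNReal.tendsto_toReal ENNReal.zero_ne_top).comp
      (hu.contH1.2.1.2 t ht))).pow 2
    simp only [ENNReal.toReal_zero, ne_eq, OfNat.ofNat_ne_zero, not_false_eq_true, zero_pow] at h1
    refine h1.congr' ?_
    filter_upwards [self_mem_nhdsWithin] with s hs
    have h2 := ofReal_integral_norm_sq ((hl s hs).sub (hl t ht))
    rw [Function.comp_apply, ← ENNReal.toReal_pow, ← h2, ENNReal.toReal_ofReal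
      (integral_nonneg fun x => sq_nonneg _)]
    rfl
  have key : ∀ n, ∃ Cn : ℝ, ∀ s ∈ I,
      W s ≤ Cn * (∫ x, ‖u s x - u t x‖ ^ 2) + 2 * (V s - S n s) + 2 * (V t - S n t) := by
    intro n
    obtain ⟨Cn, hCn, hCb⟩ := (hκ n).sqProfile.exists_bound
    refine ⟨Cn, fun s hs => ?_⟩
    have iw := fun s hs => integrable_weight_mul_sq (hm s hs)
    have ir := fun s hs => integrable_rad_mul (hκ n).sqProfile
      (integrable_norm_sq_of_memLp (hl s hs))
    have id : Integrable (fun x => ‖u s x - u t x‖ ^ 2) volume :=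
      integrable_norm_sq_of_memLp ((hl s hs).sub (hl t ht))
    have i1 : ∀ s ∈ I, Integrable (fun x => ‖x‖ ^ 2 * ‖u s x‖ ^ 2
        - rad (sqProfile (κ n)) x * ‖u s x‖ ^ 2) volume := fun s hs => (iw s hs).sub (ir s hs)
    have i2 : Integrable (fun x => Cn * ‖u s x - u t x‖ ^ 2 + 2 * (‖x‖ ^ 2 * ‖u s x‖ ^ 2
        - rad (sqProfile (κ n)) x * ‖u s x‖ ^ 2)) volume :=
      (id.const_mul Cn).add ((i1 s hs).const_mul 2)
    have i3 : Integrable (fun x => Cn * ‖u s x - u t x‖ ^ 2 + 2 * (‖x‖ ^ 2 * ‖u s x‖ ^ 2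
        - rad (sqProfile (κ n)) x * ‖u s x‖ ^ 2) + 2 * (‖x‖ ^ 2 * ‖u t x‖ ^ 2
        - rad (sqProfile (κ n)) x * ‖u t x‖ ^ 2)) volume := i2.add ((i1 t ht).const_mul 2)
    have e : Cn * (∫ x, ‖u s x - u t x‖ ^ 2) + 2 * (V s - S n s) + 2 * (V t - S n t)
        = ∫ x, (Cn * ‖u s x - u t x‖ ^ 2 + 2 * (‖x‖ ^ 2 * ‖u s x‖ ^ 2
        - rad (sqProfile (κ n)) x * ‖u s x‖ ^ 2) + 2 * (‖x‖ ^ 2 * ‖u t x‖ ^ 2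
        - rad (sqProfile (κ n)) x * ‖u t x‖ ^ 2)) := by
      rw [integral_add i2 ((i1 t ht).const_mul 2), integral_add (id.const_mul Cn)
        ((i1 s hs).const_mul 2), integral_const_mul, integral_const_mul, integral_const_mul,
        integral_sub (iw s hs) (ir s hs), integral_sub (iw t ht) (ir t ht)]
    rw [e]
    refine integral_mono (integrable_norm_sq_of_memLp ((hm s hs).sub (hm t ht))) i3 fun x => ?_
    simp only
    rw [← smul_sub, norm_smul, norm_norm, mul_pow]
    have h1 : rad (sqProfile (κ n)) x ≤ Cn :=
      (le_abs_self _).trans (IsCut.abs_rad_le hCn.le hCb x)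
    have h2 : 0 ≤ ‖x‖ ^ 2 - rad (sqProfile (κ n)) x :=
      sub_nonneg.2 (rad_sqProfile_le (fun s => (hκb n s).1) x)
    have h3 : ‖u s x - u t x‖ ^ 2 ≤ 2 * ‖u s x‖ ^ 2 + 2 * ‖u t x‖ ^ 2 := by
      have := norm_sub_le (u s x) (u t x)
      nlinarith [sq_nonneg (‖u s x‖ - ‖u t x‖), norm_nonneg (u s x - u t x),
        norm_nonneg (u s x), norm_nonneg (u t x)]
    nlinarith [mul_le_mul_of_nonneg_right h1 (sq_nonneg ‖u s x - u t x‖),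
      mul_le_mul_of_nonneg_left h3 h2]
  have hW0 : Tendsto W (𝓝[I] t) (𝓝 0) := by
    have hnn : ∀ s, 0 ≤ W s := fun s => integral_nonneg fun x => sq_nonneg _
    rw [tendsto_order]
    refine ⟨fun a ha => Eventually.of_forall fun s => ha.trans_le (hnn s), fun a ha => ?_⟩
    -- The limit of the bound in `key` as `s → t` is `4(V t - S n t)`, two halves coming from the
    -- tails at `s` and at `t`.
    have hSn : Tendsto (fun n => 4 * (V t - S n t)) atTop (𝓝 0) := by
      have := tendsto_truncated_variance hd hκ (fun n s => (hκb n s).1)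
        (fun s => (hκ1 s).mono fun n h => h.1) (hl t ht) (hm t ht)
      have h1 := (tendsto_const_nhds (x := V t)).sub this
      rw [show (∫ x, ‖x‖ ^ 2 * ‖u t x‖ ^ 2) = V t from rfl, sub_self] at h1
      simpa using h1.const_mul 4
    obtain ⟨n, hn⟩ := (hSn.eventually (gt_mem_nhds ha)).exists
    obtain ⟨Cn, hCn⟩ := key n
    have hlim : Tendsto (fun s => Cn * (∫ x, ‖u s x - u t x‖ ^ 2) + 2 * (V s - S n s)
        + 2 * (V t - S n t)) (𝓝[I] t) (𝓝 (4 * (V t - S n t))) := by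
      have := ((hL2.const_mul Cn).add ((hVc.sub (hSc n)).const_mul 2)).add_const
        (2 * (V t - S n t))
      refine this.trans_eq ?_
      congr 1
      ring
    filter_upwards [hlim.eventually (gt_mem_nhds hn), self_mem_nhdsWithin] with s hs hsI
    exact (hCn s hsI).trans_lt hs
  have h1 : Tendsto (fun s => (ENNReal.ofReal (W s)) ^ (1 / 2 : ℝ)) (𝓝[I] t) (𝓝 0) := by
    have h2 := ENNReal.tendsto_ofReal hW0
    have h3 := ((ENNReal.continuous_rpow_const (y := (1 / 2 : ℝ))).tendsto _).comp h2
    rw [ENNReal.ofReal_zero, ENNReal.zero_rpow_of_pos (by norm_num)] at h3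
    exact h3
  refine h1.congr' ?_
  filter_upwards [self_mem_nhdsWithin] with s hs
  have h2 := ofReal_integral_norm_sq ((hm s hs).sub (hm t ht))
  have h3 : ENNReal.ofReal (W s) = eLpNorm ((fun x : Space d => ‖x‖ • u s x)
      - fun x => ‖x‖ • u t x) 2 volume ^ 2 := h2
  rw [h3, ← ENNReal.rpow_natCast, ← ENNReal.rpow_mul]
  norm_num

end

end INLS
end

/-! ### The virial identity. -/

theorem lemma4p5 (d : ℕ) (hd : 3 ≤ d) (b c σ : ℝ) (hb0 : 0 < b) (hb2 : b < 2)
    (hc : -(((d : ℝ) - 2) / 2) ^ 2 < c)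
    (hσ0 : 0 < σ) (hσ : σ ≤ (4 - 2 * b) / ((d : ℝ) - 2))
    (u₀ : INLS.Space d → ℂ) (hu₀ : INLS.MemH1 u₀)
    (hxu₀ : MemLp (fun x : INLS.Space d => ‖x‖ • u₀ x) 2 volume)
    (I : Set ℝ) (u : ℝ → INLS.Space d → ℂ) (hu : INLS.IsSolution c b σ I u₀ u) :
    INLS.ContL2 I (fun t (x : INLS.Space d) => ‖x‖ • u t x) ∧
    (∀ t ∈ I,
      Integrable (fun x : INLS.Space d => ‖x‖ ^ (-2 : ℝ) * ‖u t x‖ ^ 2) volume ∧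
      Integrable (fun x : INLS.Space d => ‖x‖ ^ (-b) * ‖u t x‖ ^ (σ + 2)) volume) ∧
    ∃ V' : ℝ → ℝ, ∀ t ∈ I,
      HasDerivWithinAt (fun s => ∫ x : INLS.Space d, ‖x‖ ^ 2 * ‖u s x‖ ^ 2) (V' t) I t ∧
      HasDerivWithinAt V'
        (8 * INLS.normSqH1c c (u t)
          - 4 * (d * σ + 2 * b) / (σ + 2) * INLS.potential b σ (u t)) I t := by
  have hA : INLS.IsAdmissible d b σ := ⟨hd, hb0, hb2, hσ0, hσ⟩
  have hp := fun t (ht : t ∈ I) => (hu.contH1.1 t ht).isPair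
  refine ⟨hu.contL2_weight hA hxu₀, fun t ht => ⟨(hp t ht).integrable_hardy hd,
    (hp t ht).integrable_potential hA⟩, fun t => 4 * INLS.momentum (u t), fun t ht =>
    ⟨hu.hasDerivWithinAt_variance hA hxu₀ ht, ?_⟩⟩
  refine ((hu.hasDerivWithinAt_momentum hA hxu₀ ht).const_mul 4).congr_deriv ?_
  rw [(hp t ht).integral_limDens hA]
  ring
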